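/- Let $(M,\Phi,\Phi^\vee)$ be a reduced root datum ($M$ a free $\mathbb Z$-module of finite rank, $\Phi\subset M$ the finite set of roots, $\alpha\mapsto\alpha^\vee\in M^\vee$ the coroot map), with a fixed basis of simple roots, reflections $s_\alpha(\lambda)=\lambda-\alpha^\vee(\lambda)\alpha$, and Weyl group $W$ with longest element $w_0$ of length $N$. Let $R$ be a commutative ring and $F$ a (one-dimensional, commutative) formal group law over $R$. *Formal group ring.* Let $R[[x_M]]$ be the completion of the polynomial ring $R[x_\lambda,\lambda\in M]$ with respect to the ideal generated by the variables. The formal group ring $R[[M]]_F$ is the quotient of $R[[x_M]]$ by the closure of the ideal generated by $x_0$ and all $x_{\lambda+\mu}-F(x_\lambda,x_\mu)$, $\lambda,\mu\in M$. Let $\varepsilon:R[[M]]_F\to R$, $x_\lambda\mapsto 0$, be the augmentation. A homomorphism $M\to M'$ of abelian groups induces a homomorphism $R[[M]]_F\to R[[M']]_F$ of $R$-algebras, $x_\lambda\mapsto x_{f(\lambda)}$; in particular $W$ acts on $R[[M]]_F$. *Demazure operators.* For a root $\alpha$ the $R$-linear operator $\Delta_\alpha(u)=\frac{u-s_\alpha(u)}{x_\alpha}$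 on $R[[M]]_F$ is defined, even when $x_\alpha$ is a zero divisor, as follows. In $R[[M\oplus\mathbb Z]]_F\cong R[[M]]_F[[y]]$, where $y=x_{(0,1)}$ is regular, the difference of the images of $u$ under the maps induced by $\lambda\mapsto(\lambda,0)$ and $\lambda\mapsto(\lambda,-\alpha^\vee(\lambda))$ is $y\cdot z$ for a unique $z$; then $\Delta_\alpha(u)$ is the image of $z$ under the map induced by $M\oplus\mathbb Z\to M$, $(\lambda,n)\mapsto\lambda+n\alpha$. Thus $x_\alpha\Delta_\alpha(u)=u-s_\alpha(u)$, and $\Delta_\alpha$ is compatible with change of $(R,F)$. *Dual and characteristic map.* Let $\mathcal D(M)_F$ be the $R$-subalgebra of $\mathrm{End}_R(R[[M]]_F)$ generated by the $\Delta_\alpha$ for all roots $\alpha$ and by the multiplications by elements of $R[[M]]_F$. Let $\varepsilon\mathcal D(M)_F$ be the $R$-module of all linear forms $\varepsilon\circ D:R[[M]]_F\to R$ with $D\in\mathcal D(M)_F$, let $\mathcal H(M)_F=\mathrm{Hom}_R(\varepsilon\mathcal D(M)_F,R)$ be its $R$-dual, and let the characteristic map $\mathfrak c:R[[M]]_F\to\mathcal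 H(M)_F$ send $u$ to the evaluation $\varepsilon D\mapsto\varepsilon(D(u))$. *Torsion index.* Let $\mathfrak t$ be the torsion index of the root datum: the least positive integer of the form $\Delta_{w_0}(a)$ with $a\in S^N(M)$, where $\Delta_{w_0}=\Delta_{i_1}\circ\cdots\circ\Delta_{i_N}$ for a reduced decomposition $w_0=s_{i_1}\cdots s_{i_N}$ into simple reflections, and $\Delta_i(u)=(u-s_i(u))/\alpha_i$ are the classical divided differences on the symmetric algebra $S^*(M)$ over $\mathbb Z$. **Theorem.** Suppose that (the image of) $\mathfrak t$ is regular, i.e. not a zero divisor, in $R$. Then there is a unique (commutative, unital) ring structure on the additive group $\mathcal H(M)_F$ such that the characteristic map $\mathfrak c:R[[M]]_F\to\mathcal H(M)_F$ is a ring homomorphism. Moreover its multiplication is $R$-bilinear, so that it is an $R$-algebra structure on the $R$-module $\mathcal H(M)_F$. -/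

import Mathlib

noncomputable section

namespace FormalGroupRing

open MvPolynomial

/-! ### The power series ring `R⟦x_S⟧` on a possibly infinite set of variables -/

section PowerSeriesRing

variable (R : Type*) [CommRing R]

/-- `R⟦x_S⟧`: the completion of the polynomial ring `R[x_S]` with respect to the ideal generated by
the variables, which is the kernel of the augmentation `x_s ↦ 0`. -/
abbrev PowSer (S : Type*) : Type _ :=
  AdicCompletion (idealOfVars S R) (MvPolynomial S R)

variable {S T U : Type*}

lemma idealOfVars_pow_le_comap_rename (f : S → T) (n : ℕ) :
    idealOfVars S R ^ n ≤ (idealOfVars T R ^ n).comap (rename f : _ →ₐ[R] _) := by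
  refine le_trans (Ideal.pow_right_mono ?_ n) (Ideal.le_comap_pow _ n)
  rw [idealOfVars, Ideal.span_le]
  rintro _ ⟨s, rfl⟩
  simpa using Ideal.subset_span (Set.mem_range_self (f s))

/-- The map `R⟦x_S⟧ → R[x_T] / (x_T)^n` with `x_s ↦ x_{f(s)}`. -/
def PowSer.renameLevel (f : S → T) (n : ℕ) :
    PowSer R S →ₐ[R] MvPolynomial T R ⧸ idealOfVars T R ^ n :=
  (Ideal.quotientMapₐ (idealOfVars T R ^ n) (MvPolynomial.rename f)
    (idealOfVars_pow_le_comap_rename R f n)).comp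
      ((AdicCompletion.evalₐ (idealOfVars S R) n).restrictScalars R)

lemma PowSer.renameLevel_mk (f : S → T) (n : ℕ)
    (a : AdicCompletion.AdicCauchySequence (idealOfVars S R) (MvPolynomial S R)) :
    PowSer.renameLevel R f n (AdicCompletion.mk _ _ a) =
      Ideal.Quotient.mk _ (MvPolynomial.rename f (a n)) := by
  simp [PowSer.renameLevel]

lemma PowSer.factor_renameLevel (f : S → T) {m n : ℕ} (hle : m ≤ n) :
    (Ideal.Quotient.factorₐ R (Ideal.pow_le_pow_right hle)).comp (PowSer.renameLevel R f n) =
      PowSer.renameLevel R f m := by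
  ext x
  obtain ⟨a, rfl⟩ := AdicCompletion.mk_surjective _ _ x
  simp only [AlgHom.comp_apply, PowSer.renameLevel_mk]
  simp only [Ideal.Quotient.factorₐ_apply_mk]
  rw [Ideal.Quotient.eq, ← map_sub]
  refine idealOfVars_pow_le_comap_rename R f m ?_
  have h := a.2 hle
  rw [SModEq.sub_mem] at h
  rw [← neg_mem_iff, neg_sub]
  simpa using h

/-- The continuous `R`-algebra homomorphism `R⟦x_S⟧ → R⟦x_T⟧` with `x_s ↦ x_{f(s)}`. -/
def PowSer.rename (f : S → T) : PowSer R S →ₐ[R] PowSer R T :=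
  AdicCompletion.liftAlgHom (idealOfVars T R) (PowSer.renameLevel R f)
    (fun hle ↦ PowSer.factor_renameLevel R f hle)

/-- The variable `x_s` of `R⟦x_S⟧`. -/
def PowSer.x (s : S) : PowSer R S := AdicCompletion.of _ _ (X s)

/-- The ideal of the elements of `R⟦x_S⟧` of valuation at least `n`. These ideals are a fundamental
system of neighbourhoods of `0` for the topology of the completion. -/
def PowSer.valIdeal (S : Type*) (n : ℕ) : Ideal (PowSer R S) :=
  RingHom.ker (AdicCompletion.evalₐ (idealOfVars S R) n)

/-- The closure `⋂ n, (J + {valuation ≥ n})` of an ideal of `R⟦x_S⟧`. -/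
def PowSer.closure (J : Ideal (PowSer R S)) : Ideal (PowSer R S) :=
  ⨅ n : ℕ, J ⊔ PowSer.valIdeal R S n

lemma aeval_zero_of_mem_idealOfVars {S : Type*} (a : MvPolynomial S R)
    (ha : a ∈ idealOfVars S R ^ 1) : MvPolynomial.aeval (fun _ : S ↦ (0 : R)) a = 0 := by
  rw [pow_one] at ha
  have h : idealOfVars S R ≤ RingHom.ker (MvPolynomial.aeval (fun _ : S ↦ (0 : R))) := by
    rw [idealOfVars, Ideal.span_le]
    rintro _ ⟨s, rfl⟩
    simp
  exact h ha

/-- The augmentation `R⟦x_S⟧ → R`, `x_s ↦ 0`. -/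
def PowSer.aug (S : Type*) : PowSer R S →ₐ[R] R :=
  (Ideal.Quotient.liftₐ (idealOfVars S R ^ 1) (MvPolynomial.aeval (fun _ : S ↦ (0 : R)))
    (aeval_zero_of_mem_idealOfVars R)).comp
      ((AdicCompletion.evalₐ (idealOfVars S R) 1).restrictScalars R)

lemma PowSer.aug_eq_of_evalₐ (u : PowSer R S) (p : MvPolynomial S R)
    (h : AdicCompletion.evalₐ (idealOfVars S R) 1 u = Ideal.Quotient.mk _ p) :
    PowSer.aug R S u = MvPolynomial.aeval (fun _ : S ↦ (0 : R)) p := by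
  rw [PowSer.aug, AlgHom.comp_apply, AlgHom.restrictScalars_apply, h]
  exact Ideal.Quotient.lift_mk _ _ _

lemma PowSer.evalₐ_rename (f : S → T) (n : ℕ) (u : PowSer R S) :
    AdicCompletion.evalₐ (idealOfVars T R) n (PowSer.rename R f u) = PowSer.renameLevel R f n u :=
  AdicCompletion.evalₐ_liftAlgHom _ _ _ _ _

lemma PowSer.rename_x (f : S → T) (s : S) : PowSer.rename R f (PowSer.x R s) = PowSer.x R (f s) := by
  refine AdicCompletion.ext_evalₐ fun n ↦ ?_
  rw [PowSer.evalₐ_rename]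
  simp [PowSer.renameLevel, PowSer.x]

lemma PowSer.rename_rename (f : S → T) (g : T → U) (u : PowSer R S) :
    PowSer.rename R g (PowSer.rename R f u) = PowSer.rename R (g ∘ f) u := by
  refine AdicCompletion.ext_evalₐ fun n ↦ ?_
  rw [PowSer.evalₐ_rename, PowSer.evalₐ_rename, PowSer.renameLevel, AlgHom.comp_apply,
    AlgHom.restrictScalars_apply, PowSer.evalₐ_rename]
  obtain ⟨a, rfl⟩ := AdicCompletion.mk_surjective _ _ u
  simp [PowSer.renameLevel_mk, MvPolynomial.rename_rename]

lemma PowSer.valIdeal_le_comap_rename (f : S → T) (n : ℕ) :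
    PowSer.valIdeal R S n ≤ (PowSer.valIdeal R T n).comap (PowSer.rename R f) := by
  intro u hu
  have hu' : AdicCompletion.evalₐ (idealOfVars S R) n u = 0 := hu
  change AdicCompletion.evalₐ (idealOfVars T R) n (PowSer.rename R f u) = 0
  rw [PowSer.evalₐ_rename, PowSer.renameLevel, AlgHom.comp_apply, AlgHom.restrictScalars_apply, hu',
    map_zero]

lemma PowSer.closure_le_comap_rename (f : S → T) {J : Ideal (PowSer R S)} {K : Ideal (PowSer R T)}
    (h : J ≤ K.comap (PowSer.rename R f)) :
    PowSer.closure R J ≤ (PowSer.closure R K).comap (PowSer.rename R f) := by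
  intro u hu
  simp only [PowSer.closure, Ideal.mem_comap, Ideal.mem_iInf] at hu ⊢
  intro n
  have : J ⊔ PowSer.valIdeal R S n ≤ (K ⊔ PowSer.valIdeal R T n).comap (PowSer.rename R f) :=
    sup_le (h.trans (Ideal.comap_mono le_sup_left))
      ((PowSer.valIdeal_le_comap_rename R f n).trans (Ideal.comap_mono le_sup_right))
  exact this (hu n)

lemma PowSer.aug_rename (f : S → T) (u : PowSer R S) :
    PowSer.aug R T (PowSer.rename R f u) = PowSer.aug R S u := by
  obtain ⟨a, rfl⟩ := AdicCompletion.mk_surjective _ _ u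
  rw [PowSer.aug_eq_of_evalₐ R _ (MvPolynomial.rename f (a 1))
      (by rw [PowSer.evalₐ_rename, PowSer.renameLevel_mk]),
    PowSer.aug_eq_of_evalₐ R _ (a 1) (by simp), MvPolynomial.aeval_rename]
  rfl

lemma PowSer.aug_x (s : S) : PowSer.aug R S (PowSer.x R s) = 0 := by
  rw [PowSer.aug_eq_of_evalₐ R _ (X s) (by simp [PowSer.x])]
  simp

lemma PowSer.valIdeal_one_le_ker_aug : PowSer.valIdeal R S 1 ≤ RingHom.ker (PowSer.aug R S) := by
  intro u hu
  have hu' : AdicCompletion.evalₐ (idealOfVars S R) 1 u = 0 := hu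
  rw [RingHom.mem_ker, PowSer.aug, AlgHom.comp_apply, AlgHom.restrictScalars_apply, hu', map_zero]

end PowerSeriesRing

/-! ### The formal group ring `R⟦M⟧_F` -/

section FormalGroupRing

variable {R : Type*} [CommRing R] (F : FormalGroup R)
variable (M : Type*) [AddCommGroup M] {M' M'' : Type*} [AddCommGroup M'] [AddCommGroup M'']

variable {M} in
/-- The element `F(x_a, x_b)` of `R⟦x_M⟧`. -/
def fglSum (a b : M) : PowSer R M :=
  PowSer.rename R ![a, b] (MvPowerSeries.toAdicCompletion (Fin 2) R F.toPowerSeries)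

/-- The ideal of `R⟦x_M⟧` generated by `x_0` and all `x_{a + b} - F(x_a, x_b)`. -/
def relIdeal : Ideal (PowSer R M) :=
  Ideal.span ({PowSer.x R (0 : M)} ∪
    Set.range fun p : M × M ↦ PowSer.x R (p.1 + p.2) - fglSum F p.1 p.2)

/-- The formal group ring `R⟦M⟧_F`: the quotient of `R⟦x_M⟧` by the closure of the ideal generated
by `x_0` and all `x_{a + b} - F(x_a, x_b)`. -/
abbrev FGRing : Type _ := PowSer R M ⧸ PowSer.closure R (relIdeal F M)

namespace FGRing

variable {M} in
/-- The class of `x_a` in `R⟦M⟧_F`. -/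
def x (a : M) : FGRing F M := Ideal.Quotient.mk _ (PowSer.x R a)

variable {M}

lemma relIdeal_le_comap_rename (f : M →+ M') :
    relIdeal F M ≤ (relIdeal F M').comap (PowSer.rename R f) := by
  rw [relIdeal, Ideal.span_le, Set.union_subset_iff]
  constructor
  · rintro _ rfl
    refine Ideal.subset_span (Or.inl ?_)
    simp [PowSer.rename_x]
  · rintro _ ⟨⟨a, b⟩, rfl⟩
    refine Ideal.subset_span (Or.inr ⟨(f a, f b), ?_⟩)
    have : (⇑f ∘ ![a, b]) = ![f a, f b] := by
      ext i; fin_cases i <;> rfl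
    simp [PowSer.rename_x, fglSum, PowSer.rename_rename, this]

/-- The `R`-algebra homomorphism `R⟦M⟧_F → R⟦M'⟧_F`, `x_a ↦ x_{f(a)}`, induced by a homomorphism
`f : M → M'` of abelian groups. -/
def map (f : M →+ M') : FGRing F M →ₐ[R] FGRing F M' :=
  Ideal.quotientMapₐ _ (PowSer.rename R f)
    (PowSer.closure_le_comap_rename R f (relIdeal_le_comap_rename F f))

lemma map_x (f : M →+ M') (a : M) : map F f (x F a) = x F (f a) := by
  simp [map, x, PowSer.rename_x]

lemma map_map (f : M →+ M') (g : M' →+ M'') (u : FGRing F M) :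
    map F g (map F f u) = map F (g.comp f) u := by
  obtain ⟨u, rfl⟩ := Ideal.Quotient.mk_surjective u
  simp [map, PowSer.rename_rename]

lemma map_id (u : FGRing F M) : map F (AddMonoidHom.id M) u = u := by
  obtain ⟨u, rfl⟩ := Ideal.Quotient.mk_surjective u
  simp only [map, Ideal.quotient_map_mkₐ, Ideal.Quotient.mkₐ_eq_mk]
  congr 1
  refine AdicCompletion.ext_evalₐ fun n ↦ ?_
  obtain ⟨a, rfl⟩ := AdicCompletion.mk_surjective _ _ u
  rw [PowSer.evalₐ_rename, PowSer.renameLevel_mk]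
  simp [MvPolynomial.rename_id]

lemma evalₐ_toAdicCompletion (n : ℕ) (p : MvPowerSeries (Fin 2) R) :
    AdicCompletion.evalₐ (idealOfVars (Fin 2) R) n (MvPowerSeries.toAdicCompletion (Fin 2) R p) =
      Ideal.Quotient.mk _ (MvPowerSeries.truncTotal n p) :=
  AdicCompletion.evalₐ_liftAlgHom _ (MvPowerSeries.truncTotalAlgHom (Fin 2) R)
    (fun h ↦ AlgHom.ext fun _ ↦ by
      simpa [Ideal.Quotient.mk_eq_mk_iff_sub_mem] using
        MvPowerSeries.truncTotal_sub_truncTotal_mem_pow_idealOfVars h (le_refl _) _) n p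

lemma relIdeal_le_ker_aug : relIdeal F M ≤ RingHom.ker (PowSer.aug R M) := by
  rw [relIdeal, Ideal.span_le, Set.union_subset_iff]
  constructor
  · rintro _ rfl
    exact PowSer.aug_x R _
  · rintro _ ⟨⟨a, b⟩, rfl⟩
    have h : PowSer.aug R (Fin 2) (MvPowerSeries.toAdicCompletion (Fin 2) R F.toPowerSeries) = 0 := by
      rw [PowSer.aug_eq_of_evalₐ R _ (MvPowerSeries.truncTotal 1 F.toPowerSeries)
        (evalₐ_toAdicCompletion 1 F.toPowerSeries)]
      have := MvPowerSeries.constantCoeff_truncTotal_eq_ite (n := 1) F.toPowerSeries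
      rw [if_pos one_pos, F.zero_constantCoeff] at this
      rw [MvPolynomial.aeval_zero', this, map_zero]
    simp [RingHom.mem_ker, PowSer.aug_x, fglSum, PowSer.aug_rename, h]

variable (M) in
/-- The augmentation `ε : R⟦M⟧_F → R`, `x_a ↦ 0`. -/
def aug : FGRing F M →ₐ[R] R :=
  Ideal.Quotient.liftₐ _ (PowSer.aug R M) fun _ hu ↦
    (sup_le (relIdeal_le_ker_aug F) (PowSer.valIdeal_one_le_ker_aug R))
      ((Ideal.mem_iInf.mp hu) 1)

end FGRing

end FormalGroupRing

/-! ### Demazure operators and the dual of the augmented operator module -/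

section Operators

variable {ι M N : Type*} [AddCommGroup M] [AddCommGroup N] (P : RootDatum ι M N)
variable {R : Type*} [CommRing R] (F : FormalGroup R)

/-- The homomorphism `M → M × ℤ`, `a ↦ (a, -⟨a, α_i^∨⟩)`. -/
def shiftHom (i : ι) : M →+ M × ℤ :=
  (AddMonoidHom.id M).prod (-(P.coroot' i).toAddMonoidHom)

/-- The homomorphism `M × ℤ → M`, `(a, n) ↦ a + n α_i`. -/
def specHom (i : ι) : M × ℤ →+ M :=
  (AddMonoidHom.id M).coprod (zmultiplesHom M (P.root i))

/-- `D` is the Demazure operator `Δ_α`, `α = α_i`, on `R⟦M⟧_F`, that is, the divided difference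
`u ↦ (u - s_α(u)) / x_α`. As `x_α` may be a zero divisor in `R⟦M⟧_F`, the division is carried
out generically: in `R⟦M ⊕ ℤ⟧_F = R⟦M⟧_F⟦y⟧`, where `y = x_{(0,1)}` is always a regular element,
the difference between `u` and its image under `x_a ↦ x_{(a, -⟨a, α^∨⟩)} = x_a - ⟨a, α^∨⟩ ⬝ y`
(operations of `F`) has a unique quotient `z` by `y`, and `Δ_α(u)` is the value of `z` at
`y = x_α`. This operator satisfies `x_α Δ_α(u) = u - s_α(u)`, and it commutes with the change of
`(R, F)`, so that it is the specialization of the operator over the Lazard ring, for which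
`x_α` is regular. -/
def IsDemazureOperator (i : ι) (D : Module.End R (FGRing F M)) : Prop :=
  ∀ u : FGRing F M, ∃ z : FGRing F (M × ℤ),
    FGRing.x F ((0, 1) : M × ℤ) * z =
      FGRing.map F (AddMonoidHom.inl M ℤ) u - FGRing.map F (shiftHom P i) u ∧
    D u = FGRing.map F (specHom P i) z

lemma IsDemazureOperator.x_mul {P : RootDatum ι M N} {F : FormalGroup R} {i : ι}
    {D : Module.End R (FGRing F M)} (h : IsDemazureOperator P F i D) (u : FGRing F M) :
    FGRing.x F (P.root i) * D u =
      u - FGRing.map F (P.reflection i).toLinearMap.toAddMonoidHom u := by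
  obtain ⟨z, hz, hD⟩ := h u
  have h1 : (specHom P i).comp (AddMonoidHom.inl M ℤ) = AddMonoidHom.id M := by
    ext a; simp [specHom]
  have h2 : (specHom P i).comp (shiftHom P i) =
      (P.reflection i).toLinearMap.toAddMonoidHom := by
    ext a; simp [specHom, shiftHom, RootPairing.reflection_apply, sub_eq_add_neg]
  have h3 := congrArg (FGRing.map F (specHom P i)) hz
  rw [map_mul, FGRing.map_x, map_sub, FGRing.map_map, FGRing.map_map, h1, h2, FGRing.map_id] at h3
  rw [hD, ← h3]
  simp [specHom]

/-- `𝒟(M)_F`: the `R`-subalgebra of the `R`-linear endomorphisms of `R⟦M⟧_F` generated by the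
Demazure operators of all roots and by the multiplications by elements of `R⟦M⟧_F`. -/
def operatorAlgebra : Subalgebra R (Module.End R (FGRing F M)) :=
  Algebra.adjoin R
    ({D | ∃ i : ι, IsDemazureOperator P F i D} ∪ Set.range (LinearMap.mulLeft R (A := FGRing F M)))

/-- `ε𝒟(M)_F`: the `R`-module of all linear forms `ε ∘ D` with `D ∈ 𝒟(M)_F`. -/
def augOperatorModule : Submodule R (Module.Dual R (FGRing F M)) :=
  (Subalgebra.toSubmodule (operatorAlgebra P F)).map
    (LinearMap.compRight R (FGRing.aug F M).toLinearMap)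

/-- `ℋ(M)_F`: the `R`-dual of `ε𝒟(M)_F`. -/
abbrev DualModule : Type _ := Module.Dual R (augOperatorModule P F)

/-- The characteristic map `c : R⟦M⟧_F → ℋ(M)_F`, sending `u` to the evaluation at `u`. -/
def charMap : FGRing F M →ₗ[R] DualModule P F :=
  (augOperatorModule P F).subtype.dualMap ∘ₗ Module.Dual.eval R (FGRing F M)

/-- `S` is a commutative ring structure on `ℋ(M)_F`, with its given (pointwise) addition, for which
the characteristic map is a ring homomorphism. -/
def IsCharRingStructure (S : CommRing (DualModule P F)) : Prop :=
  (∀ (h k : DualModule P F) (E : augOperatorModule P F), (S.add h k) E = h E + k E) ∧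
    letI := S
    ∃ f : FGRing F M →+* DualModule P F, ∀ u, f u = charMap P F u

end Operators

/-! ### The torsion index -/

section TorsionIndex

variable {ι M N : Type*} [AddCommGroup M] [AddCommGroup N] {P : RootDatum ι M N} (b : P.Base)

/-- The product `s_{i_1} ⋯ s_{i_l}` of reflections of `M` attached to a word. -/
def wordProd (P : RootDatum ι M N) (L : List ι) : M ≃ₗ[ℤ] M := (L.map P.reflection).prod

/-- `L` is a reduced decomposition in simple reflections. -/
def IsReducedWord (L : List ι) : Prop :=
  (∀ i ∈ L, i ∈ b.support) ∧
    ∀ L' : List ι, (∀ i ∈ L', i ∈ b.support) → wordProd P L' = wordProd P L → L.length ≤ L'.length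

/-- `L` is a reduced decomposition of the longest element of the Weyl group. -/
def IsLongestReducedWord (L : List ι) : Prop :=
  IsReducedWord b L ∧ ∀ L' : List ι, IsReducedWord b L' → L'.length ≤ L.length

/-- `v = Δ_{i_1} ⋯ Δ_{i_l} (u)` in the symmetric algebra `S(M)` over `ℤ`, for the classical divided
differences `Δ_i(u) = (u - s_i(u)) / α_i`. -/
inductive IsDividedDifference (P : RootDatum ι M N) :
    List ι → SymmetricAlgebra ℤ M → SymmetricAlgebra ℤ M → Prop
  | nil (u : SymmetricAlgebra ℤ M) : IsDividedDifference P [] u u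
  | cons (i : ι) (L : List ι) (u w v : SymmetricAlgebra ℤ M) (h : IsDividedDifference P L u w)
      (hv : SymmetricAlgebra.ι ℤ M (P.root i) * v =
        w - SymmetricAlgebra.lift (SymmetricAlgebra.ι ℤ M ∘ₗ (P.reflection i).toLinearMap) w) :
      IsDividedDifference P (i :: L) u v

/-- The torsion index: the least positive integer `t` of the form `Δ_{w₀}(a)`, where `w₀` is the
longest element of the Weyl group, of length `N`, and `a ∈ S^N(M)`. -/
def torsionIndex : ℕ :=
  sInf {t : ℕ | 0 < t ∧ ∃ L : List ι, IsLongestReducedWord b L ∧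
    ∃ a ∈ LinearMap.range (SymmetricAlgebra.ι ℤ M) ^ L.length,
      IsDividedDifference P L a (algebraMap ℤ (SymmetricAlgebra ℤ M) t)}

end TorsionIndex

end FormalGroupRing

end

/-! Write c for the characteristic map, t for the torsion index, I for the augmentation ideal, ℓ for
the length on W and N for the length of w₀.

Suppose a natural number q is regular in R and q·ℋ lies in the image of c. Since ℋ consists of
R-valued functions, q is regular on ℋ as well, so a product on ℋ is forced: q²·(hk) = c(uv) whenever
c(u) = qh and c(v) = qk. Such a product exists. Indeed Δ(uv) = Δ(u)v + s(u)Δ(v) with s = 1 - x_α Δ,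
so every εD(uv) is an R-combination of products εD'(u)·εD''(v). Hence c(uv) depends only on c(u) and
c(v), and is divisible by q² if both are divisible by q. The ring axioms follow by cancelling q
(`IsLeibniz.exists_unique_commRing`).

The number q is a power of t. A basis of M identifies R⟦M⟧_F with a power series ring
(`exists_coordinates`). There a Demazure operator lowers I-adic order by at most one, and its
leading term is the classical divided difference. Lift an element a of S^N(M) with Δ_{w₀}(a) = t to
u₀ in I^N, choose a reduced word I_w for each w in W, and put e_w = Δ_{I_{w⁻¹w₀}}(u₀). Then
εΔ_{I_v}(e_w) comes from ℓ(v) + N - ℓ(w) operators applied to u₀. It vanishes if ℓ(v) < ℓ(w). If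
ℓ(v) = ℓ(w) it depends only on the product v w⁻¹ w₀ (`aug_wordDemazure_eq`), so it is t for v = w
and 0 otherwise. The matrix is therefore triangular by blocks and its determinant is a power of t
(`exists_matrix_det_mem_powers`).

It remains to see that q·εD is a combination of the εΔ_{I_v} for each D in 𝒟; Cramer's rule then
gives preimages under c (`exists_evalMap_eq_nsmul`). If every x_α is regular, the elements of 𝒟 are
combinations of the |W| automorphisms w with coefficients in the total ring of fractions, and
regularity of the determinant makes such a combination determined by its values at the e_w. In
general x_α may be a zero divisor. The argument is then run on M ⊕ Q, with Q the root lattice, where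
the elements attached to the roots (0, α) are regular, and pushed down along (a, q) ↦ a + q
(`exists_det_mul_aug_eq`). -/

noncomputable section

namespace FormalGroupRing

/-! ### Powers of the ideal of the variables in a power series ring -/

section PowerSeriesIdeal

open MvPowerSeries

variable {σ R : Type*} [CommRing R]

/-- The ideal of `R⟦X_σ⟧` generated by the variables. -/
abbrev varIdeal (σ R : Type*) [CommRing R] : Ideal (MvPowerSeries σ R) :=
  Ideal.span (Set.range MvPowerSeries.X)

lemma constantCoeff_eq_zero_of_mem_varIdeal {f : MvPowerSeries σ R} (hf : f ∈ varIdeal σ R) :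
    constantCoeff f = 0 := by
  have h : varIdeal σ R ≤ RingHom.ker (constantCoeff (σ := σ) (R := R)) := by
    rw [Ideal.span_le]
    rintro _ ⟨i, rfl⟩
    simp
  exact h hf

lemma coe_mem_varIdeal_pow {p : MvPolynomial σ R} {n : ℕ}
    (hp : p ∈ MvPolynomial.idealOfVars σ R ^ n) : (p : MvPowerSeries σ R) ∈ varIdeal σ R ^ n := by
  have h : MvPolynomial.idealOfVars σ R ≤
      (varIdeal σ R).comap (MvPolynomial.coeToMvPowerSeries.ringHom (σ := σ) (R := R)) := by
    rw [MvPolynomial.idealOfVars, Ideal.span_le]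
    rintro _ ⟨i, rfl⟩
    simpa using Ideal.subset_span (Set.mem_range_self i)
  exact ((Ideal.pow_right_mono h n).trans (Ideal.le_comap_pow _ n)) hp

/-- Finiteness of `σ` is essential: the ideal of the variables of the polynomial ring is then
finitely generated, so in the completion the kernel of reduction modulo its n-th power is generated
by that power. The claim is carried over from the completion. -/
lemma sub_truncTotal_mem [Finite σ] (f : MvPowerSeries σ R) (n : ℕ) :
    f - (truncTotal n f : MvPolynomial σ R) ∈ varIdeal σ R ^ n := by
  let e := toAdicCompletionAlgEquiv σ R
  set x := f - (truncTotal n f : MvPolynomial σ R) with hx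
  have h1 : e x ∈ (MvPolynomial.idealOfVars σ R ^ n • ⊤ : Submodule (MvPolynomial σ R)
      (AdicCompletion (MvPolynomial.idealOfVars σ R) (MvPolynomial σ R))) := by
    rw [AdicCompletion.pow_smul_top_eq_ker_eval (MvPolynomial.idealOfVars_fg σ R),
      LinearMap.mem_ker]
    change (toAdicCompletion σ R x).val n = 0
    rw [toAdicCompletion_apply_eq_mk_truncTotal]
    have : truncTotal n x = 0 := by
      ext d
      by_cases hd : Finsupp.degree d < n
      · simp [hx, coeff_truncTotal _ hd]
      · simp [coeff_truncTotal_eq_zero _ (not_lt.mp hd)]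
    simp [this]
  have h2 : ∀ y ∈ (MvPolynomial.idealOfVars σ R ^ n • ⊤ : Submodule (MvPolynomial σ R)
      (AdicCompletion (MvPolynomial.idealOfVars σ R) (MvPolynomial σ R))),
      e.symm y ∈ varIdeal σ R ^ n := by
    intro y hy
    induction hy using Submodule.smul_induction_on' with
    | smul r hr z hz =>
      rw [map_smul]
      have : r • e.symm z = (r : MvPowerSeries σ R) * e.symm z := rfl
      rw [this]
      exact Ideal.mul_mem_right _ _ (coe_mem_varIdeal_pow hr)
    | add a _ b _ ha hb =>
      rw [map_add]
      exact add_mem ha hb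
  simpa using h2 _ h1

lemma mem_varIdeal_iff [Finite σ] {f : MvPowerSeries σ R} :
    f ∈ varIdeal σ R ↔ constantCoeff f = 0 := by
  refine ⟨constantCoeff_eq_zero_of_mem_varIdeal, fun h ↦ ?_⟩
  have h1 := sub_truncTotal_mem f 1
  have h2 : truncTotal 1 f = 0 := by
    ext d
    by_cases hd : Finsupp.degree d < 1
    · obtain rfl : d = 0 := (Finsupp.degree_eq_zero_iff d).mp (by simpa using hd)
      rw [coeff_truncTotal _ hd]
      simpa using h
    · simp [coeff_truncTotal_eq_zero _ (not_lt.mp hd)]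
  simpa [h2] using h1

/-- Two algebra homomorphisms out of a power series ring in finitely many variables which agree on
the variables modulo `K` agree modulo `K`, if they send the variables to an ideal which is nilpotent
modulo `K`. -/
lemma sub_mem_of_X_sub_mem [Finite σ] {C : Type*} [CommRing C] [Algebra R C]
    (φ ψ : MvPowerSeries σ R →ₐ[R] C) (J K : Ideal C) {n : ℕ} (hJK : J ^ n ≤ K)
    (hφ : ∀ i, φ (X i) ∈ J) (hψ : ∀ i, ψ (X i) ∈ J) (h : ∀ i, φ (X i) - ψ (X i) ∈ K)
    (f : MvPowerSeries σ R) : φ f - ψ f ∈ K := by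
  have key : ∀ χ : MvPowerSeries σ R →ₐ[R] C, (∀ i, χ (X i) ∈ J) →
      χ (f - (truncTotal n f : MvPolynomial σ R)) ∈ K := by
    intro χ hχ
    have h1 : varIdeal σ R ≤ J.comap χ := by
      rw [Ideal.span_le]
      rintro _ ⟨i, rfl⟩
      exact hχ i
    exact hJK (((Ideal.pow_right_mono h1 n).trans (Ideal.le_comap_pow _ n))
      (sub_truncTotal_mem f n))
  have h2 : ∀ p : MvPolynomial σ R, φ p - ψ p ∈ K := by
    intro p
    induction p using MvPolynomial.induction_on with
    | C a =>
      have : ((MvPolynomial.C a : MvPolynomial σ R) : MvPowerSeries σ R) = algebraMap R _ a := by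
        rw [MvPolynomial.coe_C]; rfl
      rw [this, AlgHom.commutes, AlgHom.commutes, sub_self]
      exact K.zero_mem
    | add p q hp hq =>
      have := add_mem hp hq
      simpa [add_sub_add_comm] using this
    | mul_X p i hp =>
      rw [MvPolynomial.coe_mul, MvPolynomial.coe_X, map_mul, map_mul]
      have : φ p * φ (X i) - ψ p * ψ (X i) =
          φ (X i) * (φ p - ψ p) + ψ p * (φ (X i) - ψ (X i)) := by ring
      rw [this]
      exact add_mem (K.mul_mem_left _ hp) (K.mul_mem_left _ (h i))
  have h3 : φ f - ψ f = φ (f - (truncTotal n f : MvPolynomial σ R)) -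
      ψ (f - (truncTotal n f : MvPolynomial σ R)) +
      (φ (truncTotal n f : MvPolynomial σ R) - ψ (truncTotal n f : MvPolynomial σ R)) := by
    rw [map_sub, map_sub]; ring
  rw [h3]
  exact add_mem (sub_mem (key φ hφ) (key ψ hψ)) (h2 _)

/-- The principal ideal of a variable is closed: a coefficient of degree d is not affected by
elements of order greater than d, so divisibility can be tested one coefficient at a time. -/
lemma X_dvd_of_forall_mem [Finite σ] {f : MvPowerSeries σ R} (i : σ)
    (h : ∀ n, f ∈ Ideal.span {X i} ⊔ varIdeal σ R ^ n) : X i ∣ f := by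
  classical
  rw [X_dvd_iff]
  intro m hm
  obtain ⟨a, ha, b, hb, rfl⟩ := Submodule.mem_sup.mp (h (Finsupp.degree m + 1))
  rw [map_add, X_dvd_iff.mp (Ideal.mem_span_singleton.mp ha) m hm, zero_add]
  have key : ∀ (n : ℕ) (b : MvPowerSeries σ R), b ∈ varIdeal σ R ^ n →
      ∀ m, Finsupp.degree m < n → coeff m b = 0 := by
    intro n b hb
    have hle : (n : ℕ∞) ≤ b.order := by
      induction n generalizing b with
      | zero => simp
      | succ n ih =>
        rw [pow_succ] at hb
        induction hb using Submodule.mul_induction_on' with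
        | mem_mul_mem x hx y hy =>
          refine le_trans ?_ (le_order_mul)
          push_cast
          refine add_le_add (ih x hx) ?_
          rw [one_le_order_iff_constCoeff_eq_zero]
          exact constantCoeff_eq_zero_of_mem_varIdeal hy
        | add x _ y _ hx hy => exact le_trans (le_min hx hy) (min_order_le_add)
    intro m hm
    exact coeff_of_lt_order (lt_of_lt_of_le (by exact_mod_cast hm) hle)
  exact key _ b hb m (Nat.lt_succ_self _)

lemma iInf_varIdeal_pow [Finite σ] {f : MvPowerSeries σ R} (h : ∀ n, f ∈ varIdeal σ R ^ n) :
    f = 0 :=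
  (inferInstance : IsHausdorff (varIdeal σ R) (MvPowerSeries σ R)).haus f fun n ↦ by
    rw [SModEq.sub_mem, sub_zero, smul_eq_mul, Ideal.mul_top]
    exact h n

end PowerSeriesIdeal

/-! ### Points of the formal group law in power series -/

section FormalGroupLaw

open MvPowerSeries

variable {R : Type*} [CommRing R] (F : FormalGroup R)

lemma coeff_single_zero_formalGroup (n : ℕ) :
    coeff (Finsupp.single (0 : Fin 2) n) F.toPowerSeries = if n = 1 then 1 else 0 := by
  have h : coeff (Finsupp.single () n) F.Xzero = if n = 1 then 1 else 0 := by
    rw [F.Xzero_eq_X]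
    exact PowerSeries.coeff_X n
  rw [← h, coeff_subst (by exact HasSubst.X_zero), finsum_eq_single _ (Finsupp.single 0 n)]
  · simp [PowerSeries.X, X_pow_eq]
  · intro d hd
    by_cases h1 : d 1 = 0
    · have h0 : d 0 ≠ n := by
        rintro rfl
        apply hd
        ext i; fin_cases i <;> simp [h1]
      simp [h1, PowerSeries.X, X_pow_eq, coeff_monomial, h0.symm]
    · simp [h1]

lemma coeff_single_one_formalGroup (n : ℕ) :
    coeff (Finsupp.single (1 : Fin 2) n) F.toPowerSeries = if n = 1 then 1 else 0 := by
  have h : coeff (Finsupp.single () n) F.zeroX = if n = 1 then 1 else 0 := by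
    rw [F.zeroX_eq_X]
    exact PowerSeries.coeff_X n
  rw [← h, coeff_subst (by exact HasSubst.zero_X), finsum_eq_single _ (Finsupp.single 1 n)]
  · simp [PowerSeries.X, X_pow_eq]
  · intro d hd
    by_cases h1 : d 0 = 0
    · have h0 : d 1 ≠ n := by
        rintro rfl
        apply hd
        ext i; fin_cases i <;> simp [h1]
      simp [h1, PowerSeries.X, X_pow_eq, coeff_monomial, h0.symm]
    · simp [h1]

/-- A formal group law has the form `X + Y + X Y G(X, Y)`. -/
lemma exists_formalGroup_eq : ∃ G : MvPowerSeries (Fin 2) R,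
    F.toPowerSeries = X 0 + X 1 + X 0 * X 1 * G := by
  classical
  have h0 : ∀ d : Fin 2 →₀ ℕ, d 0 = 0 → d = Finsupp.single 1 (d 1) := fun d hd ↦ by
    ext i; fin_cases i <;> simp [hd]
  have h1 : ∀ d : Fin 2 →₀ ℕ, d 1 = 0 → d = Finsupp.single 0 (d 0) := fun d hd ↦ by
    ext i; fin_cases i <;> simp [hd]
  have hX : (X 0 : MvPowerSeries (Fin 2) R) ∣ F.toPowerSeries - X 1 := by
    rw [X_dvd_iff]
    intro m hm
    rw [h0 m hm, map_sub, coeff_single_one_formalGroup, coeff_X]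
    simp [Finsupp.single_eq_single_iff]
  obtain ⟨H, hH⟩ := hX
  have hY : (X 1 : MvPowerSeries (Fin 2) R) ∣ H - 1 := by
    rw [X_dvd_iff]
    intro m hm
    have h2 := congrArg (coeff (Finsupp.single 0 1 + m)) hH
    rw [show (X 0 : MvPowerSeries (Fin 2) R) = monomial (Finsupp.single 0 1) 1 from rfl,
      coeff_add_monomial_mul, one_mul] at h2
    rw [map_sub, ← h2, h1 m hm, map_sub, ← Finsupp.single_add, coeff_single_zero_formalGroup]
    have h3 : (Finsupp.single 0 1 + Finsupp.single 0 (m 0) : Fin 2 →₀ ℕ) ≠ Finsupp.single 1 1 :=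
      fun h ↦ by simpa using DFunLike.congr_fun h 1
    simp [coeff_X, coeff_one, h3]
  obtain ⟨G, hG⟩ := hY
  refine ⟨G, ?_⟩
  rw [sub_eq_iff_eq_add] at hH hG
  rw [hH, hG]
  ring

variable {σ : Type*} [Finite σ]

omit [Finite σ] in
lemma hasSubst_pair {f g : MvPowerSeries σ R} (hf : f ∈ varIdeal σ R) (hg : g ∈ varIdeal σ R) :
    HasSubst ![f, g] :=
  hasSubst_of_constantCoeff_zero fun s ↦ by
    fin_cases s
    · exact constantCoeff_eq_zero_of_mem_varIdeal hf
    · exact constantCoeff_eq_zero_of_mem_varIdeal hg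

omit [Finite σ] in
lemma subst_pair_sub_mem {f f' g g' : MvPowerSeries σ R} (hf : f ∈ varIdeal σ R)
    (hf' : f' ∈ varIdeal σ R) (hg : g ∈ varIdeal σ R) (hg' : g' ∈ varIdeal σ R) (n : ℕ)
    (h : f - f' ∈ varIdeal σ R ^ n) (h' : g - g' ∈ varIdeal σ R ^ n)
    (H : MvPowerSeries (Fin 2) R) :
    H.subst ![f, g] - H.subst ![f', g'] ∈ varIdeal σ R ^ n := by
  have := sub_mem_of_X_sub_mem (substAlgHom (hasSubst_pair hf hg) : _ →ₐ[R] _)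
    (substAlgHom (hasSubst_pair hf' hg')) (varIdeal σ R) (varIdeal σ R ^ n) le_rfl
    (fun i ↦ by rw [substAlgHom_X]; fin_cases i <;> assumption)
    (fun i ↦ by rw [substAlgHom_X]; fin_cases i <;> assumption)
    (fun i ↦ by rw [substAlgHom_X, substAlgHom_X]; fin_cases i <;> assumption) H
  simpa only [coe_substAlgHom] using this

omit [Finite σ] in
lemma formalGroup_subst_mem {f g : MvPowerSeries σ R} (hf : f ∈ varIdeal σ R)
    (hg : g ∈ varIdeal σ R) : F.toPowerSeries.subst ![f, g] ∈ varIdeal σ R := by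
  obtain ⟨G, hG⟩ := exists_formalGroup_eq F
  rw [hG, ← coe_substAlgHom (hasSubst_pair hf hg)]
  simp only [map_add, map_mul, substAlgHom_X]
  exact add_mem (add_mem hf hg) (Ideal.mul_mem_right _ _ (Ideal.mul_mem_right _ _ hf))

/-- Since F(f, g) = f + g + f·H(f, g), an inverse of f is a fixed point of g ↦ -f - f·H(f, g). The
factor f makes this map contracting for the adic topology. -/
lemma exists_formalGroup_subst_eq_zero {f : MvPowerSeries σ R} (hf : f ∈ varIdeal σ R) :
    ∃ g ∈ varIdeal σ R, F.toPowerSeries.subst ![f, g] = 0 := by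
  obtain ⟨G, hG⟩ := exists_formalGroup_eq F
  have hF : ∀ g ∈ varIdeal σ R, F.toPowerSeries.subst ![f, g] =
      f + g + f * (X 1 * G).subst ![f, g] := by
    intro g hg
    rw [hG, ← coe_substAlgHom (hasSubst_pair hf hg)]
    simp only [map_add, map_mul, substAlgHom_X]
    simp [mul_assoc]
  -- The map g ↦ g - F(f, g) is the contraction above, so successive differences gain one order at
  -- each step and are themselves the values F(f, s n), which tend to zero.
  obtain ⟨s, hs0, hs⟩ : ∃ s : ℕ → MvPowerSeries σ R, s 0 = 0 ∧
      ∀ n, s (n + 1) = s n - F.toPowerSeries.subst ![f, s n] :=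
    ⟨fun n ↦ Nat.rec 0 (fun _ g ↦ g - F.toPowerSeries.subst ![f, g]) n, rfl, fun _ ↦ rfl⟩
  have hsJ : ∀ n, s n ∈ varIdeal σ R := by
    intro n
    induction n with
    | zero => rw [hs0]; exact zero_mem _
    | succ n ih => rw [hs]; exact sub_mem ih (formalGroup_subst_mem F hf ih)
  have hstep : ∀ n, s n - s (n + 1) ∈ varIdeal σ R ^ n := by
    intro n
    induction n with
    | zero => simp
    | succ n ih =>
      have h1 : s (n + 1) - s (n + 1 + 1) =
          - (f * ((X 1 * G).subst ![f, s n] - (X 1 * G).subst ![f, s (n + 1)])) := by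
        linear_combination hs n - hs (n + 1) - hF _ (hsJ n) + hF _ (hsJ (n + 1))
      rw [h1, pow_succ']
      exact neg_mem (Ideal.mul_mem_mul hf
        (subst_pair_sub_mem hf hf (hsJ _) (hsJ _) n (by simp) ih _))
  have hcauchy : ∀ {m n : ℕ}, m ≤ n →
      s m ≡ s n [SMOD (varIdeal σ R ^ m • ⊤ :
        Submodule (MvPowerSeries σ R) (MvPowerSeries σ R))] := by
    intro m n hmn
    rw [SModEq.sub_mem, smul_eq_mul, Ideal.mul_top]
    induction n, hmn using Nat.le_induction with
    | base => simp
    | succ n hmn ih =>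
      have := add_mem ih (Ideal.pow_le_pow_right hmn (hstep n))
      simpa using this
  obtain ⟨L, hL⟩ := (inferInstance : IsPrecomplete (varIdeal σ R) (MvPowerSeries σ R)).prec hcauchy
  have hL' : ∀ n, s n - L ∈ varIdeal σ R ^ n := fun n ↦ by
    have := hL n
    rwa [SModEq.sub_mem, smul_eq_mul, Ideal.mul_top] at this
  have hLJ : L ∈ varIdeal σ R := by
    have := sub_mem (hsJ 1) (by simpa using hL' 1 : s 1 - L ∈ varIdeal σ R)
    simpa using this
  refine ⟨L, hLJ, iInf_varIdeal_pow fun n ↦ ?_⟩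
  have h1 := subst_pair_sub_mem hf hf (hsJ n) hLJ n (by simp) (hL' n) F.toPowerSeries
  have h2 := hstep n
  rw [hs, sub_sub_cancel] at h2
  simpa using sub_mem h2 h1

/-- The points of a formal group law in `R⟦X_σ⟧` with constant coefficient zero. -/
def zeroPoints (σ : Type*) [Finite σ] : AddSubmonoid (F.Point σ) where
  carrier := {f | f.val ∈ varIdeal σ R}
  add_mem' hf hg := formalGroup_subst_mem F hf hg
  zero_mem' := zero_mem (varIdeal σ R)

/-- The point `X_i`, as an invertible point. -/
def variablePoint [F.IsComm] (i : σ) : AddUnits (zeroPoints F σ) :=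
  have hX : X i ∈ varIdeal σ R := Ideal.subset_span (Set.mem_range_self i)
  have hs : ∀ {f : MvPowerSeries σ R}, f ∈ varIdeal σ R → PowerSeries.HasSubst f := fun h ↦
    PowerSeries.HasSubst.of_constantCoeff_zero (constantCoeff_eq_zero_of_mem_varIdeal h)
  have h := exists_formalGroup_subst_eq_zero F hX
  have hadd : (⟨⟨X i, hs hX⟩, hX⟩ : zeroPoints F σ) +
      ⟨⟨h.choose, hs h.choose_spec.1⟩, h.choose_spec.1⟩ = 0 :=
    Subtype.ext (Subtype.ext h.choose_spec.2)
  { val := ⟨⟨X i, hs hX⟩, hX⟩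
    neg := ⟨⟨h.choose, hs h.choose_spec.1⟩, h.choose_spec.1⟩
    val_neg := hadd
    neg_val := (add_comm _ _).trans hadd }

lemma exists_additive_points [F.IsComm] {M : Type*} [AddCommGroup M]
    (e : Module.Basis σ ℤ M) : ∃ p : M → MvPowerSeries σ R, (∀ a, p a ∈ varIdeal σ R) ∧
      p 0 = 0 ∧ (∀ a b, p (a + b) = F.toPowerSeries.subst ![p a, p b]) ∧ ∀ i, p (e i) = X i := by
  -- The invertible points form an abelian group, so a homomorphism out of the free module M only
  -- requires the variables to be invertible.
  let q : M →ₗ[ℤ] AddUnits (zeroPoints F σ) := e.constr ℤ (variablePoint F)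
  refine ⟨fun a ↦ (q a).val.val.val, fun a ↦ (q a).val.2, ?_, fun a b ↦ ?_, fun i ↦ ?_⟩
  · simp only [map_zero]
    rfl
  · simp only [map_add]
    rfl
  · simp only [q, Module.Basis.constr_basis]
    rfl

end FormalGroupLaw

end FormalGroupRing

end

noncomputable section

namespace FormalGroupRing

/-! ### Continuous homomorphisms out of `PowSer` -/

section Lift

open MvPolynomial

variable {R : Type*} [CommRing R] {T σ : Type*} [Finite σ]

omit [Finite σ] in
lemma aeval_mem_varIdeal_pow (p : T → MvPowerSeries σ R) (hp : ∀ t, p t ∈ varIdeal σ R) (n : ℕ) :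
    idealOfVars T R ^ n ≤ (varIdeal σ R ^ n).comap (aeval p : MvPolynomial T R →ₐ[R] _) := by
  refine le_trans (Ideal.pow_right_mono ?_ n) (Ideal.le_comap_pow _ n)
  rw [idealOfVars, Ideal.span_le]
  rintro _ ⟨t, rfl⟩
  simpa using hp t

/-- The map `R⟦x_T⟧ → R⟦X_σ⟧ / (X)^n`, `x_t ↦ p t`. -/
def powSerLiftLevel (p : T → MvPowerSeries σ R) (hp : ∀ t, p t ∈ varIdeal σ R) (n : ℕ) :
    PowSer R T →ₐ[R] MvPowerSeries σ R ⧸ varIdeal σ R ^ n :=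
  (Ideal.quotientMapₐ (varIdeal σ R ^ n) (aeval p) (aeval_mem_varIdeal_pow p hp n)).comp
    ((AdicCompletion.evalₐ (idealOfVars T R) n).restrictScalars R)

omit [Finite σ] in
lemma powSerLiftLevel_mk (p : T → MvPowerSeries σ R) (hp : ∀ t, p t ∈ varIdeal σ R) (n : ℕ)
    (a : AdicCompletion.AdicCauchySequence (idealOfVars T R) (MvPolynomial T R)) :
    powSerLiftLevel p hp n (AdicCompletion.mk _ _ a) = Ideal.Quotient.mk _ (aeval p (a n)) := by
  simp [powSerLiftLevel]

lemma cauchySequence_sub_mem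
    (a : AdicCompletion.AdicCauchySequence (idealOfVars T R) (MvPolynomial T R)) {m n : ℕ}
    (h : m ≤ n) : a n - a m ∈ idealOfVars T R ^ m := by
  have h := a.2 h
  rw [SModEq.sub_mem] at h
  rw [← neg_mem_iff, neg_sub]
  simpa using h

omit [Finite σ] in
lemma factor_powSerLiftLevel (p : T → MvPowerSeries σ R) (hp : ∀ t, p t ∈ varIdeal σ R) {m n : ℕ}
    (hle : m ≤ n) :
    (Ideal.Quotient.factorₐ R (Ideal.pow_le_pow_right hle)).comp (powSerLiftLevel p hp n) =
      powSerLiftLevel p hp m := by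
  ext x
  obtain ⟨a, rfl⟩ := AdicCompletion.mk_surjective _ _ x
  simp only [AlgHom.comp_apply, powSerLiftLevel_mk, Ideal.Quotient.factorₐ_apply_mk]
  rw [Ideal.Quotient.eq, ← map_sub]
  exact aeval_mem_varIdeal_pow p hp m (cauchySequence_sub_mem a hle)

/-- The continuous homomorphism `R⟦x_T⟧ → R⟦X_σ⟧`, `x_t ↦ p t`. -/
def powSerLift (p : T → MvPowerSeries σ R) (hp : ∀ t, p t ∈ varIdeal σ R) :
    PowSer R T →ₐ[R] MvPowerSeries σ R :=
  IsAdicComplete.liftAlgHom (varIdeal σ R) (powSerLiftLevel p hp)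
    fun hle ↦ factor_powSerLiftLevel p hp hle

lemma mk_powSerLift (p : T → MvPowerSeries σ R) (hp : ∀ t, p t ∈ varIdeal σ R) (n : ℕ)
    (u : PowSer R T) :
    Ideal.Quotient.mk (varIdeal σ R ^ n) (powSerLift p hp u) = powSerLiftLevel p hp n u :=
  IsAdicComplete.mk_liftAlgHom (varIdeal σ R) (powSerLiftLevel p hp)
    (fun hle ↦ factor_powSerLiftLevel p hp hle) n u

lemma powSerLift_mem (p : T → MvPowerSeries σ R) (hp : ∀ t, p t ∈ varIdeal σ R) {n : ℕ}
    {u : PowSer R T} (hu : u ∈ PowSer.valIdeal R T n) : powSerLift p hp u ∈ varIdeal σ R ^ n := by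
  have hu' : AdicCompletion.evalₐ (idealOfVars T R) n u = 0 := hu
  rw [← Ideal.Quotient.eq_zero_iff_mem, mk_powSerLift, powSerLiftLevel, AlgHom.comp_apply,
    AlgHom.restrictScalars_apply, hu', map_zero]

lemma powSerLift_x (p : T → MvPowerSeries σ R) (hp : ∀ t, p t ∈ varIdeal σ R) (t : T) :
    powSerLift p hp (PowSer.x R t) = p t := by
  rw [← sub_eq_zero]
  refine iInf_varIdeal_pow fun n ↦ ?_
  rw [← Ideal.Quotient.eq, mk_powSerLift]
  simp [powSerLiftLevel, PowSer.x]

/-- The homomorphism `R⟦X_τ⟧ → R⟦x_T⟧`, `X_i ↦ x_{f(i)}`. -/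
def powSerRename {τ : Type*} [Finite τ] (R : Type*) [CommRing R] (f : τ → T) :
    MvPowerSeries τ R →ₐ[R] PowSer R T :=
  (PowSer.rename R f).comp ((MvPowerSeries.toAdicCompletion τ R).restrictScalars R)

lemma powSerRename_X {τ : Type*} [Finite τ] (f : τ → T) (i : τ) :
    powSerRename R f (MvPowerSeries.X i) = PowSer.x R (f i) := by
  rw [← PowSer.rename_x, powSerRename, AlgHom.comp_apply, AlgHom.restrictScalars_apply,
    ← MvPolynomial.coe_X, MvPowerSeries.toAdicCompletion_coe]
  rfl

lemma mem_valIdeal_iff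
    {a : AdicCompletion.AdicCauchySequence (idealOfVars T R) (MvPolynomial T R)} {m n : ℕ}
    (h : m ≤ n) :
    (AdicCompletion.mk _ _ a : PowSer R T) ∈ PowSer.valIdeal R T m ↔
      a n ∈ idealOfVars T R ^ m := by
  have h1 : (AdicCompletion.mk _ _ a : PowSer R T) ∈ PowSer.valIdeal R T m ↔
      a m ∈ idealOfVars T R ^ m := by
    rw [PowSer.valIdeal, RingHom.mem_ker, ← Ideal.Quotient.eq_zero_iff_mem]
    simp
  rw [h1, ← sub_add_cancel (a n) (a m)]
  exact (add_mem_cancel_left (cauchySequence_sub_mem a h)).symm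

lemma valIdeal_mul_le (m n : ℕ) :
    PowSer.valIdeal R T m * PowSer.valIdeal R T n ≤ PowSer.valIdeal R T (m + n) := by
  rw [Ideal.mul_le]
  intro u hu v hv
  obtain ⟨a, rfl⟩ := AdicCompletion.mk_surjective _ _ u
  obtain ⟨b, rfl⟩ := AdicCompletion.mk_surjective _ _ v
  rw [mem_valIdeal_iff (Nat.le_add_right m n)] at hu
  rw [mem_valIdeal_iff (Nat.le_add_left n m)] at hv
  rw [PowSer.valIdeal, RingHom.mem_ker, map_mul, AdicCompletion.evalₐ_mk, AdicCompletion.evalₐ_mk,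
    ← map_mul, Ideal.Quotient.eq_zero_iff_mem, pow_add]
  exact Ideal.mul_mem_mul hu hv

lemma valIdeal_one_pow_le (n : ℕ) : PowSer.valIdeal R T 1 ^ n ≤ PowSer.valIdeal R T n := by
  induction n with
  | zero =>
    intro u _
    have : Subsingleton (MvPolynomial T R ⧸ idealOfVars T R ^ 0) :=
      Ideal.Quotient.subsingleton_iff.mpr (by simp)
    exact Subsingleton.elim _ _
  | succ n ih =>
    rw [pow_succ]
    exact (Ideal.mul_mono_left ih).trans (valIdeal_mul_le n 1)

lemma x_mem_valIdeal_one (t : T) : PowSer.x R t ∈ PowSer.valIdeal R T 1 := by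
  rw [PowSer.valIdeal, RingHom.mem_ker, PowSer.x]
  simp only [AdicCompletion.evalₐ_of, Ideal.Quotient.eq_zero_iff_mem, pow_one]
  exact Ideal.subset_span (Set.mem_range_self t)

end Lift

/-! ### The formal group ring of a lattice is a power series ring -/

section Coordinates

variable {R : Type*} [CommRing R] (F : FormalGroup R) {M : Type*} [AddCommGroup M]
variable {σ : Type*} [Finite σ]

open MvPowerSeries (X)

/-- The image of the ideal of elements of valuation at least `n` in the formal group ring. -/
def valFiltration (n : ℕ) : Ideal (FGRing F M) :=
  (PowSer.valIdeal R M n).map (Ideal.Quotient.mk _)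

lemma mem_valFiltration_iff {n : ℕ} {u : FGRing F M} :
    u ∈ valFiltration F n ↔ ∃ v ∈ PowSer.valIdeal R M n, Ideal.Quotient.mk _ v = u :=
  Ideal.mem_map_iff_of_surjective _ Ideal.Quotient.mk_surjective

lemma valFiltration_mul_le (m n : ℕ) :
    valFiltration F m * valFiltration F n ≤ (valFiltration F (m + n) : Ideal (FGRing F M)) := by
  rw [valFiltration, valFiltration, ← Ideal.map_mul]
  exact Ideal.map_mono (valIdeal_mul_le m n)

lemma valFiltration_one_pow_le (n : ℕ) :
    valFiltration F 1 ^ n ≤ (valFiltration F n : Ideal (FGRing F M)) := by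
  rw [valFiltration, ← Ideal.map_pow]
  exact Ideal.map_mono (valIdeal_one_pow_le n)

/-- Separatedness is exactly what dividing by the closure of the relation ideal provides. -/
lemma eq_zero_of_mem_valFiltration {u : FGRing F M} (h : ∀ n, u ∈ valFiltration F n) : u = 0 := by
  obtain ⟨v, rfl⟩ := Ideal.Quotient.mk_surjective u
  rw [Ideal.Quotient.eq_zero_iff_mem, PowSer.closure, Ideal.mem_iInf]
  intro n
  obtain ⟨w, hw, hwv⟩ := (mem_valFiltration_iff F).mp (h n)
  rw [Ideal.Quotient.eq] at hwv
  have h1 := (Ideal.mem_iInf.mp hwv) n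
  have h2 := sub_mem (Ideal.mem_sup_right (S := relIdeal F M) hw) h1
  simpa using h2

/-- The homomorphism `R⟦X_τ⟧ → R⟦M⟧_F`, `X_i ↦ x_{f(i)}`. -/
def evalAt {τ : Type*} [Finite τ] (f : τ → M) : MvPowerSeries τ R →ₐ[R] FGRing F M :=
  (Ideal.Quotient.mkₐ R _).comp (powSerRename R f)

lemma evalAt_X {τ : Type*} [Finite τ] (f : τ → M) (i : τ) :
    evalAt F f (X i) = FGRing.x F (f i) := by
  rw [evalAt, AlgHom.comp_apply, powSerRename_X]
  rfl

lemma x_mem_valFiltration_one (a : M) : FGRing.x F a ∈ valFiltration F 1 :=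
  Ideal.mem_map_of_mem _ (x_mem_valIdeal_one a)

lemma relIdeal_le_closure : relIdeal F M ≤ PowSer.closure R (relIdeal F M) :=
  le_iInf fun _ ↦ le_sup_left

lemma FGRing.x_zero : FGRing.x F (0 : M) = 0 := by
  rw [FGRing.x, Ideal.Quotient.eq_zero_iff_mem]
  exact relIdeal_le_closure F (Ideal.subset_span (Or.inl rfl))

lemma FGRing.x_add (a b : M) : FGRing.x F (a + b) = evalAt F ![a, b] F.toPowerSeries := by
  have h : PowSer.x R (a + b) - fglSum F a b ∈ PowSer.closure R (relIdeal F M) :=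
    relIdeal_le_closure F (Ideal.subset_span (Or.inr ⟨(a, b), rfl⟩))
  exact (Ideal.Quotient.eq).mpr h

lemma FGRing.exists_x_add : ∃ G : M → M → FGRing F M, ∀ a b,
    FGRing.x F (a + b) = FGRing.x F a + FGRing.x F b + FGRing.x F a * FGRing.x F b * G a b := by
  obtain ⟨G, hG⟩ := exists_formalGroup_eq F
  refine ⟨fun a b ↦ evalAt F ![a, b] G, fun a b ↦ ?_⟩
  rw [FGRing.x_add, hG]
  simp [evalAt_X]

variable {F} in
-- The relations die modulo every power of the ideal of the variables, hence die because the target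
-- is separated. Continuity extends this to the closure.
lemma powSerLift_closure {p : M → MvPowerSeries σ R} (hp : ∀ a, p a ∈ varIdeal σ R)
    (h0 : p 0 = 0) (hadd : ∀ a b, p (a + b) = F.toPowerSeries.subst ![p a, p b]) :
    ∀ u ∈ PowSer.closure R (relIdeal F M), powSerLift p hp u = 0 := by
  have h1 : relIdeal F M ≤ RingHom.ker (powSerLift p hp) := by
    rw [relIdeal, Ideal.span_le, Set.union_subset_iff]
    constructor
    · rintro _ rfl
      simp [powSerLift_x, h0]
    · rintro _ ⟨⟨a, b⟩, rfl⟩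
      rw [SetLike.mem_coe, RingHom.mem_ker, map_sub, powSerLift_x]
      refine iInf_varIdeal_pow fun n ↦ ?_
      have := sub_mem_of_X_sub_mem
        (MvPowerSeries.substAlgHom (hasSubst_pair (hp a) (hp b)) : _ →ₐ[R] _)
        ((powSerLift p hp).comp (powSerRename R ![a, b])) (varIdeal σ R) (varIdeal σ R ^ n) le_rfl
        (fun i ↦ by rw [MvPowerSeries.substAlgHom_X]; fin_cases i; exacts [hp a, hp b])
        (fun i ↦ by
          rw [AlgHom.comp_apply, powSerRename_X, powSerLift_x]; fin_cases i; exacts [hp a, hp b])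
        (fun i ↦ by
          rw [MvPowerSeries.substAlgHom_X, AlgHom.comp_apply, powSerRename_X, powSerLift_x]
          fin_cases i <;> simp)
        F.toPowerSeries
      rw [MvPowerSeries.coe_substAlgHom, ← hadd] at this
      exact this
  intro u hu
  refine iInf_varIdeal_pow fun n ↦ ?_
  obtain ⟨v, hv, w, hw, rfl⟩ := Submodule.mem_sup.mp ((Ideal.mem_iInf.mp hu) n)
  rw [map_add, RingHom.mem_ker.mp (h1 hv), zero_add]
  exact powSerLift_mem p hp hw

/-- The homomorphism `R⟦M⟧_F → R⟦X_σ⟧`, `x_a ↦ p a`. -/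
def liftPoints {p : M → MvPowerSeries σ R} (hp : ∀ a, p a ∈ varIdeal σ R)
    (h0 : p 0 = 0) (hadd : ∀ a b, p (a + b) = F.toPowerSeries.subst ![p a, p b]) :
    FGRing F M →ₐ[R] MvPowerSeries σ R :=
  Ideal.Quotient.liftₐ _ (powSerLift p hp) (powSerLift_closure hp h0 hadd)

variable {F}

lemma liftPoints_x {p : M → MvPowerSeries σ R} (hp : ∀ a, p a ∈ varIdeal σ R)
    (h0 : p 0 = 0) (hadd : ∀ a b, p (a + b) = F.toPowerSeries.subst ![p a, p b]) (a : M) :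
    liftPoints F hp h0 hadd (FGRing.x F a) = p a :=
  powSerLift_x p hp a

lemma evalAt_mem {τ : Type*} [Finite τ] (f : τ → M) {n : ℕ} {s : MvPowerSeries τ R}
    (hs : s ∈ varIdeal τ R ^ n) : evalAt F f s ∈ valFiltration F n := by
  have h1 : varIdeal τ R ≤ (valFiltration F 1).comap (evalAt F f) := by
    rw [Ideal.span_le]
    rintro _ ⟨i, rfl⟩
    simpa [evalAt_X] using x_mem_valFiltration_one F (f i)
  exact valFiltration_one_pow_le F n
    (((Ideal.pow_right_mono h1 n).trans (Ideal.le_comap_pow _ n)) hs)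

/-- Both sides satisfy the same addition rule given by F, so the set of good `a` is a subgroup
containing the basis. -/
lemma evalAt_points (e : Module.Basis σ ℤ M) {p : M → MvPowerSeries σ R}
    (hp : ∀ a, p a ∈ varIdeal σ R)
    (h0 : p 0 = 0) (hadd : ∀ a b, p (a + b) = F.toPowerSeries.subst ![p a, p b])
    (he : ∀ i, p (e i) = X i) (a : M) : evalAt F e (p a) = FGRing.x F a := by
  have key : ∀ (a b : M) (n : ℕ), evalAt F e (p a) - FGRing.x F a ∈ valFiltration F n →
      evalAt F e (p b) - FGRing.x F b ∈ valFiltration F n → ∀ H : MvPowerSeries (Fin 2) R,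
      evalAt F e (H.subst ![p a, p b]) - evalAt F ![a, b] H ∈ valFiltration F n := by
    intro a b n ha hb H
    have := sub_mem_of_X_sub_mem
      ((evalAt F e).comp (MvPowerSeries.substAlgHom (hasSubst_pair (hp a) (hp b)) : _ →ₐ[R] _))
      (evalAt F ![a, b]) (valFiltration F 1) (valFiltration F n) (valFiltration_one_pow_le F n)
      (fun i ↦ by
        rw [AlgHom.comp_apply, MvPowerSeries.substAlgHom_X]
        refine evalAt_mem e ?_
        rw [pow_one]
        fin_cases i; exacts [hp a, hp b])
      (fun i ↦ by rw [evalAt_X]; exact x_mem_valFiltration_one F _)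
      (fun i ↦ by
        rw [AlgHom.comp_apply, MvPowerSeries.substAlgHom_X, evalAt_X]
        fin_cases i; exacts [ha, hb]) H
    simpa only [AlgHom.comp_apply, MvPowerSeries.coe_substAlgHom] using this
  let S : AddSubgroup M :=
    { carrier := {a | evalAt F e (p a) = FGRing.x F a}
      zero_mem' := by simp [h0, FGRing.x_zero]
      add_mem' := by
        intro a b ha hb
        rw [Set.mem_ofPred_eq] at ha hb ⊢
        rw [← sub_eq_zero]
        refine eq_zero_of_mem_valFiltration F fun n ↦ ?_
        rw [hadd, FGRing.x_add]
        exact key a b n (by simp [ha]) (by simp [hb]) _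
      neg_mem' := by
        intro a ha
        rw [Set.mem_ofPred_eq] at ha ⊢
        rw [← sub_eq_zero]
        refine eq_zero_of_mem_valFiltration F fun n ↦ ?_
        obtain ⟨G, hG⟩ := exists_formalGroup_eq F
        -- Both sides at -a are inverses of x_a for F. Writing F = X + Y + XYG, an agreement to
        -- order n of the candidates at -a becomes one to order n + 1, because the correction term
        -- carries the factor x_a.
        induction n with
        | zero => exact valFiltration_one_pow_le F 0 (by simp)
        | succ n ih =>
          have h1 := FGRing.x_add F a (-a)
          have h2 := congrArg (evalAt F e) (hadd a (-a))
          rw [add_neg_cancel, FGRing.x_zero, hG] at h1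
          rw [add_neg_cancel, h0, map_zero, hG,
            ← MvPowerSeries.coe_substAlgHom (hasSubst_pair (hp a) (hp (-a)))] at h2
          have h3 := key a (-a) n (by simp [ha]) ih (X 1 * G)
          rw [← MvPowerSeries.coe_substAlgHom (hasSubst_pair (hp a) (hp (-a)))] at h3
          simp only [map_add, map_mul, MvPowerSeries.substAlgHom_X, evalAt_X,
            Matrix.cons_val_zero, Matrix.cons_val_one, Matrix.cons_val_fin_one, ha] at h1 h2 h3
          have h4 := valFiltration_mul_le F 1 n
            (Ideal.mul_mem_mul (x_mem_valFiltration_one F a) h3)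
          rw [add_comm 1 n, ← neg_mem_iff] at h4
          convert h4 using 1
          linear_combination h1 - h2 }
  have hS : S = ⊤ := by
    have h1 : AddSubgroup.toIntSubmodule S = ⊤ := by
      rw [eq_top_iff, ← e.span_eq, Submodule.span_le]
      rintro _ ⟨i, rfl⟩
      change evalAt F e (p (e i)) = _
      rw [he, evalAt_X]
    rw [eq_top_iff]
    intro x _
    have : x ∈ AddSubgroup.toIntSubmodule S := by rw [h1]; trivial
    exact this
  have : a ∈ S := by rw [hS]; trivial
  exact this

/-- Sending x_a to the point p(a) and sending X_i to x_{e_i} are mutually inverse: one composite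
fixes the variables, the other fixes every x_a by `evalAt_points`. Density of polynomials and
separatedness conclude. -/
lemma exists_coordinates [F.IsComm] (e : Module.Basis σ ℤ M) :
    ∃ c : FGRing F M ≃ₐ[R] MvPowerSeries σ R, ∀ s, c.symm s = evalAt F e s := by
  obtain ⟨p, hp, h0, hadd, he⟩ := exists_additive_points F e
  refine ⟨AlgEquiv.ofAlgHom (liftPoints F hp h0 hadd) (evalAt F e) ?_ ?_, fun s ↦ rfl⟩
  · ext1 s
    rw [← sub_eq_zero]
    refine iInf_varIdeal_pow fun n ↦ ?_
    refine sub_mem_of_X_sub_mem ((liftPoints F hp h0 hadd).comp (evalAt F e)) (AlgHom.id R _)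
      (varIdeal σ R) (varIdeal σ R ^ n) le_rfl (fun i ↦ ?_)
      (fun i ↦ Ideal.subset_span (Set.mem_range_self i)) (fun i ↦ ?_) s
    · rw [AlgHom.comp_apply, evalAt_X, liftPoints_x]
      exact hp _
    · rw [AlgHom.comp_apply, evalAt_X, liftPoints_x, he]
      simp
  · ext1 u
    rw [← sub_eq_zero]
    refine eq_zero_of_mem_valFiltration F fun n ↦ ?_
    obtain ⟨v, rfl⟩ := Ideal.Quotient.mk_surjective u
    obtain ⟨f, hf⟩ : ∃ f : MvPolynomial M R,
        v - AdicCompletion.of _ _ f ∈ PowSer.valIdeal R M n := by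
      obtain ⟨f, hf⟩ := Ideal.Quotient.mk_surjective
        (AdicCompletion.evalₐ (MvPolynomial.idealOfVars M R) n v)
      refine ⟨f, ?_⟩
      rw [PowSer.valIdeal, RingHom.mem_ker, map_sub, ← hf]
      simp
    have h1 : ∀ f : MvPolynomial M R,
        evalAt F e (powSerLift p hp (AdicCompletion.of _ _ f)) =
          Ideal.Quotient.mk _ (AdicCompletion.of _ _ f) := by
      intro f
      let ofHom : MvPolynomial M R →ₐ[R] PowSer R M := (Algebra.ofId _ _).restrictScalars R
      change ((evalAt F e).comp ((powSerLift p hp).comp ofHom)) f =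
        ((Ideal.Quotient.mkₐ R (PowSer.closure R (relIdeal F M))).comp ofHom) f
      congr 1
      refine MvPolynomial.algHom_ext fun a ↦ ?_
      change evalAt F e (powSerLift p hp (PowSer.x R a)) = FGRing.x F a
      rw [powSerLift_x, evalAt_points e hp h0 hadd he]
    have h2 : evalAt F e (powSerLift p hp (v - AdicCompletion.of _ _ f)) ∈ valFiltration F n :=
      evalAt_mem e (powSerLift_mem p hp hf)
    have h3 := sub_mem h2 ((mem_valFiltration_iff F).mpr ⟨_, hf, rfl⟩)
    rw [map_sub, map_sub, map_sub, h1, sub_sub_sub_cancel_right] at h3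
    exact h3

lemma aug_evalAt {τ : Type*} [Finite τ] (f : τ → M) (s : MvPowerSeries τ R) :
    FGRing.aug F M (evalAt F f s) = MvPowerSeries.constantCoeff s := by
  have haug : ∀ a : M, FGRing.aug F M (FGRing.x F a) = 0 := fun a ↦ PowSer.aug_x R a
  let cc : MvPowerSeries τ R →ₐ[R] R :=
    { MvPowerSeries.constantCoeff (σ := τ) (R := R) with
      commutes' := fun r ↦ MvPowerSeries.constantCoeff_C (σ := τ) r }
  have := sub_mem_of_X_sub_mem ((FGRing.aug F M).comp (evalAt F f)) cc ⊥ ⊥ (n := 1) (by simp)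
    (fun i ↦ by rw [AlgHom.comp_apply, evalAt_X, haug]; exact zero_mem _)
    (fun i ↦ by
      change MvPowerSeries.constantCoeff (X i) ∈ _
      rw [MvPowerSeries.constantCoeff_X]; exact zero_mem _)
    (fun i ↦ by
      change _ - MvPowerSeries.constantCoeff (X i) ∈ _
      rw [AlgHom.comp_apply, evalAt_X, haug, MvPowerSeries.constantCoeff_X, sub_zero]
      exact zero_mem _) s
  rw [Ideal.mem_bot, sub_eq_zero] at this
  exact this

end Coordinates

end FormalGroupRing

end

noncomputable section

namespace FormalGroupRing

/-! ### Augmentation ideal, regular elements and divisibility by y -/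

section Structure

open scoped nonZeroDivisors

variable {R : Type*} [CommRing R] (F : FormalGroup R)
variable {M M' : Type*} [AddCommGroup M] [AddCommGroup M']

/-- The augmentation ideal of `R⟦M⟧_F`. -/
abbrev augIdeal (M : Type*) [AddCommGroup M] : Ideal (FGRing F M) := RingHom.ker (FGRing.aug F M)

lemma FGRing.aug_x (a : M) : FGRing.aug F M (FGRing.x F a) = 0 := PowSer.aug_x R a

lemma FGRing.x_mem_augIdeal (a : M) : FGRing.x F a ∈ augIdeal F M := FGRing.aug_x F a

lemma FGRing.aug_map (f : M →+ M') (u : FGRing F M) :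
    FGRing.aug F M' (FGRing.map F f u) = FGRing.aug F M u := by
  obtain ⟨u, rfl⟩ := Ideal.Quotient.mk_surjective u
  exact PowSer.aug_rename R f u

lemma FGRing.map_mem_augIdeal_pow (f : M →+ M') {n : ℕ} {u : FGRing F M}
    (hu : u ∈ augIdeal F M ^ n) : FGRing.map F f u ∈ augIdeal F M' ^ n := by
  have h : augIdeal F M ≤ (augIdeal F M').comap (FGRing.map F f) := fun v hv ↦ by
    rw [Ideal.mem_comap, RingHom.mem_ker]
    exact (FGRing.aug_map F f v).trans hv
  exact ((Ideal.pow_right_mono h n).trans (Ideal.le_comap_pow _ n)) hu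

variable {F} [F.IsComm] {σ : Type*} [Finite σ]

lemma augIdeal_eq_span (e : Module.Basis σ ℤ M) :
    augIdeal F M = Ideal.span (Set.range fun i ↦ FGRing.x F (e i)) := by
  refine le_antisymm (fun u hu ↦ ?_) ?_
  · obtain ⟨c, hc⟩ := exists_coordinates (F := F) e
    obtain ⟨s, rfl⟩ := c.symm.surjective u
    rw [hc] at hu ⊢
    have hs : s ∈ varIdeal σ R := by
      rw [mem_varIdeal_iff, ← aug_evalAt (F := F) e]
      exact hu
    have h1 : varIdeal σ R ≤
        (Ideal.span (Set.range fun i ↦ FGRing.x F (e i))).comap (evalAt F e) := by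
      rw [Ideal.span_le]
      rintro _ ⟨i, rfl⟩
      rw [SetLike.mem_coe, Ideal.mem_comap, evalAt_X]
      exact Ideal.subset_span (Set.mem_range_self i)
    exact h1 hs
  · rw [Ideal.span_le]
    rintro _ ⟨i, rfl⟩
    exact FGRing.x_mem_augIdeal F _

lemma augIdeal_eq_span_x [Module.Finite ℤ M] [Module.Free ℤ M] :
    augIdeal F M = Ideal.span (Set.range (FGRing.x F)) := by
  refine le_antisymm ?_ ?_
  · rw [augIdeal_eq_span (Module.Free.chooseBasis ℤ M)]
    refine Ideal.span_mono ?_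
    rintro _ ⟨i, rfl⟩
    exact ⟨_, rfl⟩
  · rw [Ideal.span_le]
    rintro _ ⟨i, rfl⟩
    exact FGRing.x_mem_augIdeal F _

lemma FGRing.mem_nonZeroDivisors_of_aug [Module.Finite ℤ M] [Module.Free ℤ M] {u : FGRing F M}
    (hu : FGRing.aug F M u ∈ R⁰) : u ∈ (FGRing F M)⁰ := by
  obtain ⟨c, hc⟩ := exists_coordinates (F := F) (Module.Free.chooseBasis ℤ M)
  obtain ⟨s, rfl⟩ := c.symm.surjective u
  rw [← MulEquivClass.map_nonZeroDivisors c.symm]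
  refine Submonoid.mem_map_of_mem c.symm ?_
  rw [hc, aug_evalAt] at hu
  exact MvPowerSeries.mem_nonZeroDivisors_of_constantCoeff hu

lemma FGRing.x_basis_mem_nonZeroDivisors (e : Module.Basis σ ℤ M) (i : σ) :
    FGRing.x F (e i) ∈ (FGRing F M)⁰ := by
  obtain ⟨c, hc⟩ := exists_coordinates (F := F) e
  rw [← evalAt_X F e, ← hc]
  rw [← MulEquivClass.map_nonZeroDivisors c.symm]
  exact Submonoid.mem_map_of_mem c.symm MvPowerSeries.X_mem_nonzeroDivisors

lemma FGRing.algHom_sub_mem (e : Module.Basis σ ℤ M) {C : Type*} [CommRing C] [Algebra R C]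
    (φ ψ : FGRing F M →ₐ[R] C) (J K : Ideal C) {n : ℕ} (hJK : J ^ n ≤ K)
    (hφ : ∀ i, φ (FGRing.x F (e i)) ∈ J) (hψ : ∀ i, ψ (FGRing.x F (e i)) ∈ J)
    (h : ∀ i, φ (FGRing.x F (e i)) - ψ (FGRing.x F (e i)) ∈ K) (u : FGRing F M) :
    φ u - ψ u ∈ K := by
  obtain ⟨c, hc⟩ := exists_coordinates (F := F) e
  obtain ⟨s, rfl⟩ := c.symm.surjective u
  rw [hc]
  exact sub_mem_of_X_sub_mem (φ.comp (evalAt F e)) (ψ.comp (evalAt F e)) J K hJK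
    (by simpa [evalAt_X] using hφ) (by simpa [evalAt_X] using hψ) (by simpa [evalAt_X] using h) s

lemma FGRing.x_basis_dvd (e : Module.Basis σ ℤ M) (i : σ) {u : FGRing F M}
    (h : ∀ n, u ∈ Ideal.span {FGRing.x F (e i)} ⊔ augIdeal F M ^ n) : FGRing.x F (e i) ∣ u := by
  obtain ⟨c, hc⟩ := exists_coordinates (F := F) e
  obtain ⟨s, rfl⟩ := c.symm.surjective u
  rw [← evalAt_X F e, ← hc]
  refine map_dvd c.symm (X_dvd_of_forall_mem i fun n ↦ ?_)
  obtain ⟨a, ha, b, hb, hab⟩ := Submodule.mem_sup.mp (h n)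
  have h1 : s = c a + c b := by rw [← map_add, hab, AlgEquiv.apply_symm_apply]
  have hx : c (FGRing.x F (e i)) = MvPowerSeries.X i := by
    rw [← evalAt_X F e, ← hc, AlgEquiv.apply_symm_apply]
  rw [h1]
  refine Submodule.add_mem_sup ?_ ?_
  · obtain ⟨d, rfl⟩ := Ideal.mem_span_singleton.mp ha
    rw [map_mul, hx]
    exact Ideal.mul_mem_right _ _ (Ideal.mem_span_singleton_self _)
  · have h2 : augIdeal F M ≤ (varIdeal σ R).comap c := by
      rw [augIdeal_eq_span e, Ideal.span_le]
      rintro _ ⟨j, rfl⟩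
      have : c (FGRing.x F (e j)) = MvPowerSeries.X j := by
        rw [← evalAt_X F e, ← hc, AlgEquiv.apply_symm_apply]
      rw [SetLike.mem_coe, Ideal.mem_comap, this]
      exact Ideal.subset_span (Set.mem_range_self j)
    exact ((Ideal.pow_right_mono h2 n).trans (Ideal.le_comap_pow _ n)) hb

/-- The basis of `M × ℤ` given by a basis of `M` and `(0, 1)`. -/
def prodIntBasis (e : Module.Basis σ ℤ M) : Module.Basis (σ ⊕ Unit) ℤ (M × ℤ) :=
  e.prod (Module.Basis.singleton Unit ℤ)

variable [Module.Finite ℤ M] [Module.Free ℤ M]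

lemma FGRing.y_mem_nonZeroDivisors :
    FGRing.x F ((0, 1) : M × ℤ) ∈ (FGRing F (M × ℤ))⁰ := by
  have := FGRing.x_basis_mem_nonZeroDivisors (F := F)
    (prodIntBasis (Module.Free.chooseBasis ℤ M)) (Sum.inr ())
  simpa [prodIntBasis] using this

/-- The identity and the retraction through M agree on basis coordinates modulo y, so u minus its
retraction lies in (y) + I^n for every n. The ideal (y) is closed. -/
lemma FGRing.y_dvd_of_map_fst_eq_zero {u : FGRing F (M × ℤ)}
    (hu : FGRing.map F (AddMonoidHom.fst M ℤ) u = 0) : FGRing.x F ((0, 1) : M × ℤ) ∣ u := by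
  let e := prodIntBasis (Module.Free.chooseBasis ℤ M)
  have he : e (Sum.inr ()) = ((0, 1) : M × ℤ) := by simp [e, prodIntBasis]
  rw [← he]
  refine FGRing.x_basis_dvd e _ fun n ↦ ?_
  have := FGRing.algHom_sub_mem e (AlgHom.id R _)
    ((FGRing.map F (AddMonoidHom.inl M ℤ)).comp (FGRing.map F (AddMonoidHom.fst M ℤ)))
    (augIdeal F (M × ℤ)) (Ideal.span {FGRing.x F (e (Sum.inr ()))} ⊔ augIdeal F (M × ℤ) ^ n)
    (n := n) le_sup_right (fun i ↦ FGRing.x_mem_augIdeal F _)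
    (fun i ↦ by
      rw [AlgHom.comp_apply, FGRing.map_x, FGRing.map_x]
      exact FGRing.x_mem_augIdeal F _)
    (fun i ↦ by
      rw [AlgHom.comp_apply, FGRing.map_x, FGRing.map_x, AlgHom.id_apply]
      rcases i with i | i
      · simp [e, prodIntBasis]
      · have h1 : AddMonoidHom.inl M ℤ (AddMonoidHom.fst M ℤ (e (Sum.inr i))) = 0 := by
          simp [e, prodIntBasis]
        rw [h1, FGRing.x_zero, sub_zero]
        exact Ideal.mem_sup_left (Ideal.mem_span_singleton_self _)) u
  simpa [hu] using this

end Structure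

/-! ### Demazure operators -/

section Demazure

open scoped nonZeroDivisors

variable {R : Type*} [CommRing R] (F : FormalGroup R) [F.IsComm]
variable {M M' : Type*} [AddCommGroup M] [Module.Finite ℤ M] [Module.Free ℤ M]
variable [AddCommGroup M'] [Module.Finite ℤ M'] [Module.Free ℤ M']

/-- The homomorphism `a ↦ (a, -c(a))`. -/
abbrev shiftBy (c : M →+ ℤ) : M →+ M × ℤ := (AddMonoidHom.id M).prod (-c)

/-- The homomorphism `(a, n) ↦ a + n α`. -/
abbrev specAt (α : M) : M × ℤ →+ M := (AddMonoidHom.id M).coprod (zmultiplesHom M α)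

/-- The reflection `a ↦ a - c(a) α`. -/
abbrev reflectBy (α : M) (c : M →+ ℤ) : M →+ M := (specAt α).comp (shiftBy c)

omit [Module.Finite ℤ M] [Module.Free ℤ M] in
lemma reflectBy_apply (α : M) (c : M →+ ℤ) (a : M) : reflectBy α c a = a - c a • α := by
  simp [sub_eq_add_neg]

lemma exists_y_mul_eq (c : M →+ ℤ) (u : FGRing F M) : ∃ z : FGRing F (M × ℤ),
    FGRing.x F ((0, 1) : M × ℤ) * z =
      FGRing.map F (AddMonoidHom.inl M ℤ) u - FGRing.map F (shiftBy c) u := by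
  have h : FGRing.map F (AddMonoidHom.fst M ℤ)
      (FGRing.map F (AddMonoidHom.inl M ℤ) u - FGRing.map F (shiftBy c) u) = 0 := by
    rw [map_sub, FGRing.map_map, FGRing.map_map, sub_eq_zero]
    congr 1
  obtain ⟨z, hz⟩ := FGRing.y_dvd_of_map_fst_eq_zero h
  exact ⟨z, hz.symm⟩

variable {F} in
lemma y_mul_cancel {z z' : FGRing F (M × ℤ)}
    (h : FGRing.x F ((0, 1) : M × ℤ) * z = FGRing.x F ((0, 1) : M × ℤ) * z') : z = z' :=
  (mul_cancel_left_mem_nonZeroDivisors FGRing.y_mem_nonZeroDivisors).mp h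

/-- The generic divided difference `R⟦M⟧_F → R⟦M ⊕ ℤ⟧_F`. -/
def genericDemazure (c : M →+ ℤ) : FGRing F M →ₗ[R] FGRing F (M × ℤ) where
  toFun u := (exists_y_mul_eq F c u).choose
  map_add' u v := y_mul_cancel (by
    rw [mul_add, (exists_y_mul_eq F c (u + v)).choose_spec, (exists_y_mul_eq F c u).choose_spec,
      (exists_y_mul_eq F c v).choose_spec, map_add, map_add]
    ring)
  map_smul' r u := y_mul_cancel (by
    rw [RingHom.id_apply, mul_smul_comm, (exists_y_mul_eq F c (r • u)).choose_spec,
      (exists_y_mul_eq F c u).choose_spec, map_smul, map_smul, smul_sub])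

lemma y_mul_genericDemazure (c : M →+ ℤ) (u : FGRing F M) :
    FGRing.x F ((0, 1) : M × ℤ) * genericDemazure F c u =
      FGRing.map F (AddMonoidHom.inl M ℤ) u - FGRing.map F (shiftBy c) u :=
  (exists_y_mul_eq F c u).choose_spec

lemma eq_genericDemazure {c : M →+ ℤ} {u : FGRing F M} {z : FGRing F (M × ℤ)}
    (h : FGRing.x F ((0, 1) : M × ℤ) * z =
      FGRing.map F (AddMonoidHom.inl M ℤ) u - FGRing.map F (shiftBy c) u) :
    genericDemazure F c u = z :=
  y_mul_cancel ((y_mul_genericDemazure F c u).trans h.symm)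

/-- The Demazure operator attached to `α : M` and `c : M → ℤ`. -/
def demazure (α : M) (c : M →+ ℤ) : Module.End R (FGRing F M) :=
  (FGRing.map F (specAt α)).toLinearMap ∘ₗ genericDemazure F c

lemma demazure_apply (α : M) (c : M →+ ℤ) (u : FGRing F M) :
    demazure F α c u = FGRing.map F (specAt α) (genericDemazure F c u) := rfl

omit [F.IsComm] [Module.Finite ℤ M] [Module.Free ℤ M] in
lemma map_specAt_inl (α : M) (u : FGRing F M) :
    FGRing.map F (specAt α) (FGRing.map F (AddMonoidHom.inl M ℤ) u) = u := by
  rw [FGRing.map_map]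
  have : (specAt α).comp (AddMonoidHom.inl M ℤ) = AddMonoidHom.id M := by ext; simp
  rw [this, FGRing.map_id]

lemma x_mul_demazure (α : M) (c : M →+ ℤ) (u : FGRing F M) :
    FGRing.x F α * demazure F α c u = u - FGRing.map F (reflectBy α c) u := by
  have h := congrArg (FGRing.map F (specAt α)) (y_mul_genericDemazure F c u)
  rw [map_mul, FGRing.map_x, map_sub, map_specAt_inl, FGRing.map_map] at h
  rw [demazure_apply, ← h]
  simp

lemma demazure_mul (α : M) (c : M →+ ℤ) (u v : FGRing F M) :
    demazure F α c (u * v) =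
      demazure F α c u * v + FGRing.map F (reflectBy α c) u * demazure F α c v := by
  have h : genericDemazure F c (u * v) =
      genericDemazure F c u * FGRing.map F (AddMonoidHom.inl M ℤ) v +
        FGRing.map F (shiftBy c) u * genericDemazure F c v := by
    refine eq_genericDemazure F ?_
    rw [mul_add, ← mul_assoc, y_mul_genericDemazure, mul_left_comm, y_mul_genericDemazure,
      map_mul, map_mul]
    ring
  rw [demazure_apply, h, map_add, map_mul, map_mul, map_specAt_inl, FGRing.map_map]
  rfl

/-- Naturality in the lattice, through uniqueness of the generic quotient by y. It allows an
operator on M to be lifted to a lattice where the root element is regular. -/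
lemma map_demazure (f : M →+ M') {α : M} {α' : M'} {c : M →+ ℤ} {c' : M' →+ ℤ}
    (hα : f α = α') (hc : c'.comp f = c) (u : FGRing F M) :
    FGRing.map F f (demazure F α c u) = demazure F α' c' (FGRing.map F f u) := by
  have h : genericDemazure F c' (FGRing.map F f u) =
      FGRing.map F (f.prodMap (AddMonoidHom.id ℤ)) (genericDemazure F c u) := by
    refine eq_genericDemazure F ?_
    have h1 := congrArg (FGRing.map F (f.prodMap (AddMonoidHom.id ℤ)))
      (y_mul_genericDemazure F c u)
    rw [map_mul, map_sub, FGRing.map_x, FGRing.map_map, FGRing.map_map] at h1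
    have h2 : f.prodMap (AddMonoidHom.id ℤ) ((0, 1) : M × ℤ) = (0, 1) := by simp
    rw [h2] at h1
    rw [h1, FGRing.map_map, FGRing.map_map]
    congr 3
    refine AddMonoidHom.ext fun a ↦ Prod.ext (by simp) (by simp [← hc])
  rw [demazure_apply, demazure_apply, h, FGRing.map_map, FGRing.map_map]
  congr 2
  ext
  simp [hα]

-- The m-fold formal multiple of y is m·y to first order; the quotient by y therefore augments to m.
omit [F.IsComm] [Module.Finite ℤ M] [Module.Free ℤ M] in
lemma exists_x_int_eq (m : ℤ) : ∃ q : FGRing F (M × ℤ),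
    FGRing.x F ((0, m) : M × ℤ) = FGRing.x F ((0, 1) : M × ℤ) * q ∧ FGRing.aug F _ q = m := by
  obtain ⟨G, hG⟩ := FGRing.exists_x_add F (M := M × ℤ)
  induction m using Int.induction_on with
  | zero => exact ⟨0, by rw [mul_zero]; exact FGRing.x_zero F, by simp⟩
  | succ m ih =>
    obtain ⟨q, hq, hqm⟩ := ih
    have h := hG (0, (m : ℤ)) (0, 1)
    rw [Prod.mk_add_mk, add_zero, hq] at h
    refine ⟨q + 1 + FGRing.x F ((0, 1) : M × ℤ) * q * G (0, (m : ℤ)) (0, 1), ?_, ?_⟩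
    · rw [h]; ring
    · simp [hqm, FGRing.aug_x]
  | pred m ih =>
    obtain ⟨q, hq, hqm⟩ := ih
    have h := hG (0, -(m : ℤ) - 1) (0, 1)
    rw [Prod.mk_add_mk, add_zero, sub_add_cancel, hq] at h
    refine ⟨q - 1 - FGRing.x F ((0, -(m : ℤ) - 1) : M × ℤ) * G (0, -(m : ℤ) - 1) (0, 1), ?_, ?_⟩
    · linear_combination -h
    · simp [hqm, FGRing.aug_x]

lemma aug_demazure_x (α : M) (c : M →+ ℤ) (a : M) :
    FGRing.aug F M (demazure F α c (FGRing.x F a)) = (c a : R) := by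
  obtain ⟨G, hG⟩ := FGRing.exists_x_add F (M := M × ℤ)
  obtain ⟨q, hq, hqm⟩ := exists_x_int_eq F (M := M) (-c a)
  have h := hG (a, 0) (0, -c a)
  rw [Prod.mk_add_mk, add_zero, zero_add, hq] at h
  have hz : genericDemazure F c (FGRing.x F a) =
      -(q + FGRing.x F ((a, 0) : M × ℤ) * q * G (a, 0) (0, -c a)) := by
    refine eq_genericDemazure F ?_
    rw [FGRing.map_x, FGRing.map_x]
    have h1 : shiftBy c a = (a, -c a) := by simp
    have h2 : AddMonoidHom.inl M ℤ a = (a, 0) := by simp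
    rw [h1, h2, h]
    ring
  rw [demazure_apply, FGRing.aug_map, hz]
  simp [hqm, FGRing.aug_x]

/-- Induction with the twisted Leibniz rule. The truncated exponent makes the case n = 0 vacuous. -/
lemma demazure_mem (α : M) (c : M →+ ℤ) {n : ℕ} {u : FGRing F M} (hu : u ∈ augIdeal F M ^ n) :
    demazure F α c u ∈ augIdeal F M ^ (n - 1) := by
  induction n generalizing u with
  | zero => simp
  | succ n ih =>
    rw [pow_succ'] at hu
    induction hu using Submodule.mul_induction_on' with
    | mem_mul_mem g hg b hb =>
      rw [demazure_mul]
      refine add_mem (Ideal.mul_mem_left _ _ hb) ?_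
      rcases n with _ | n
      · simp
      · rw [Nat.add_sub_cancel, pow_succ']
        refine Ideal.mul_mem_mul ?_ (ih hb)
        rw [← pow_one (augIdeal F M)] at hg ⊢
        exact FGRing.map_mem_augIdeal_pow F _ hg
    | add x _ y _ hx hy => rw [map_add]; exact add_mem hx hy

variable {ι N : Type*} [AddCommGroup N] (P : RootDatum ι M N)

/-- The Demazure operator of the root `α_i`. -/
def rootDemazure (i : ι) : Module.End R (FGRing F M) :=
  demazure F (P.root i) (P.coroot' i).toAddMonoidHom

omit [Module.Finite ℤ M] [Module.Free ℤ M] in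
lemma shiftHom_eq (i : ι) : shiftHom P i = shiftBy (P.coroot' i).toAddMonoidHom := rfl

omit [Module.Finite ℤ M] [Module.Free ℤ M] in
lemma specHom_eq (i : ι) : specHom P i = specAt (P.root i) := rfl

lemma isDemazureOperator_iff {i : ι} {D : Module.End R (FGRing F M)} :
    IsDemazureOperator P F i D ↔ D = rootDemazure F P i := by
  unfold IsDemazureOperator
  simp only [shiftHom_eq, specHom_eq]
  constructor
  · intro h
    refine LinearMap.ext fun u ↦ ?_
    obtain ⟨z, hz, hD⟩ := h u
    have h1 : genericDemazure F (P.coroot' i).toAddMonoidHom u = z := eq_genericDemazure F hz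
    rw [hD, ← h1]
    rfl
  · rintro rfl u
    exact ⟨_, y_mul_genericDemazure F _ u, rfl⟩

end Demazure

end FormalGroupRing

end

noncomputable section

namespace FormalGroupRing

/-! ### The Weyl group acting on roots and weights -/

section WeylGroup

open RootPairing
section

variable {ι M N : Type*} [AddCommGroup M] [AddCommGroup N] (P : RootDatum ι M N)

/-- The reflection in the root `α_i`, as an element of the Weyl group. -/
abbrev weylReflection (i : ι) : P.weylGroup := weylGroup.ofIdx P i

/-- The element of the Weyl group spelled by a word. -/
def weylWord (L : List ι) : P.weylGroup := (L.map (weylReflection P)).prod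

@[simp] lemma weylWord_nil : weylWord P [] = 1 := rfl

@[simp] lemma weylWord_cons (i : ι) (L : List ι) :
    weylWord P (i :: L) = weylReflection P i * weylWord P L := by
  simp [weylWord]

@[simp] lemma weylWord_append (L L' : List ι) :
    weylWord P (L ++ L') = weylWord P L * weylWord P L' := by
  simp [weylWord]

lemma wordProd_eq (L : List ι) : wordProd P L = Equiv.weightHom P (weylWord P L : P.Aut) := by
  induction L with
  | nil => exact (map_one (Equiv.weightHom P)).symm
  | cons i L ih =>
    rw [weylWord_cons, Subgroup.coe_mul, map_mul, ← ih]
    have : Equiv.weightHom P (weylReflection P i : P.Aut) = P.reflection i := by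
      ext x; rfl
    simp only [wordProd, List.map_cons, List.prod_cons, this]

lemma wordProd_eq_iff {L L' : List ι} :
    wordProd P L = wordProd P L' ↔ weylWord P L = weylWord P L' := by
  rw [wordProd_eq, wordProd_eq, (Equiv.weightHom_injective P).eq_iff, Subtype.ext_iff]

lemma weylReflection_smul (i j : ι) : weylReflection P i • j = P.reflectionPerm i j := rfl

lemma weylReflection_smul_vec (i : ι) (x : M) : weylReflection P i • x = P.reflection i x := rfl

variable {P}

lemma root_weyl_smul (w : P.weylGroup) (i : ι) : P.root (w • i) = w • P.root i :=
  (P.weylGroup_apply_root w i).symm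

lemma weylReflection_mul_self (i : ι) : weylReflection P i * weylReflection P i = 1 := by
  refine Subtype.ext ?_
  change Equiv.reflection P i * Equiv.reflection P i = 1
  rw [mul_eq_one_iff_inv_eq, Equiv.reflection_inv]

lemma weylReflection_inv (i : ι) : (weylReflection P i)⁻¹ = weylReflection P i :=
  inv_eq_of_mul_eq_one_left (weylReflection_mul_self i)

lemma weyl_induction {p : P.weylGroup → Prop} (h : ∀ i, p (weylReflection P i)) (h1 : p 1)
    (hmul : ∀ x y, p x → p y → p (x * y)) (w : P.weylGroup) : p w := by
  obtain ⟨w, hw⟩ := w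
  induction hw using weylGroup.induction with
  | mem i => exact h i
  | one => exact h1
  | mul x y hx hy ihx ihy => exact hmul _ _ ihx ihy

lemma coroot'_weyl_smul (w : P.weylGroup) (i : ι) (x : M) :
    P.coroot' (w • i) (w • x) = P.coroot' i x := by
  induction w using weyl_induction generalizing i x with
  | h j =>
    rw [weylReflection_smul, weylReflection_smul_vec, ← coroot'_reflection,
      reflection_same]
  | h1 => simp
  | hmul v w hv hw => rw [mul_smul, mul_smul, hv, hw]

lemma weylReflection_weyl_smul (w : P.weylGroup) (i : ι) :
    weylReflection P (w • i) = w * weylReflection P i * w⁻¹ := by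
  refine Subtype.ext (Equiv.weightHom_injective P (LinearEquiv.ext fun x ↦ ?_))
  change weylReflection P (w • i) • x = (w * weylReflection P i * w⁻¹) • x
  rw [mul_smul, mul_smul, weylReflection_smul_vec, weylReflection_smul_vec,
    reflection_apply, reflection_apply, smul_sub, smul_inv_smul, root_weyl_smul,
    ← coroot'_weyl_smul w i (w⁻¹ • x), smul_inv_smul, smul_comm]

lemma root_neg (i : ι) : P.root (P.reflectionPerm i i) = -P.root i := by
  rw [root_reflectionPerm, reflection_apply_self]

lemma neg_neg_index (i : ι) :
    P.reflectionPerm (P.reflectionPerm i i) (P.reflectionPerm i i) = i :=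
  P.root.injective (by rw [root_neg, root_neg, neg_neg])

lemma weyl_smul_neg (w : P.weylGroup) (i : ι) :
    w • P.reflectionPerm i i = P.reflectionPerm (w • i) (w • i) := by
  refine P.root.injective ?_
  rw [root_weyl_smul, root_neg, root_neg, smul_neg, root_weyl_smul]

lemma weylReflection_neg (i : ι) : weylReflection P (P.reflectionPerm i i) = weylReflection P i := by
  rw [← weylReflection_smul, weylReflection_weyl_smul, mul_assoc, mul_inv_cancel, mul_one]

variable (b : P.Base)

lemma isPos_neg {i : ι} : b.IsPos (P.reflectionPerm i i) ↔ ¬ b.IsPos i :=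
  Base.IsPos.neg_iff_not b i

variable [Finite ι] [P.IsReduced]

lemma isPos_reflectionPerm_iff {i j : ι} (hi : i ∈ b.support) (h1 : j ≠ i)
    (h2 : j ≠ P.reflectionPerm i i) : b.IsPos (P.reflectionPerm i j) ↔ b.IsPos j := by
  constructor
  · intro h
    by_contra hj
    rw [← isPos_neg] at hj
    have h3 := hj.reflectionPerm hi (fun h ↦ h2 (by
      rw [← h, neg_neg_index]))
    rw [← weylReflection_smul, weyl_smul_neg, isPos_neg] at h3
    exact h3 h
  · exact fun h ↦ h.reflectionPerm hi h1

variable (P) in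
-- Every root is reached from simple ones by simple reflections and negation, and conjugating a
-- reflection moves its root; so simple reflections generate.
lemma exists_word (w : P.weylGroup) : ∃ L : List ι, (∀ i ∈ L, i ∈ b.support) ∧ weylWord P L = w := by
  induction w using weyl_induction with
  | h i =>
    induction i using b.induction_reflect with
    | h₀ i ih => rwa [weylReflection_neg]
    | h₁ i hi => exact ⟨[i], by simpa using hi, by simp⟩
    | h₂ i j ih hj =>
      obtain ⟨L, hL, hLi⟩ := ih
      refine ⟨j :: L ++ [j], ?_, ?_⟩
      · intro k hk
        simp only [List.cons_append, List.mem_cons, List.mem_append, List.not_mem_nil,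
          or_false] at hk
        rcases hk with rfl | hk | rfl
        exacts [hj, hL k hk, hj]
      · rw [← weylReflection_smul, weylReflection_weyl_smul, weylReflection_inv]
        simp [hLi, mul_assoc]
  | h1 => exact ⟨[], by simp, rfl⟩
  | hmul v w hv hw =>
    obtain ⟨L, hL, rfl⟩ := hv
    obtain ⟨L', hL', rfl⟩ := hw
    refine ⟨L ++ L', fun k hk ↦ ?_, by simp⟩
    rcases List.mem_append.mp hk with h | h
    exacts [hL k h, hL' k h]

end

end WeylGroup

end FormalGroupRing

end

noncomputable section

namespace FormalGroupRing

/-! ### Length as number of inversions, and the longest element -/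

section Inversions

open RootPairing

variable {ι M N : Type*} [AddCommGroup M] [AddCommGroup N] {P : RootDatum ι M N} (b : P.Base)
variable [Fintype ι]

open scoped Classical in
/-- The positive roots which are sent to negative roots by `w`. -/
def inversions (w : P.weylGroup) : Finset ι :=
  Finset.univ.filter fun i ↦ b.IsPos i ∧ ¬ b.IsPos (w • i)

variable {b}

lemma mem_inversions {w : P.weylGroup} {i : ι} :
    i ∈ inversions b w ↔ b.IsPos i ∧ ¬ b.IsPos (w • i) := by
  simp [inversions]

lemma inversions_one : inversions b (1 : P.weylGroup) = ∅ := by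
  ext i
  simp [mem_inversions]

variable (b) in
lemma card_inversions_inv (w : P.weylGroup) :
    (inversions b w⁻¹).card = (inversions b w).card := by
  refine (Finset.card_bij (fun i _ ↦ P.reflectionPerm (w • i) (w • i)) ?_ ?_ ?_).symm
  · intro i hi
    rw [mem_inversions] at hi ⊢
    rw [← weyl_smul_neg, inv_smul_smul, isPos_neg, not_not, weyl_smul_neg, isPos_neg]
    exact ⟨hi.2, hi.1⟩
  · intro i _ j _ hij
    have := congrArg P.root hij
    rw [root_neg, root_neg, neg_inj, P.root.apply_eq_iff_eq] at this
    exact MulAction.injective w this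
  · intro j hj
    rw [mem_inversions] at hj
    refine ⟨w⁻¹ • P.reflectionPerm j j, ?_, ?_⟩
    · rw [mem_inversions, smul_inv_smul, weyl_smul_neg, isPos_neg, isPos_neg, not_not]
      exact ⟨hj.2, hj.1⟩
    · rw [smul_inv_smul, neg_neg_index]

variable [P.IsReduced]

-- A simple reflection changes the sign of ±α_i only, so the one new inversion is the root that w
-- sends to α_i.
open scoped Classical in
lemma inversions_mul_of_pos {i : ι} (hi : i ∈ b.support) {w : P.weylGroup}
    (h : b.IsPos (w⁻¹ • i)) :
    inversions b (weylReflection P i * w) = insert (w⁻¹ • i) (inversions b w) ∧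
      w⁻¹ • i ∉ inversions b w := by
  have hipos : b.IsPos i := Base.isPos_of_mem_support hi
  refine ⟨?_, ?_⟩
  · ext j
    rw [Finset.mem_insert, mem_inversions, mem_inversions, mul_smul, weylReflection_smul]
    by_cases h1 : w • j = i
    · have : j = w⁻¹ • i := by rw [← h1, inv_smul_smul]
      rw [h1, isPos_neg]
      simp only [this, true_or, iff_true]
      exact ⟨h, not_not.mpr hipos⟩
    · have h1' : j ≠ w⁻¹ • i := fun hj ↦ h1 (by rw [hj, smul_inv_smul])
      by_cases h2 : w • j = P.reflectionPerm i i
      · have h3 : ¬ b.IsPos j := by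
          have : j = w⁻¹ • P.reflectionPerm i i := by rw [← h2, inv_smul_smul]
          rw [this, weyl_smul_neg, isPos_neg]
          exact not_not.mpr h
        simp [h3, h1']
      · rw [isPos_reflectionPerm_iff b hi h1 h2]
        simp [h1']
  · rw [mem_inversions, smul_inv_smul]
    exact fun h ↦ h.2 hipos

lemma card_inversions_mul_of_pos {i : ι} (hi : i ∈ b.support) {w : P.weylGroup}
    (h : b.IsPos (w⁻¹ • i)) :
    (inversions b (weylReflection P i * w)).card = (inversions b w).card + 1 := by
  classical
  obtain ⟨h1, h2⟩ := inversions_mul_of_pos hi h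
  rw [h1, Finset.card_insert_of_notMem h2]

omit [Fintype ι] [P.IsReduced] in
lemma weyl_inv_smul_neg {i : ι} {w : P.weylGroup} :
    (weylReflection P i * w)⁻¹ • i = w⁻¹ • P.reflectionPerm i i := by
  rw [mul_inv_rev, mul_smul, weylReflection_inv, weylReflection_smul]

lemma card_inversions_mul_of_neg {i : ι} (hi : i ∈ b.support) {w : P.weylGroup}
    (h : ¬ b.IsPos (w⁻¹ • i)) :
    (inversions b (weylReflection P i * w)).card + 1 = (inversions b w).card := by
  have h1 : b.IsPos ((weylReflection P i * w)⁻¹ • i) := by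
    rw [weyl_inv_smul_neg, weyl_smul_neg, isPos_neg]
    exact h
  have := card_inversions_mul_of_pos hi h1
  rw [← mul_assoc, weylReflection_mul_self, one_mul] at this
  exact this.symm

lemma card_inversions_weylWord_le {L : List ι} (hL : ∀ i ∈ L, i ∈ b.support) :
    (inversions b (weylWord P L)).card ≤ L.length := by
  induction L with
  | nil => simp [inversions_one]
  | cons i L ih =>
    have hi := hL i (by simp)
    have ih := ih (fun j hj ↦ hL j (by simp [hj]))
    rw [weylWord_cons, List.length_cons]
    by_cases h : b.IsPos ((weylWord P L)⁻¹ • i)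
    · rw [card_inversions_mul_of_pos hi h]
      lia
    · have := card_inversions_mul_of_neg hi h
      lia

/-- The deletion property. -/
lemma exists_word_of_mem_inversions {L : List ι} (hL : ∀ i ∈ L, i ∈ b.support) {j : ι}
    (hj : j ∈ inversions b (weylWord P L)) : ∃ K : List ι, (∀ i ∈ K, i ∈ b.support) ∧
      K.length + 1 = L.length ∧ weylWord P K = weylWord P L * weylReflection P j := by
  induction L with
  | nil => simp [inversions_one] at hj
  | cons i L ih =>
    have hi := hL i (by simp)
    have hL' : ∀ i ∈ L, i ∈ b.support := fun j hj ↦ hL j (by simp [hj])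
    by_cases h : j ∈ inversions b (weylWord P L)
    · obtain ⟨K, hK, hKL, hKw⟩ := ih hL' h
      refine ⟨i :: K, ?_, by simp [hKL], by simp [hKw, mul_assoc]⟩
      intro k hk
      rcases List.mem_cons.mp hk with rfl | hk
      exacts [hi, hK k hk]
    · have h1 : weylWord P L • j = i := by
        by_contra h1
        rw [mem_inversions, weylWord_cons, mul_smul, weylReflection_smul] at hj
        rw [mem_inversions, not_and_not_right] at h
        exact hj.2 ((h hj.1).reflectionPerm hi h1)
      refine ⟨L, hL', by simp, ?_⟩
      rw [weylWord_cons, ← h1, weylReflection_weyl_smul]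
      simp [mul_assoc, weylReflection_mul_self]

/-- If a nonempty word with first letter i spells an element w without inversions, then w⁻¹ has none
either, so w⁻¹α_i is positive and is an inversion of the tail s_i w. Deletion in the tail spells s_i
w · s_{w⁻¹α_i} = w by a word two letters shorter, and induction on the word applies. -/
lemma eq_one_of_inversions_eq_empty {w : P.weylGroup} (h : inversions b w = ∅) : w = 1 := by
  obtain ⟨L, hL, rfl⟩ := exists_word P b w
  induction hn : L.length using Nat.strong_induction_on generalizing L with
  | _ n ih =>
    rcases L with _ | ⟨i, L⟩
    · rfl
    · have hi := hL i (by simp)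
      have hL' : ∀ i ∈ L, i ∈ b.support := fun j hj ↦ hL j (by simp [hj])
      have hpos : b.IsPos ((weylWord P (i :: L))⁻¹ • i) := by
        have h1 : i ∉ inversions b (weylWord P (i :: L))⁻¹ := by
          have := card_inversions_inv b (weylWord P (i :: L))
          rw [h, Finset.card_empty, Finset.card_eq_zero] at this
          rw [this]
          exact Finset.notMem_empty _
        rw [mem_inversions, not_and_not_right] at h1
        exact h1 (Base.isPos_of_mem_support hi)
      classical
      have h2 := (inversions_mul_of_pos hi hpos).1
      rw [weylWord_cons, ← mul_assoc, weylReflection_mul_self, one_mul] at h2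
      obtain ⟨K, hK, hKL, hKw⟩ := exists_word_of_mem_inversions hL'
        (by rw [h2]; exact Finset.mem_insert_self _ _)
      have h3 : weylWord P K = weylWord P (i :: L) := by
        rw [hKw, weylReflection_weyl_smul]
        simp [mul_assoc]
      rw [List.length_cons] at hn
      rw [← h3]
      exact ih K.length (by lia) K hK (by rwa [h3]) rfl

lemma finite_weylGroup (b : P.Base) : Finite P.weylGroup := by
  refine Finite.of_injective (MulAction.toPermHom P.weylGroup ι)
    ((injective_iff_map_eq_one _).mpr fun w hw ↦ ?_)
  refine eq_one_of_inversions_eq_empty (b := b) ?_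
  ext i
  have : w • i = i := DFunLike.congr_fun hw i
  simp [mem_inversions, this]

omit [P.IsReduced] in
lemma isPos_weyl_smul_of_simple {w : P.weylGroup} (h : ∀ i ∈ b.support, b.IsPos (w • i)) {i : ι}
    (hi : b.IsPos i) : b.IsPos (w • i) := by
  refine hi.induction_on_add h fun i j k hk hik hj ↦ ?_
  refine hik.add (h j hj) ?_
  rw [root_weyl_smul, hk, smul_add, root_weyl_smul, root_weyl_smul]

omit [P.IsReduced] in
lemma not_isPos_weyl_smul_of_simple {w : P.weylGroup} (h : ∀ i ∈ b.support, ¬ b.IsPos (w • i))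
    {i : ι} (hi : b.IsPos i) : ¬ b.IsPos (w • i) := by
  refine hi.induction_on_add h fun i j k hk hik hj ↦ ?_
  have h1 := h j hj
  rw [← isPos_neg] at hik h1 ⊢
  refine hik.add h1 ?_
  rw [root_neg, root_neg, root_neg, root_weyl_smul, hk, smul_add, root_weyl_smul, root_weyl_smul,
    neg_add]

lemma exists_word_card (b : P.Base) (w : P.weylGroup) : ∃ L : List ι, (∀ i ∈ L, i ∈ b.support) ∧
    weylWord P L = w ∧ L.length = (inversions b w).card := by
  induction hn : (inversions b w).card generalizing w with
  | zero =>
    rw [Finset.card_eq_zero] at hn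
    exact ⟨[], by simp, by simp [eq_one_of_inversions_eq_empty hn], rfl⟩
  | succ n ih =>
    obtain ⟨i, hi, hneg⟩ : ∃ i ∈ b.support, ¬ b.IsPos (w⁻¹ • i) := by
      by_contra! h
      have h1 : inversions b w⁻¹ = ∅ := by
        ext j
        simp only [mem_inversions, Finset.notMem_empty, iff_false, not_and_not_right]
        exact fun hj ↦ isPos_weyl_smul_of_simple h hj
      have h2 := card_inversions_inv b w
      rw [h1, hn] at h2
      simp at h2
    have h1 := card_inversions_mul_of_neg hi hneg
    obtain ⟨L, hL, hLw, hLn⟩ := ih (weylReflection P i * w) (by lia)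
    refine ⟨i :: L, ?_, ?_, by simp [hLn]⟩
    · intro k hk
      rcases List.mem_cons.mp hk with rfl | hk
      exacts [hi, hL k hk]
    · rw [weylWord_cons, hLw, ← mul_assoc, weylReflection_mul_self, one_mul]

omit [P.IsReduced] in
omit [Fintype ι] in
lemma isReducedWord_iff {L : List ι} : IsReducedWord b L ↔ (∀ i ∈ L, i ∈ b.support) ∧
    ∀ L' : List ι, (∀ i ∈ L', i ∈ b.support) → weylWord P L' = weylWord P L →
      L.length ≤ L'.length := by
  simp only [IsReducedWord, wordProd_eq_iff]

lemma length_eq_of_isReducedWord {L : List ι} (hL : IsReducedWord b L) :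
    L.length = (inversions b (weylWord P L)).card := by
  rw [isReducedWord_iff] at hL
  obtain ⟨K, hK, hKw, hKn⟩ := exists_word_card b (weylWord P L)
  refine le_antisymm ?_ (card_inversions_weylWord_le hL.1)
  rw [← hKn]
  exact hL.2 K hK hKw

section Longest

variable {L₀ : List ι} (hL₀ : IsLongestReducedWord b L₀)
include hL₀

lemma card_inversions_le (w : P.weylGroup) : (inversions b w).card ≤ L₀.length := by
  obtain ⟨K, hK, hKw, hKn⟩ := exists_word_card b w
  rw [← hKn]
  refine hL₀.2 K (isReducedWord_iff.mpr ⟨hK, fun K' hK' h ↦ ?_⟩)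
  rw [hKn, ← hKw, ← h]
  exact card_inversions_weylWord_le hK'

lemma not_isPos_longest_smul {i : ι} (hi : b.IsPos i) : ¬ b.IsPos (weylWord P L₀ • i) := by
  refine not_isPos_weyl_smul_of_simple (fun j hj hpos ↦ ?_) hi
  have h1 := card_inversions_mul_of_pos (w := (weylWord P L₀)⁻¹) hj (by rwa [inv_inv])
  rw [card_inversions_inv, ← length_eq_of_isReducedWord hL₀.1] at h1
  have := card_inversions_le hL₀ (weylReflection P j * (weylWord P L₀)⁻¹)
  lia

/-- The map β ↦ -w₀β matches the inversions of w⁻¹w₀ with the positive roots that are not inversions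
of w⁻¹. -/
lemma card_inversions_inv_mul_longest (w : P.weylGroup) :
    (inversions b (w⁻¹ * weylWord P L₀)).card + (inversions b w).card = L₀.length := by
  classical
  set w₀ := weylWord P L₀
  have hpos : inversions b w₀ = Finset.univ.filter fun i ↦ b.IsPos i := by
    ext i
    simp only [mem_inversions, Finset.mem_filter, Finset.mem_univ, true_and, and_iff_left_iff_imp]
    exact fun hi ↦ not_isPos_longest_smul hL₀ hi
  have hbij : (inversions b (w⁻¹ * w₀)).card =
      (inversions b w₀ \ inversions b w⁻¹).card := by
    refine Finset.card_bij (fun i _ ↦ P.reflectionPerm (w₀ • i) (w₀ • i)) ?_ ?_ ?_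
    · intro i hi
      rw [mem_inversions, mul_smul] at hi
      rw [hpos, Finset.mem_sdiff, Finset.mem_filter, mem_inversions, isPos_neg, not_and_not_right,
        weyl_smul_neg, isPos_neg]
      exact ⟨⟨Finset.mem_univ _, not_isPos_longest_smul hL₀ hi.1⟩, fun _ ↦ hi.2⟩
    · intro i _ j _ hij
      have := congrArg P.root hij
      rw [root_neg, root_neg, neg_inj, P.root.apply_eq_iff_eq] at this
      exact MulAction.injective w₀ this
    · intro j hj
      rw [hpos, Finset.mem_sdiff, Finset.mem_filter, mem_inversions, not_and_not_right] at hj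
      obtain ⟨⟨_, h1⟩, h2⟩ := hj
      refine ⟨w₀⁻¹ • P.reflectionPerm j j, ?_, ?_⟩
      · rw [mem_inversions, mul_smul, smul_inv_smul, weyl_smul_neg w⁻¹, isPos_neg, not_not]
        refine ⟨?_, h2 h1⟩
        by_contra h3
        rw [← isPos_neg, ← weyl_smul_neg, neg_neg_index] at h3
        have := not_isPos_longest_smul hL₀ h3
        rw [smul_inv_smul] at this
        exact this h1
      · rw [smul_inv_smul, neg_neg_index]
  have hsub : inversions b w⁻¹ ⊆ inversions b w₀ := by
    rw [hpos]
    intro i hi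
    simp [(mem_inversions.mp hi).1]
  rw [hbij, ← card_inversions_inv b w, Finset.card_sdiff_add_card_eq_card hsub,
    length_eq_of_isReducedWord hL₀.1]

lemma eq_longest_of_card {w : P.weylGroup} (h : (inversions b w).card = L₀.length) :
    w = weylWord P L₀ := by
  have h1 := card_inversions_inv_mul_longest hL₀ w
  have h2 : inversions b (w⁻¹ * weylWord P L₀) = ∅ := by
    rw [← Finset.card_eq_zero]
    lia
  exact inv_mul_eq_one.mp (eq_one_of_inversions_eq_empty h2)

end Longest

/-! ### Sums over the deletions of a letter -/

section WordDeletion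

/-- The words obtained from a word by deleting a letter, each with the index of the root whose
reflection is thereby multiplied from the right. -/
def deletions (P : RootDatum ι M N) : List ι → List (ι × List ι)
  | [] => []
  | i :: L => ((weylWord P L)⁻¹ • i, L) :: (deletions P L).map fun p ↦ (p.1, i :: p.2)

omit [Fintype ι] [P.IsReduced] in
lemma of_mem_deletions {L : List ι} {p : ι × List ι} (hp : p ∈ deletions P L) :
    p.2.length + 1 = L.length ∧ ∀ i ∈ p.2, i ∈ L := by
  induction L generalizing p with
  | nil => simp [deletions] at hp
  | cons i L ih =>
    rw [deletions, List.mem_cons, List.mem_map] at hp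
    rcases hp with rfl | ⟨q, hq, rfl⟩
    · exact ⟨by simp, fun j hj ↦ by simp [hj]⟩
    · obtain ⟨h1, h2⟩ := ih hq
      refine ⟨by simp [h1], fun j hj ↦ ?_⟩
      rcases List.mem_cons.mp hj with rfl | hj
      · simp
      · simp [h2 j hj]

/-- A deletion is recorded by the root w⁻¹α_i at its letter, possibly negative. For a word that is
not reduced, a root crossed once in each sense gives the same element after deletion with opposite
values of χ. After cancellation only the inversions remain, which depend on the product and not on
the word. -/
lemma sum_deletions {A : Type*} [CommRing A] {L : List ι} (hL : ∀ i ∈ L, i ∈ b.support)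
    (χ : ι → A) (hχ : ∀ i, χ (P.reflectionPerm i i) = - χ i) (G : P.weylGroup → A) :
    ((deletions P L).map fun p ↦ χ p.1 * G (weylWord P p.2)).sum =
      ∑ j ∈ inversions b (weylWord P L), χ j * G (weylWord P L * weylReflection P j) := by
  classical
  induction L generalizing G with
  | nil => simp [deletions, inversions_one]
  | cons i L ih =>
    have hi := hL i (by simp)
    have ih := ih (fun j hj ↦ hL j (by simp [hj])) (fun w ↦ G (weylReflection P i * w))
    set w := weylWord P L with hw
    have h1 : ((deletions P (i :: L)).map fun p ↦ χ p.1 * G (weylWord P p.2)).sum =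
        χ (w⁻¹ • i) * G w + ∑ j ∈ inversions b w,
          χ j * G (weylReflection P i * w * weylReflection P j) := by
      rw [deletions, List.map_cons, List.sum_cons, List.map_map]
      refine congrArg₂ _ rfl ?_
      simp only [mul_assoc]
      rw [← ih]
      rfl
    have h2 : weylReflection P i * w * weylReflection P (w⁻¹ • i) = w := by
      rw [weylReflection_weyl_smul, inv_inv, mul_assoc, mul_assoc, mul_inv_cancel_left,
        ← mul_assoc, weylReflection_mul_self, one_mul]
    rw [h1, weylWord_cons, ← hw]
    by_cases h : b.IsPos (w⁻¹ • i)
    · obtain ⟨h3, h4⟩ := inversions_mul_of_pos hi h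
      rw [h3, Finset.sum_insert h4, h2]
    · have h' : b.IsPos ((weylReflection P i * w)⁻¹ • i) := by
        rw [weyl_inv_smul_neg, weyl_smul_neg, isPos_neg]
        exact h
      obtain ⟨h3, h4⟩ := inversions_mul_of_pos hi h'
      rw [← mul_assoc, weylReflection_mul_self, one_mul] at h3
      rw [h3, Finset.sum_insert h4, weyl_inv_smul_neg, weyl_smul_neg, hχ, weylReflection_neg, h2]
      ring

end WordDeletion

end Inversions

end FormalGroupRing

end

noncomputable section

namespace FormalGroupRing

/-! ### Leading terms of composites of Demazure operators -/

section LeadingTerms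

open RootPairing

variable {R : Type*} [CommRing R] (F : FormalGroup R) [F.IsComm]
variable {ι M N : Type*} [AddCommGroup M] [Module.Finite ℤ M] [Module.Free ℤ M] [AddCommGroup N]
variable (P : RootDatum ι M N)

/-- The composite of the Demazure operators along a word. -/
def wordDemazure (L : List ι) : Module.End R (FGRing F M) := (L.map (rootDemazure F P)).prod

@[simp] lemma wordDemazure_nil : wordDemazure F P [] = 1 := rfl

@[simp] lemma wordDemazure_cons (i : ι) (L : List ι) :
    wordDemazure F P (i :: L) = rootDemazure F P i * wordDemazure F P L := by
  simp [wordDemazure]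

@[simp] lemma wordDemazure_append (L L' : List ι) :
    wordDemazure F P (L ++ L') = wordDemazure F P L * wordDemazure F P L' := by
  simp [wordDemazure]

lemma rootDemazure_mem (i : ι) {n : ℕ} {u : FGRing F M} (hu : u ∈ augIdeal F M ^ n) :
    rootDemazure F P i u ∈ augIdeal F M ^ (n - 1) :=
  demazure_mem F _ _ hu

lemma wordDemazure_mem (L : List ι) {n : ℕ} {u : FGRing F M} (hu : u ∈ augIdeal F M ^ n) :
    wordDemazure F P L u ∈ augIdeal F M ^ (n - L.length) := by
  induction L with
  | nil => simpa using hu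
  | cons i L ih =>
    rw [wordDemazure_cons, Module.End.mul_apply, List.length_cons, ← Nat.sub_sub]
    exact rootDemazure_mem F P i ih

lemma aug_wordDemazure_of_lt (L : List ι) {n : ℕ} {u : FGRing F M} (hu : u ∈ augIdeal F M ^ n)
    (h : L.length < n) : FGRing.aug F M (wordDemazure F P L u) = 0 :=
  Ideal.pow_le_self (I := augIdeal F M) (by omega) (wordDemazure_mem F P L hu)

omit [F.IsComm] [Module.Finite ℤ M] [Module.Free ℤ M] in
lemma map_reflectBy_root (i : ι) : reflectBy (P.root i) (P.coroot' i).toAddMonoidHom =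
    DistribSMul.toAddMonoidHom M (weylReflection P i) := by
  ext a
  rw [reflectBy_apply, DistribSMul.toAddMonoidHom_apply, weylReflection_smul_vec,
    RootPairing.reflection_apply]
  rfl

lemma rootDemazure_mul (i : ι) (u v : FGRing F M) :
    rootDemazure F P i (u * v) = rootDemazure F P i u * v +
      FGRing.map F (DistribSMul.toAddMonoidHom M (weylReflection P i)) u * rootDemazure F P i v := by
  rw [rootDemazure, demazure_mul, map_reflectBy_root]

lemma aug_rootDemazure_x (i : ι) (a : M) :
    FGRing.aug F M (rootDemazure F P i (FGRing.x F a)) = (P.coroot' i a : R) :=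
  aug_demazure_x F _ _ a

/-- Moving x_a through the word by the twisted Leibniz rule either acts on a by a reflection or
consumes one operator. In the latter case Δ_i(x_b) is, modulo I, the integer ⟨b, α_i^∨⟩. -/
lemma wordDemazure_x_mul_sub_mem (L : List ι) (a : M) {m : ℕ} (hL : L.length ≤ m + 1)
    {u : FGRing F M} (hu : u ∈ augIdeal F M ^ m) :
    wordDemazure F P L (FGRing.x F a * u) -
      (FGRing.x F (weylWord P L • a) * wordDemazure F P L u +
        ((deletions P L).map fun p ↦ (P.coroot' p.1 a : R) • wordDemazure F P p.2 u).sum) ∈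
      augIdeal F M ^ (m + 2 - L.length) := by
  induction L with
  | nil => simp [deletions]
  | cons i L ih =>
    rw [List.length_cons] at hL
    have h := rootDemazure_mem F P i (ih (by omega))
    rw [Nat.sub_sub] at h
    rw [map_sub, map_add, rootDemazure_mul, FGRing.map_x, map_list_sum, List.map_map] at h
    have h1 : (rootDemazure F P i (FGRing.x F (weylWord P L • a)) -
        algebraMap R _ (P.coroot' ((weylWord P L)⁻¹ • i) a : R)) * wordDemazure F P L u ∈
          augIdeal F M ^ (m + 2 - (L.length + 1)) := by
      -- One order comes from replacing Δ_i(x_b) by its constant term, the others from Δ_L(u). The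
      -- truncated subtractions agree because L has at most m letters here.
      have h2 : m + 2 - (L.length + 1) = 1 + (m - L.length) := by omega
      rw [h2, pow_add, pow_one]
      refine Ideal.mul_mem_mul ?_ (wordDemazure_mem F P L hu)
      rw [RingHom.mem_ker, map_sub, aug_rootDemazure_x,
        ← coroot'_weyl_smul (weylWord P L) ((weylWord P L)⁻¹ • i) a, smul_inv_smul]
      simp
    have h3 := add_mem h h1
    rw [List.length_cons]
    convert h3 using 1

    simp only [deletions, wordDemazure_cons, Module.End.mul_apply, List.map_cons, List.sum_cons,
      List.map_map, weylWord_cons, mul_smul, DistribSMul.toAddMonoidHom_apply, Function.comp_def,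
      map_smul, sub_mul, ← Algebra.smul_def]
    ring

lemma aug_wordDemazure_x_mul (L : List ι) (a : M) {m : ℕ} (hL : L.length ≤ m + 1)
    {u : FGRing F M} (hu : u ∈ augIdeal F M ^ m) :
    FGRing.aug F M (wordDemazure F P L (FGRing.x F a * u)) =
      ((deletions P L).map fun p ↦
        (P.coroot' p.1 a : R) * FGRing.aug F M (wordDemazure F P p.2 u)).sum := by
  have h : _ ∈ augIdeal F M :=
    Ideal.pow_le_self (by omega) (wordDemazure_x_mul_sub_mem F P L a hL hu)
  rw [RingHom.mem_ker, map_sub, sub_eq_zero, map_add, map_mul (FGRing.aug F M), FGRing.aug_x, zero_mul, zero_add,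
    map_list_sum, List.map_map] at h
  rw [h]
  simp [Function.comp_def]

lemma aug_wordDemazure_mul (L : List ι) {m : ℕ} (hL : L.length ≤ m) (s : FGRing F M)
    {u : FGRing F M} (hu : u ∈ augIdeal F M ^ m) :
    FGRing.aug F M (wordDemazure F P L (s * u)) =
      FGRing.aug F M s * FGRing.aug F M (wordDemazure F P L u) := by
  have h : (s - algebraMap R _ (FGRing.aug F M s)) * u ∈ augIdeal F M ^ (m + 1) := by
    rw [pow_succ']
    refine Ideal.mul_mem_mul ?_ hu
    simp [RingHom.mem_ker]
  have h1 := aug_wordDemazure_of_lt F P L h (by omega)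
  rw [sub_mul, ← Algebra.smul_def, map_sub, map_sub, map_smul, map_smul, sub_eq_zero] at h1
  rw [h1, smul_eq_mul]

omit [F.IsComm] [Module.Finite ℤ M] [Module.Free ℤ M] in
lemma list_prod_x_mem (l : List M) :
    (l.map (FGRing.x F)).prod ∈ augIdeal F M ^ l.length := by
  induction l with
  | nil => simp
  | cons a l ih =>
    rw [List.map_cons, List.prod_cons, List.length_cons, pow_succ']
    exact Ideal.mul_mem_mul (FGRing.x_mem_augIdeal F a) ih

lemma augIdeal_pow_eq_span (m : ℕ) : augIdeal F M ^ m =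
    Ideal.span {u | ∃ l : List M, l.length = m ∧ (l.map (FGRing.x F)).prod = u} := by
  refine le_antisymm ?_ (Ideal.span_le.mpr ?_)
  · induction m with
    | zero =>
      refine le_of_le_of_eq le_top (((Ideal.eq_top_iff_one _).mpr (Ideal.subset_span ?_)).symm)
      exact ⟨[], rfl, rfl⟩
    | succ m ih =>
      rw [pow_succ']
      refine (Ideal.mul_mono augIdeal_eq_span_x.le ih).trans ?_
      rw [Ideal.span_mul_span', Ideal.span_le]
      rintro _ ⟨_, ⟨a, rfl⟩, _, ⟨l, hl, rfl⟩, rfl⟩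
      exact Ideal.subset_span ⟨a :: l, by simp [hl], by simp⟩
  · rintro _ ⟨l, rfl, rfl⟩
    exact list_prod_x_mem F l

variable {P} [Fintype ι] [P.IsReduced] (b : P.Base)

variable (R) in
/-- The value at `0` of a composite of Demazure operators with product `w` on a product of
generators `x_a`, which is of the same degree as the composite. -/
def leadingCoeff : List M → P.weylGroup → R
  | [], _ => 1
  | a :: l, w => ∑ j ∈ inversions b w, (P.coroot' j a : R) * leadingCoeff l (w * weylReflection P j)

variable {b}

lemma aug_wordDemazure_prod {L : List ι} (hL : ∀ i ∈ L, i ∈ b.support) {l : List M}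
    (h : L.length ≤ l.length) :
    FGRing.aug F M (wordDemazure F P L (l.map (FGRing.x F)).prod) =
      leadingCoeff R b l (weylWord P L) := by
  induction l generalizing L with
  | nil =>
    have : L = [] := List.eq_nil_of_length_eq_zero (by simpa using h)
    subst this
    simp [leadingCoeff]
  | cons a l ih =>
    rw [List.length_cons] at h
    rw [List.map_cons, List.prod_cons, aug_wordDemazure_x_mul F P L a h (list_prod_x_mem F l),
      leadingCoeff, ← sum_deletions hL (fun j ↦ (P.coroot' j a : R)) (fun i ↦ ?_)]
    · congr 1
      refine List.map_congr_left fun p hp ↦ ?_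
      obtain ⟨h1, h2⟩ := of_mem_deletions hp
      rw [ih (fun i hi ↦ hL i (h2 i hi)) (by omega)]
    · rw [← Int.cast_neg]
      congr 1
      rw [← weylReflection_smul, ← LinearMap.neg_apply]
      simp [RootPairing.coroot', weylReflection_smul]

/-- For general F the composite depends on the word, but its leading term does not: on products of m
generators the value is `leadingCoeff`, a function of the Weyl group element alone. Coefficients in
front only contribute their augmentation. In particular, a composite along a nonreduced word of
length m may be replaced by a shorter one, which kills I^m. -/
lemma aug_wordDemazure_eq {L L' : List ι} (hL : ∀ i ∈ L, i ∈ b.support)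
    (hL' : ∀ i ∈ L', i ∈ b.support) (hw : weylWord P L = weylWord P L') {m : ℕ}
    (h : L.length ≤ m) (h' : L'.length ≤ m) {u : FGRing F M} (hu : u ∈ augIdeal F M ^ m) :
    FGRing.aug F M (wordDemazure F P L u) = FGRing.aug F M (wordDemazure F P L' u) := by
  rw [augIdeal_pow_eq_span] at hu
  induction hu using Submodule.span_induction with
  | mem u hu =>
    obtain ⟨l, rfl, rfl⟩ := hu
    rw [aug_wordDemazure_prod F hL h, aug_wordDemazure_prod F hL' h', hw]
  | zero => simp
  | add x y hx hy ihx ihy => rw [map_add, map_add, map_add, map_add, ihx, ihy]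
  | smul a x hx ih =>
    change x ∈ Ideal.span _ at hx
    rw [← augIdeal_pow_eq_span] at hx
    rw [smul_eq_mul, aug_wordDemazure_mul F P L h a hx, aug_wordDemazure_mul F P L' h' a hx, ih]

end LeadingTerms

end FormalGroupRing

end

noncomputable section

namespace FormalGroupRing

/-! ### Comparison with classical divided differences -/

section SymmetricAlgebra

open RootPairing

variable {R : Type*} [CommRing R] (F : FormalGroup R)
variable {ι M N : Type*} [AddCommGroup M] [AddCommGroup N]

lemma sub_mem_of_forall_basis {A σ : Type*} [CommRing A] (J : Ideal A) (f : M →ₗ[ℤ] A) {x : M → A}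
    (h0 : x 0 = 0) (hadd : ∀ a b, x (a + b) - (x a + x b) ∈ J) (e : Module.Basis σ ℤ M)
    (he : ∀ i, f (e i) - x (e i) ∈ J) (a : M) : f a - x a ∈ J := by
  let g : M →+ A ⧸ J :=
    { toFun := fun a ↦ Ideal.Quotient.mk J (x a)
      map_zero' := by rw [h0, map_zero]
      map_add' := fun a b ↦ by rw [← map_add, Ideal.Quotient.eq]; exact hadd a b }
  have h : (Ideal.Quotient.mk J).toAddMonoidHom.toIntLinearMap ∘ₗ f = g.toIntLinearMap :=
    e.ext fun i ↦ Ideal.Quotient.eq.mpr (he i)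
  exact Ideal.Quotient.eq.mp (LinearMap.congr_fun h a)

variable [Module.Finite ℤ M] [Module.Free ℤ M]

variable (M) in
/-- A ring homomorphism from the symmetric algebra to the formal group ring which sends
`a` to `x_a` up to terms of higher order. -/
def symLift : SymmetricAlgebra ℤ M →ₐ[ℤ] FGRing F M :=
  SymmetricAlgebra.lift ((Module.Free.chooseBasis ℤ M).constr ℤ
    fun i ↦ FGRing.x F (Module.Free.chooseBasis ℤ M i))

/-- The map a ↦ x_a is additive modulo I², so agreement on a basis suffices. -/
lemma symLift_ι_sub_mem (a : M) :
    symLift F M (SymmetricAlgebra.ι ℤ M a) - FGRing.x F a ∈ augIdeal F M ^ 2 := by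
  refine sub_mem_of_forall_basis (augIdeal F M ^ 2)
    ((symLift F M).toLinearMap ∘ₗ SymmetricAlgebra.ι ℤ M) (x := FGRing.x F) (FGRing.x_zero F)
    (fun a b ↦ ?_) (Module.Free.chooseBasis ℤ M) (fun i ↦ ?_) a
  · obtain ⟨G, hG⟩ := FGRing.exists_x_add F (M := M)
    rw [hG, add_sub_cancel_left, pow_two]
    exact Ideal.mul_mem_right _ _
      (Ideal.mul_mem_mul (FGRing.x_mem_augIdeal F a) (FGRing.x_mem_augIdeal F b))
  · simp [symLift]

variable [F.IsComm] (P : RootDatum ι M N)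

/-- The ring automorphism of the symmetric algebra induced by a reflection. -/
abbrev symReflection (i : ι) : SymmetricAlgebra ℤ M →ₐ[ℤ] SymmetricAlgebra ℤ M :=
  SymmetricAlgebra.lift (SymmetricAlgebra.ι ℤ M ∘ₗ (P.reflection i).toLinearMap)

omit [F.IsComm] in
lemma symLift_ι_mem (a : M) : symLift F M (SymmetricAlgebra.ι ℤ M a) ∈ augIdeal F M := by
  have h := add_mem (Ideal.pow_le_self two_ne_zero (symLift_ι_sub_mem F a))
    (FGRing.x_mem_augIdeal F a)
  rwa [sub_add_cancel] at h

omit [F.IsComm] in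
lemma symLift_mem {n : ℕ} {u : SymmetricAlgebra ℤ M}
    (hu : u ∈ LinearMap.range (SymmetricAlgebra.ι ℤ M) ^ n) : symLift F M u ∈ augIdeal F M ^ n := by
  induction n generalizing u with
  | zero => simp
  | succ n ih =>
    rw [pow_succ'] at hu ⊢
    induction hu using Submodule.mul_induction_on' with
    | mem_mul_mem g hg v hv =>
      obtain ⟨a, rfl⟩ := hg
      rw [map_mul]
      exact Ideal.mul_mem_mul (symLift_ι_mem F a) (ih hv)
    | add x _ y _ hx hy => rw [map_add]; exact add_mem hx hy

lemma rootDemazure_symLift_ι_sub_mem (i : ι) (a : M) :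
    rootDemazure F P i (symLift F M (SymmetricAlgebra.ι ℤ M a)) -
      algebraMap R _ (P.coroot' i a : R) ∈ augIdeal F M := by
  have h1 := rootDemazure_mem F P i (symLift_ι_sub_mem F a)
  rw [pow_one, RingHom.mem_ker, map_sub, map_sub, aug_rootDemazure_x] at h1
  rw [RingHom.mem_ker, map_sub, AlgHom.commutes]
  exact h1

omit [F.IsComm] in
lemma map_symLift_ι_sub_mem (i : ι) (a : M) :
    FGRing.map F (DistribSMul.toAddMonoidHom M (weylReflection P i))
        (symLift F M (SymmetricAlgebra.ι ℤ M a)) -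
      symLift F M (SymmetricAlgebra.ι ℤ M (P.reflection i a)) ∈ augIdeal F M ^ 2 := by
  have h1 := FGRing.map_mem_augIdeal_pow F
    (DistribSMul.toAddMonoidHom M (weylReflection P i)) (symLift_ι_sub_mem F a)
  have h2 := sub_mem h1 (symLift_ι_sub_mem F (P.reflection i a))
  rw [map_sub, FGRing.map_x] at h2
  convert h2 using 1
  rw [DistribSMul.toAddMonoidHom_apply, weylReflection_smul_vec]
  ring

/-- The classical quotient is built by the classical twisted Leibniz rule, in parallel with the one
for `rootDemazure`. The map `symLift` need not commute with reflections, but it does to first order,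
which is enough for leading terms. -/
lemma exists_ι_root_mul_eq (i : ι) {n : ℕ} {u : SymmetricAlgebra ℤ M}
    (hu : u ∈ LinearMap.range (SymmetricAlgebra.ι ℤ M) ^ (n + 1)) :
    ∃ v ∈ LinearMap.range (SymmetricAlgebra.ι ℤ M) ^ n,
      SymmetricAlgebra.ι ℤ M (P.root i) * v = u - symReflection P i u ∧
      rootDemazure F P i (symLift F M u) - symLift F M v ∈ augIdeal F M ^ (n + 1) := by
  have hι (a : M) : SymmetricAlgebra.ι ℤ M (P.reflection i a) = SymmetricAlgebra.ι ℤ M a -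
      algebraMap ℤ _ (P.coroot' i a) * SymmetricAlgebra.ι ℤ M (P.root i) := by
    rw [RootPairing.reflection_apply, map_sub, map_smul, Algebra.smul_def]
  induction n generalizing u with
  | zero =>
    rw [zero_add, pow_one] at hu
    obtain ⟨a, rfl⟩ := hu
    refine ⟨algebraMap ℤ _ (P.coroot' i a), ?_, ?_, ?_⟩
    · rw [pow_zero]
      exact Submodule.algebraMap_mem _
    · rw [SymmetricAlgebra.lift_ι_apply]
      simp only [LinearMap.comp_apply, LinearEquiv.coe_coe, hι]
      ring
    · rw [zero_add, pow_one]
      convert rootDemazure_symLift_ι_sub_mem F P i a using 2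
      simp
  | succ n ih =>
    rw [pow_succ'] at hu
    induction hu using Submodule.mul_induction_on' with
    | mem_mul_mem g hg u hu =>
      obtain ⟨a, rfl⟩ := hg
      obtain ⟨v, hv, hvu, hvd⟩ := ih hu
      refine ⟨algebraMap ℤ _ (P.coroot' i a) * u +
        SymmetricAlgebra.ι ℤ M (P.reflection i a) * v, ?_, ?_, ?_⟩
      · refine add_mem ?_ ?_
        · rw [← Algebra.smul_def]
          exact Submodule.smul_mem _ _ hu
        · rw [pow_succ']
          exact Submodule.mul_mem_mul ⟨_, rfl⟩ hv
      · rw [map_mul, SymmetricAlgebra.lift_ι_apply, LinearMap.comp_apply, LinearEquiv.coe_coe]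
        linear_combination SymmetricAlgebra.ι ℤ M (P.reflection i a) * hvu + u * hι a
      · rw [map_mul, rootDemazure_mul]
        have h1 := Ideal.mul_mem_mul (rootDemazure_symLift_ι_sub_mem F P i a) (symLift_mem F hu)
        have h2 := Ideal.mul_mem_mul (map_symLift_ι_sub_mem F P i a)
          (rootDemazure_mem F P i (symLift_mem F hu))
        have h3 := Ideal.mul_mem_mul (symLift_ι_mem F (P.reflection i a)) hvd
        rw [← pow_succ'] at h1 h3
        rw [← pow_add, Nat.add_sub_cancel, add_comm] at h2
        convert add_mem (add_mem h1 h2) h3 using 1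
        simp
        ring
    | add x _ y _ hx hy =>
      obtain ⟨v, hv, h1, h2⟩ := hx
      obtain ⟨v', hv', h1', h2'⟩ := hy
      refine ⟨v + v', add_mem hv hv', ?_, ?_⟩
      · rw [mul_add, h1, h1', map_add]
        ring
      · convert add_mem h2 h2' using 1
        simp only [map_add]
        ring

lemma IsDividedDifference.wordDemazure_sub_mem {L : List ι} {u v : SymmetricAlgebra ℤ M}
    (h : IsDividedDifference P L u v) {n : ℕ}
    (hu : u ∈ LinearMap.range (SymmetricAlgebra.ι ℤ M) ^ n) (hn : L.length ≤ n) :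
    v ∈ LinearMap.range (SymmetricAlgebra.ι ℤ M) ^ (n - L.length) ∧
      wordDemazure F P L (symLift F M u) - symLift F M v ∈ augIdeal F M ^ (n + 1 - L.length) := by
  induction h with
  | nil u => simpa using hu
  | cons i L u w v h hv ih =>
    rw [List.length_cons] at hn ⊢
    obtain ⟨h1, h2⟩ := ih hu (by omega)
    have h3 : n - L.length = n - (L.length + 1) + 1 := by omega
    rw [h3] at h1
    obtain ⟨v', hv', h4, h5⟩ := exists_ι_root_mul_eq F P i h1
    have h6 : SymmetricAlgebra.ι ℤ M (P.root i) ≠ 0 := by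
      intro h
      refine P.ne_zero i ((Module.Free.chooseBasis ℤ M).ext_elem fun j ↦ ?_)
      have h' := congrArg (SymmetricAlgebra.lift ((Module.Free.chooseBasis ℤ M).coord j)) h
      rw [SymmetricAlgebra.lift_ι_apply, map_zero] at h'
      rw [map_zero]
      exact h'
    -- The symmetric algebra of a lattice is a domain, so the prescribed quotient by the root is the
    -- one constructed.
    obtain rfl : v = v' := mul_left_cancel₀ h6 (hv.trans h4.symm)
    refine ⟨hv', ?_⟩
    have h7 := rootDemazure_mem F P i h2
    have h8 : n + 1 - L.length - 1 = n + 1 - (L.length + 1) := by omega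
    have h9 : n - (L.length + 1) + 1 = n + 1 - (L.length + 1) := by omega
    rw [h8, map_sub] at h7
    rw [h9] at h5
    rw [wordDemazure_cons, Module.End.mul_apply]
    convert add_mem h7 h5 using 1
    ring

lemma IsDividedDifference.aug_wordDemazure {L : List ι} {u : SymmetricAlgebra ℤ M} {t : ℕ}
    (h : IsDividedDifference P L u (algebraMap ℤ _ t))
    (hu : u ∈ LinearMap.range (SymmetricAlgebra.ι ℤ M) ^ L.length) :
    FGRing.aug F M (wordDemazure F P L (symLift F M u)) = t := by
  obtain ⟨-, h1⟩ := h.wordDemazure_sub_mem F P hu le_rfl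
  rw [Nat.add_sub_cancel_left, pow_one, RingHom.mem_ker, map_sub, sub_eq_zero] at h1
  rw [h1]
  simp

end SymmetricAlgebra

end FormalGroupRing

end

noncomputable section

namespace FormalGroupRing

/-! ### A matrix whose determinant is a power of the torsion index -/

section TorsionMatrix

open RootPairing

lemma det_mem_powers {n A : Type*} [Fintype n] [DecidableEq n] [CommRing A] (B : Matrix n n A)
    (l : n → ℕ) (t : A) (h0 : ∀ i j, l i < l j → B i j = 0)
    (h1 : ∀ i j, l i = l j → i ≠ j → B i j = 0) (h2 : ∀ i, B i i = t) :
    B.det ∈ Submonoid.powers t := by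
  have h : B.BlockTriangular (fun i ↦ OrderDual.toDual (l i)) := fun i j hij ↦ h0 i j hij
  rw [h.det]
  refine Submonoid.prod_mem _ fun a _ ↦ ?_
  have h3 : B.toSquareBlock (fun i ↦ OrderDual.toDual (l i)) a = Matrix.diagonal fun _ ↦ t := by
    ext i j
    rw [Matrix.toSquareBlock_def, Matrix.of_apply, Matrix.diagonal_apply]
    split_ifs with hij
    · rw [hij, h2]
    · exact h1 _ _ (OrderDual.toDual.injective (i.2.trans j.2.symm)) fun h ↦ hij (Subtype.ext h)
  rw [h3, Matrix.det_diagonal, Finset.prod_const]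
  exact ⟨_, rfl⟩

variable {R : Type*} [CommRing R] (F : FormalGroup R) [F.IsComm]
variable {ι M N : Type*} [AddCommGroup M] [Module.Finite ℤ M] [Module.Free ℤ M] [AddCommGroup N]
variable {P : RootDatum ι M N} [Fintype ι] [P.IsReduced] {b : P.Base}

lemma exists_matrix_det_mem_powers [Fintype P.weylGroup] [DecidableEq P.weylGroup]
    (ht : torsionIndex b ≠ 0) :
    ∃ (I : P.weylGroup → List ι) (e : P.weylGroup → FGRing F M),
      (Matrix.of fun v w ↦ FGRing.aug F M (wordDemazure F P (I v) (e w))).det ∈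
        Submonoid.powers (torsionIndex b : R) := by
  -- A nonzero infimum means that the defining set is nonempty; this supplies the longest word and
  -- the element a.
  obtain ⟨-, L₀, hL₀, a, ha, hat⟩ := Nat.sInf_mem (Nat.nonempty_of_pos_sInf ht.bot_lt)
  rw [← torsionIndex] at hat
  choose I hI hIw hIl using exists_word_card b
  set w₀ := weylWord P L₀
  set u := symLift F M a
  have hu : u ∈ augIdeal F M ^ L₀.length := symLift_mem F ha
  have hlen (w : P.weylGroup) :
      (inversions b (w⁻¹ * w₀)).card + (inversions b w).card = L₀.length :=
    card_inversions_inv_mul_longest hL₀ w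
  refine ⟨I, fun w ↦ wordDemazure F P (I (w⁻¹ * w₀)) u,
    det_mem_powers _ (fun w ↦ (inversions b w).card) _ ?_ ?_ ?_⟩
  all_goals
    simp only [Matrix.of_apply, ← Module.End.mul_apply, ← wordDemazure_append]
  · intro v w h
    refine aug_wordDemazure_of_lt F P _ hu ?_
    rw [List.length_append, hIl, hIl]
    have := hlen w
    omega
  · intro v w h hvw
    -- For v ≠ w the product v w⁻¹ w₀ is not the longest element, so it has a word with fewer than N
    -- letters, whose composite augments to zero on I^N.
    have hcard : (inversions b (v * (w⁻¹ * w₀))).card < L₀.length := by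
      refine lt_of_le_of_ne (card_inversions_le hL₀ _) fun h' ↦ hvw ?_
      have := eq_longest_of_card hL₀ h'
      rwa [← mul_assoc, mul_eq_right, mul_inv_eq_one] at this
    rw [aug_wordDemazure_eq F (L' := I (v * (w⁻¹ * w₀))) (m := L₀.length) _ (hI _) _ _ _ hu]
    · exact aug_wordDemazure_of_lt F P _ hu (by rwa [hIl])
    · intro i hi
      rcases List.mem_append.mp hi with hi | hi
      exacts [hI _ i hi, hI _ i hi]
    · rw [weylWord_append, hIw, hIw, hIw]
    · rw [List.length_append, hIl, hIl]
      have := hlen w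
      omega
    · rw [hIl]
      exact hcard.le
  · intro w
    rw [← hat.aug_wordDemazure F P ha]
    refine aug_wordDemazure_eq F (b := b) ?_ hL₀.1.1 ?_ ?_ le_rfl hu
    · intro i hi
      rcases List.mem_append.mp hi with hi | hi
      exacts [hI _ i hi, hI _ i hi]
    · rw [weylWord_append, hIw, hIw, mul_inv_cancel_left]
    · rw [List.length_append, hIl, hIl]
      have := hlen w
      omega

end TorsionMatrix

end FormalGroupRing

end

noncomputable section

namespace FormalGroupRing

/-! ### Combinations of automorphisms with regular denominators -/

section TwistedSpan

open scoped nonZeroDivisors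

variable {A G : Type*} [CommRing A] [Group G] (ρ : G →* (A →+* A))

/-- The `A`-module of functions `A → A` spanned by the endomorphisms of a group action. -/
def twistedSpan : Submodule A (A → A) := Submodule.span A (Set.range fun g ↦ (ρ g : A → A))

variable {ρ}

lemma coe_mem_twistedSpan (g : G) : (ρ g : A → A) ∈ twistedSpan ρ :=
  Submodule.subset_span ⟨g, rfl⟩

lemma id_mem_twistedSpan : (id : A → A) ∈ twistedSpan ρ := by
  simpa using coe_mem_twistedSpan (ρ := ρ) 1

lemma comp_mem_twistedSpan (g : G) {f : A → A} (hf : f ∈ twistedSpan ρ) :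
    ρ g ∘ f ∈ twistedSpan ρ := by
  induction hf using Submodule.span_induction with
  | mem f hf =>
    obtain ⟨h, rfl⟩ := hf
    refine Submodule.subset_span ⟨g * h, ?_⟩
    simp only [map_mul]
    rfl
  | zero =>
    convert Submodule.zero_mem _ using 1
    ext u
    simp
  | add f f' _ _ h h' =>
    convert add_mem h h' using 1
    ext u
    simp
  | smul a f _ h =>
    convert Submodule.smul_mem _ (ρ g a) h using 1
    ext u
    simp

lemma map_mem_nonZeroDivisors_of_action (g : G) {a : A} (ha : a ∈ A⁰) : ρ g a ∈ A⁰ := by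
  have h (g : G) (v : A) : ρ g (ρ g⁻¹ v) = v := by
    change (ρ g * ρ g⁻¹) v = v
    rw [← map_mul, mul_inv_cancel, map_one]
    rfl
  refine mem_nonZeroDivisors_iff_right.mpr fun v hv ↦ ?_
  have h1 := congrArg (ρ g⁻¹) hv
  have h2 := h g⁻¹ a
  rw [inv_inv] at h2
  rw [map_mul, h2, map_zero] at h1
  rw [← h g v, mem_nonZeroDivisors_iff_right.mp ha _ h1, map_zero]

variable (ρ) in
/-- A function `A → A` which is a combination of the endomorphisms of a group action, with
coefficients in the total ring of fractions. -/
def IsTwisted (f : A → A) : Prop := ∃ a ∈ A⁰, a • f ∈ twistedSpan ρ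

lemma isTwisted_id : IsTwisted ρ id := ⟨1, one_mem _, by simpa using id_mem_twistedSpan⟩

lemma IsTwisted.add {f f' : A → A} (h : IsTwisted ρ f) (h' : IsTwisted ρ f') :
    IsTwisted ρ (f + f') := by
  obtain ⟨a, ha, haf⟩ := h
  obtain ⟨a', ha', haf'⟩ := h'
  refine ⟨a * a', mul_mem ha ha', ?_⟩
  rw [smul_add, mul_smul a a' f', mul_comm a a', mul_smul]
  exact add_mem (Submodule.smul_mem _ _ haf) (Submodule.smul_mem _ _ haf')

lemma IsTwisted.smul {f : A → A} (h : IsTwisted ρ f) (c : A) : IsTwisted ρ (c • f) := by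
  obtain ⟨a, ha, haf⟩ := h
  exact ⟨a, ha, by rw [smul_comm]; exact Submodule.smul_mem _ _ haf⟩

lemma IsTwisted.sum {κ : Type*} (s : Finset κ) {f : κ → A → A} (h : ∀ i, IsTwisted ρ (f i)) :
    IsTwisted ρ (∑ i ∈ s, f i) := by
  classical
  induction s using Finset.induction_on with
  | empty => exact ⟨1, one_mem _, by simp⟩
  | insert i s hi ih => rw [Finset.sum_insert hi]; exact (h i).add ih

/-- Moving a denominator a' to the left of g turns it into g(a'), which is regular because g acts
invertibly. -/
lemma IsTwisted.comp {f f' : A → A} (h : IsTwisted ρ f) (h' : IsTwisted ρ f') :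
    IsTwisted ρ (f ∘ f') := by
  obtain ⟨a, ha, haf⟩ := h
  have key : ∀ k ∈ twistedSpan ρ, IsTwisted ρ (k ∘ f') := by
    intro k hk
    induction hk using Submodule.span_induction with
    | mem k hk =>
      obtain ⟨g, rfl⟩ := hk
      obtain ⟨a', ha', haf'⟩ := h'
      refine ⟨ρ g a', map_mem_nonZeroDivisors_of_action g ha', ?_⟩
      convert comp_mem_twistedSpan g haf' using 1
      ext u
      simp
    | zero => exact ⟨1, one_mem _, by rw [one_smul]; exact Submodule.zero_mem _⟩
    | add k k' _ _ h h' => exact h.add h'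
    | smul c k _ h => exact h.smul c
  obtain ⟨a', ha', h1⟩ := key _ haf
  exact ⟨a' * a, mul_mem ha' ha, by rw [mul_smul]; exact h1⟩

variable [Fintype G]

lemma IsTwisted.exists_sum_eq {f : A → A} (h : IsTwisted ρ f) :
    ∃ a ∈ A⁰, ∃ c : G → A, ∀ u, a * f u = ∑ g, c g * ρ g u := by
  obtain ⟨a, ha, haf⟩ := h
  obtain ⟨c, hc⟩ := (Submodule.mem_span_range_iff_exists_fun A).mp haf
  refine ⟨a, ha, c, fun u ↦ ?_⟩
  have := congrFun hc u
  simpa using this.symm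

variable [DecidableEq G]

lemma IsTwisted.eq_zero {f : A → A} (h : IsTwisted ρ f) {D : G → A → A}
    (hD : ∀ v, IsTwisted ρ (D v)) {e : G → A}
    (hdet : (Matrix.of fun v w ↦ D v (e w)).det ∈ A⁰) (hf : ∀ w, f (e w) = 0) (u : A) :
    f u = 0 := by
  choose X hX C hC using fun v ↦ (hD v).exists_sum_eq
  obtain ⟨a, ha, c, hc⟩ := h.exists_sum_eq
  set E : Matrix G G A := Matrix.of fun g w ↦ ρ g (e w)
  -- After clearing denominators the matrix of values factors through E = (g(e_w)). Regularity of
  -- its determinant thus passes to det E, and a row c with cE = 0 must vanish.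
  have h1 : Matrix.diagonal X * Matrix.of (fun v w ↦ D v (e w)) = Matrix.of C * E := by
    ext v w
    rw [Matrix.diagonal_mul, Matrix.mul_apply]
    exact hC v (e w)
  have h2 : E.det ∈ A⁰ := by
    have h3 := congrArg Matrix.det h1
    rw [Matrix.det_mul, Matrix.det_mul, Matrix.det_diagonal] at h3
    have h4 := mul_mem (prod_mem fun v (_ : v ∈ Finset.univ) ↦ hX v) hdet
    rw [h3] at h4
    exact (mul_mem_nonZeroDivisors.mp h4).2
  have h3 : Matrix.vecMul c E = 0 := by
    ext w
    have := hc (e w)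
    rw [hf, mul_zero] at this
    exact this.symm
  have h4 : c = 0 := by
    have h5 := congrArg (fun r ↦ Matrix.vecMul r E.adjugate) h3
    simp only [Matrix.vecMul_vecMul, Matrix.mul_adjugate, Matrix.vecMul_smul, Matrix.vecMul_one,
      Matrix.zero_vecMul] at h5
    ext g
    refine mem_nonZeroDivisors_iff.mp h2 |>.1 _ ?_
    exact congrFun h5 g
  have h5 := hc u
  simp only [h4, Pi.zero_apply, zero_mul, Finset.sum_const_zero] at h5
  exact mem_nonZeroDivisors_iff.mp ha |>.1 _ h5

/-- Cramer's rule chooses d so that the two sides agree at every e_w. Their difference is twisted,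
hence zero. -/
lemma IsTwisted.exists_det_mul_eq {f : A → A} (h : IsTwisted ρ f) {D : G → A → A}
    (hD : ∀ v, IsTwisted ρ (D v)) {e : G → A}
    (hdet : (Matrix.of fun v w ↦ D v (e w)).det ∈ A⁰) :
    ∃ d : G → A, ∀ u, (Matrix.of fun v w ↦ D v (e w)).det * f u = ∑ v, d v * D v u := by
  set B : Matrix G G A := Matrix.of fun v w ↦ D v (e w) with hB
  set d : G → A := Matrix.vecMul (fun w ↦ f (e w)) B.adjugate
  refine ⟨d, fun u ↦ ?_⟩
  have h1 : IsTwisted ρ (B.det • f + (-1 : A) • ∑ v, d v • D v) :=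
    (h.smul _).add ((IsTwisted.sum _ fun v ↦ (hD v).smul _).smul _)
  have h2 := h1.eq_zero hD hdet (fun w ↦ ?_) u
  · simpa [add_neg_eq_zero] using h2
  · have h3 : Matrix.vecMul d B = B.det • fun w ↦ f (e w) := by
      rw [Matrix.vecMul_vecMul, Matrix.adjugate_mul, Matrix.vecMul_smul, Matrix.vecMul_one]
    have h4 := congrFun h3 w
    simp only [Matrix.vecMul, dotProduct, Pi.smul_apply, smul_eq_mul] at h4
    simp only [Pi.add_apply, Pi.smul_apply, Finset.sum_apply, smul_eq_mul]
    rw [← h4]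
    simp [hB]

end TwistedSpan

end FormalGroupRing

end

noncomputable section

namespace FormalGroupRing

/-! ### Descent of twisted functions along a surjection -/

section TwistedLift

open scoped nonZeroDivisors

variable {R A B G : Type*} [CommRing R] [CommRing A] [CommRing B] [Algebra R A] [Algebra R B]
variable [Group G] (ρ : G →* (A →+* A)) (π : A →ₐ[R] B)

/-- An endomorphism of `B` which lifts along `π : A → B` to a twisted function on `A`. -/
def HasTwistedLift (D : Module.End R B) : Prop :=
  ∃ f : A → A, IsTwisted ρ f ∧ ∀ u, π (f u) = D (π u)

variable {ρ π}

lemma HasTwistedLift.add {D D' : Module.End R B} (h : HasTwistedLift ρ π D)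
    (h' : HasTwistedLift ρ π D') : HasTwistedLift ρ π (D + D') := by
  obtain ⟨f, hf, hfD⟩ := h
  obtain ⟨f', hf', hfD'⟩ := h'
  refine ⟨f + f', hf.add hf', fun u ↦ ?_⟩
  rw [Pi.add_apply, map_add, hfD, hfD', LinearMap.add_apply]

lemma HasTwistedLift.mul {D D' : Module.End R B} (h : HasTwistedLift ρ π D)
    (h' : HasTwistedLift ρ π D') : HasTwistedLift ρ π (D * D') := by
  obtain ⟨f, hf, hfD⟩ := h
  obtain ⟨f', hf', hfD'⟩ := h'
  refine ⟨f ∘ f', hf.comp hf', fun u ↦ ?_⟩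
  rw [Function.comp_apply, hfD, hfD', Module.End.mul_apply]

lemma hasTwistedLift_mulLeft (hπ : Function.Surjective π) (b : B) :
    HasTwistedLift ρ π (LinearMap.mulLeft R b) := by
  obtain ⟨a, rfl⟩ := hπ b
  refine ⟨a • id, isTwisted_id.smul _, fun u ↦ ?_⟩
  rw [Pi.smul_apply, smul_eq_mul, map_mul, LinearMap.mulLeft_apply, id]

lemma hasTwistedLift_algebraMap (hπ : Function.Surjective π) (r : R) :
    HasTwistedLift ρ π (algebraMap R (Module.End R B) r) := by
  have h : algebraMap R (Module.End R B) r = LinearMap.mulLeft R (algebraMap R B r) :=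
    LinearMap.ext fun u ↦ Algebra.smul_def r u
  rw [h]
  exact hasTwistedLift_mulLeft hπ _

lemma hasTwistedLift_of_mul_eq {D : Module.End R B} {f : A → A} (hf : ∀ u, π (f u) = D (π u)) {a : A}
    (ha : a ∈ A⁰) (g : G) (h : ∀ u, a * f u = u - ρ g u) : HasTwistedLift ρ π D := by
  refine ⟨f, ⟨a, ha, ?_⟩, hf⟩
  convert sub_mem (id_mem_twistedSpan (ρ := ρ)) (coe_mem_twistedSpan (ρ := ρ) g) using 1
  exact funext h

/-- Downstairs the operators need not be determined by their values at the e_w. The relation is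
therefore found upstairs, where the lifted determinant is regular because its augmentation is, and
then projected and augmented. -/
lemma HasTwistedLift.exists_det_mul_eq [Fintype G] [DecidableEq G] (hπ : Function.Surjective π)
    {ε : B →ₐ[R] R} (hε : ∀ a, ε (π a) ∈ R⁰ → a ∈ A⁰)
    {D : G → Module.End R B} (hD : ∀ v, HasTwistedLift ρ π (D v))
    {e : G → B} (hdet : (Matrix.of fun v w ↦ ε (D v (e w))).det ∈ R⁰)
    {D' : Module.End R B} (hD' : HasTwistedLift ρ π D') :
    ∃ d : G → R, ∀ u, (Matrix.of fun v w ↦ ε (D v (e w))).det * ε (D' u) =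
      ∑ v, d v * ε (D v u) := by
  choose f hf hfD using hD
  obtain ⟨f', hf', hfD'⟩ := hD'
  choose e' he' using fun w ↦ hπ (e w)
  have h1 : ε (π (Matrix.of fun v w ↦ f v (e' w)).det) =
      (Matrix.of fun v w ↦ ε (D v (e w))).det := by
    rw [AlgHom.map_det, AlgHom.map_det]
    congr 1
    ext v w
    simp [hfD, he']
  obtain ⟨d, hd⟩ := hf'.exists_det_mul_eq hf (hε _ (by rw [h1]; exact hdet))
  refine ⟨fun v ↦ ε (π (d v)), fun u ↦ ?_⟩
  obtain ⟨u, rfl⟩ := hπ u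
  have h2 := congrArg (ε ∘ π) (hd u)
  simp only [Function.comp_apply, map_mul, h1, hfD', map_sum, hfD] at h2
  exact h2

end TwistedLift

/-! ### The lattice M ⊕ Q, where root elements are regular -/

section ExtendedLattice

open RootPairing
open scoped nonZeroDivisors

variable {ι M N : Type*} [AddCommGroup M] [AddCommGroup N] (P : RootDatum ι M N)

/-- The lattice `M ⊕ Q`, where `Q` is the root lattice. -/
abbrev ExtLattice : Type _ := M × P.rootSpan ℤ

/-- The homomorphism `M ⊕ Q → M`, `(a, q) ↦ a + q`. -/
def extProj : ExtLattice P →+ M :=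
  (AddMonoidHom.id M).coprod (P.rootSpan ℤ).subtype.toAddMonoidHom

@[simp] lemma extProj_apply (x : ExtLattice P) : extProj P x = x.1 + x.2 := rfl

lemma extProj_comp_inl : (extProj P).comp (AddMonoidHom.inl M _) = AddMonoidHom.id M := by
  ext a
  simp

variable {P} in
lemma weyl_smul_sub_mem (w : P.weylGroup) (a : M) : w • a - a ∈ P.rootSpan ℤ := by
  induction w using weyl_induction generalizing a with
  | h i =>
    rw [weylReflection_smul_vec, RootPairing.reflection_apply, sub_sub_cancel_left]
    exact neg_mem (Submodule.smul_mem _ _ (Submodule.subset_span ⟨i, rfl⟩))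
  | h1 => simp
  | hmul v w hv hw =>
    rw [mul_smul, ← sub_add_sub_cancel _ (w • a)]
    exact add_mem (hv _) (hw _)

lemma weyl_smul_add_sub_mem (w : P.weylGroup) (x : ExtLattice P) :
    w • (x.1 + (x.2 : M)) - x.1 ∈ P.rootSpan ℤ := by
  rw [← sub_add_sub_cancel _ (x.1 + (x.2 : M)), add_sub_cancel_left]
  exact add_mem (weyl_smul_sub_mem _ _) x.2.2

/-- The action of the Weyl group on `M ⊕ Q` which is trivial on `(M ⊕ Q) / Q` and for which
`(a, q) ↦ a + q` is equivariant. -/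
def extAct (w : P.weylGroup) : ExtLattice P →+ ExtLattice P where
  toFun x := (x.1, ⟨w • (x.1 + (x.2 : M)) - x.1, weyl_smul_add_sub_mem P w x⟩)
  map_zero' := by ext <;> simp
  map_add' x y := by
    ext
    · simp
    · simp only [Prod.fst_add, Prod.snd_add, Submodule.coe_add, smul_add]
      abel

lemma extAct_one : extAct P 1 = AddMonoidHom.id _ := by
  ext x <;> simp [extAct]

lemma extAct_mul (v w : P.weylGroup) : extAct P (v * w) = (extAct P v).comp (extAct P w) := by
  refine AddMonoidHom.ext fun x ↦ Prod.ext rfl (Subtype.ext ?_)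
  change (v * w) • (x.1 + (x.2 : M)) - x.1 =
    v • (x.1 + (w • (x.1 + (x.2 : M)) - x.1)) - x.1
  rw [mul_smul, add_sub_cancel]

/-- The root `α_i` in the second summand of `M ⊕ Q`. -/
def extRoot (i : ι) : ExtLattice P := (0, P.rootSpanMem ℤ i)

@[simp] lemma extProj_extRoot (i : ι) : extProj P (extRoot P i) = P.root i := by
  simp [extRoot]

lemma extAct_extRoot (w : P.weylGroup) (i : ι) : extAct P w (extRoot P i) = extRoot P (w • i) := by
  refine Prod.ext rfl (Subtype.ext ?_)
  simp [extAct, extRoot, root_weyl_smul]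

/-- The reflections lifted to M ⊕ Q come from an action of W itself, so no more than |W|
automorphisms occur upstairs, matching the size of the matrix. -/
lemma reflectBy_extRoot (i : ι) :
    reflectBy (extRoot P i) ((P.coroot' i).toAddMonoidHom.comp (extProj P)) =
      extAct P (weylReflection P i) := by
  refine AddMonoidHom.ext fun x ↦ ?_
  rw [reflectBy_apply]
  refine Prod.ext ?_ (Subtype.ext ?_)
  · simp [extAct, extRoot]
  · simp only [extRoot, extAct, AddMonoidHom.coe_mk, ZeroHom.coe_mk, weylReflection_smul_vec,
      RootPairing.reflection_apply, Prod.snd_sub, Prod.smul_snd, Submodule.coe_sub,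
      Submodule.coe_smul]
    simp only [extProj_apply, AddMonoidHom.comp_apply, LinearMap.toAddMonoidHom_coe]
    abel

instance [Finite ι] : Module.Finite ℤ (P.rootSpan ℤ) :=
  Module.Finite.span_of_finite ℤ (Set.finite_range _)

instance [Module.Finite ℤ M] [Module.Free ℤ M] : Module.Free ℤ (P.rootSpan ℤ) := by
  infer_instance

section LatticeAction

variable {R : Type*} [CommRing R] (F : FormalGroup R)
variable {L G : Type*} [AddCommGroup L] [Group G]

section RingAct

variable {act : G → L →+ L} (h1 : act 1 = AddMonoidHom.id L)
  (hmul : ∀ v w, act (v * w) = (act v).comp (act w))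

/-- The action on the formal group ring which is induced by a group action on the lattice. -/
def ringAct : G →* (FGRing F L →+* FGRing F L) where
  toFun w := (FGRing.map F (act w)).toRingHom
  map_one' := by
    refine RingHom.ext fun u ↦ ?_
    rw [h1]
    exact FGRing.map_id F u
  map_mul' v w := by
    refine RingHom.ext fun u ↦ ?_
    rw [hmul]
    exact (FGRing.map_map F (act w) (act v) u).symm

lemma ringAct_apply (w : G) (u : FGRing F L) :
    ringAct F h1 hmul w u = FGRing.map F (act w) u := rfl

end RingAct

variable {F} {P} [Module.Finite ℤ M] [Module.Free ℤ M] [Module.Finite ℤ L] [Module.Free ℤ L] [F.IsComm]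
variable {ρ : G →* (FGRing F L →+* FGRing F L)} {p : L →+ M}

lemma hasTwistedLift_rootDemazure {i : ι} {α : L} (hα : p α = P.root i)
    (hreg : FGRing.x F α ∈ (FGRing F L)⁰) (g : G)
    (hg : ∀ u, ρ g u = FGRing.map F (reflectBy α ((P.coroot' i).toAddMonoidHom.comp p)) u) :
    HasTwistedLift ρ (FGRing.map F p) (rootDemazure F P i) :=
  hasTwistedLift_of_mul_eq (f := demazure F α ((P.coroot' i).toAddMonoidHom.comp p))
    (fun u ↦ map_demazure F p hα rfl u) hreg g fun u ↦ by rw [hg, x_mul_demazure]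

omit [Module.Finite ℤ L] [Module.Free ℤ L] in
lemma hasTwistedLift_of_mem (hp : Function.Surjective (FGRing.map F p))
    (hroot : ∀ i, HasTwistedLift ρ (FGRing.map F p) (rootDemazure F P i))
    {D : Module.End R (FGRing F M)} (hD : D ∈ operatorAlgebra P F) :
    HasTwistedLift ρ (FGRing.map F p) D := by
  induction hD using Algebra.adjoin_induction with
  | mem D hD =>
    rcases hD with ⟨i, hi⟩ | ⟨a, rfl⟩
    · rw [(isDemazureOperator_iff F P).mp hi]
      exact hroot i
    · exact hasTwistedLift_mulLeft hp a
  | algebraMap r => exact hasTwistedLift_algebraMap hp r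
  | add D D' _ _ h h' => exact h.add h'
  | mul D D' _ _ h h' => exact h.mul h'

end LatticeAction

variable {P} {R : Type*} [CommRing R] (F : FormalGroup R)
variable [Module.Finite ℤ M] [Module.Free ℤ M] [F.IsComm] [Fintype ι] [P.IsReduced] (b : P.Base)

-- Simple roots form a basis of Q, so for them the element is a coordinate and hence regular. The
-- action of W by ring automorphisms reaches all other roots.
include b in
lemma x_extRoot_mem_nonZeroDivisors (i : ι) :
    FGRing.x F (extRoot P i) ∈ (FGRing F (ExtLattice P))⁰ := by
  have h (w : P.weylGroup) (i : ι) (hi : FGRing.x F (extRoot P i) ∈ (FGRing F (ExtLattice P))⁰) :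
      FGRing.x F (extRoot P (w • i)) ∈ (FGRing F (ExtLattice P))⁰ := by
    rw [← extAct_extRoot, ← FGRing.map_x, ← ringAct_apply F (extAct_one P) (extAct_mul P)]
    exact map_mem_nonZeroDivisors_of_action w hi
  induction i using b.induction_reflect with
  | h₀ i hi => exact h (weylReflection P i) i hi
  | h₁ i hi =>
    have := FGRing.x_basis_mem_nonZeroDivisors (F := F)
      ((Module.Free.chooseBasis ℤ M).prod b.toWeightBasisInt) (Sum.inr ⟨i, hi⟩)
    rw [Module.Basis.prod_apply] at this
    convert this using 2
    refine Prod.ext ?_ (Subtype.ext ?_) <;> simp [extRoot]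
  | h₂ i j hi hj => exact h (weylReflection P j) i hi

include b in
lemma exists_det_mul_aug_eq [Fintype P.weylGroup] [DecidableEq P.weylGroup]
    {D : P.weylGroup → Module.End R (FGRing F M)} (hD : ∀ v, D v ∈ operatorAlgebra P F)
    {e : P.weylGroup → FGRing F M}
    (hdet : (Matrix.of fun v w ↦ FGRing.aug F M (D v (e w))).det ∈ R⁰)
    {D' : Module.End R (FGRing F M)} (hD' : D' ∈ operatorAlgebra P F) :
    ∃ d : P.weylGroup → R, ∀ u, (Matrix.of fun v w ↦ FGRing.aug F M (D v (e w))).det *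
      FGRing.aug F M (D' u) = ∑ v, d v * FGRing.aug F M (D v u) := by
  have hp : Function.Surjective (FGRing.map F (extProj P)) := fun u ↦
    ⟨FGRing.map F (AddMonoidHom.inl M _) u, by rw [FGRing.map_map, extProj_comp_inl, FGRing.map_id]⟩
  have h {D : Module.End R (FGRing F M)} (hD : D ∈ operatorAlgebra P F) :
      HasTwistedLift (ringAct F (extAct_one P) (extAct_mul P)) (FGRing.map F (extProj P)) D :=
    hasTwistedLift_of_mem hp (fun i ↦
      hasTwistedLift_rootDemazure (extProj_extRoot P i) (x_extRoot_mem_nonZeroDivisors F b i)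
        (weylReflection P i) fun u ↦ by rw [reflectBy_extRoot, ringAct_apply]) hD
  exact HasTwistedLift.exists_det_mul_eq hp
    (fun a ha ↦ FGRing.mem_nonZeroDivisors_of_aug (by rwa [FGRing.aug_map] at ha))
    (fun v ↦ h (hD v)) hdet (h hD')

end ExtendedLattice

end FormalGroupRing

end

noncomputable section

namespace FormalGroupRing

/-! ### Leibniz rules for algebras of operators -/

section Leibniz

variable {R B : Type*} [CommRing R] [CommRing B] [Algebra R B]

/-- The functions of two variables which are spanned by the products of operators. -/
def productSpan (𝒟 : Subalgebra R (Module.End R B)) : Submodule R (B → B → B) :=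
  Submodule.span R {T | ∃ D ∈ 𝒟, ∃ D' ∈ 𝒟, T = fun u v ↦ D u * D' v}

variable {𝒟 : Subalgebra R (Module.End R B)}

lemma mul_mem_productSpan {D D' : Module.End R B} (hD : D ∈ 𝒟) (hD' : D' ∈ 𝒟) :
    (fun u v ↦ D u * D' v) ∈ productSpan 𝒟 :=
  Submodule.subset_span ⟨D, hD, D', hD', rfl⟩

lemma precomp_mem_productSpan {D D' : Module.End R B} (hD : D ∈ 𝒟) (hD' : D' ∈ 𝒟)
    {T : B → B → B} (hT : T ∈ productSpan 𝒟) : (fun u v ↦ T (D u) (D' v)) ∈ productSpan 𝒟 := by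
  induction hT using Submodule.span_induction with
  | mem T hT =>
    obtain ⟨E, hE, E', hE', rfl⟩ := hT
    exact mul_mem_productSpan (mul_mem hE hD) (mul_mem hE' hD')
  | zero => exact Submodule.zero_mem _
  | add T T' _ _ h h' => exact add_mem h h'
  | smul r T _ h => exact Submodule.smul_mem _ r h

lemma postcomp_mem_productSpan {D : Module.End R B} (hD : (fun u v ↦ D (u * v)) ∈ productSpan 𝒟)
    {T : B → B → B} (hT : T ∈ productSpan 𝒟) : (fun u v ↦ D (T u v)) ∈ productSpan 𝒟 := by
  induction hT using Submodule.span_induction with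
  | mem T hT =>
    obtain ⟨E, hE, E', hE', rfl⟩ := hT
    exact precomp_mem_productSpan hE hE' hD
  | zero =>
    simp only [Pi.zero_apply, map_zero]
    exact Submodule.zero_mem _
  | add T T' _ _ h h' =>
    simp only [Pi.add_apply, map_add]
    exact add_mem h h'
  | smul r T _ h =>
    simp only [Pi.smul_apply, map_smul]
    exact Submodule.smul_mem _ r h

lemma mem_productSpan_of_mem_adjoin {s : Set (Module.End R B)}
    (hs : ∀ D ∈ s, (fun u v ↦ D (u * v)) ∈ productSpan (Algebra.adjoin R s)) {D : Module.End R B}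
    (hD : D ∈ Algebra.adjoin R s) :
    (fun u v ↦ D (u * v)) ∈ productSpan (Algebra.adjoin R s) := by
  induction hD using Algebra.adjoin_induction with
  | mem D hD => exact hs D hD
  | algebraMap r =>
    convert mul_mem_productSpan (𝒟 := Algebra.adjoin R s) (Subalgebra.algebraMap_mem _ r)
      (one_mem _) using 3
    simp
  | add D D' _ _ h h' => exact add_mem h h'
  | mul D D' _ _ h h' => exact postcomp_mem_productSpan h h'

end Leibniz

/-! ### The ring structure on the dual -/

section DualRing

open scoped nonZeroDivisors

variable {R B : Type*} [CommRing R] [CommRing B] [Algebra R B] (X : Submodule R (Module.Dual R B))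

/-- The evaluation map from a module to the dual of a module of linear forms. -/
def evalMap : B →ₗ[R] Module.Dual R X := X.subtype.dualMap ∘ₗ Module.Dual.eval R B

/-- A module of linear forms on an algebra satisfies a Leibniz rule if its elements take on products
of elements of the algebra values that are combinations of products of values of linear forms. -/
def IsLeibniz : Prop := ∀ E ∈ X, (fun u v ↦ E (u * v)) ∈
  Submodule.span R {T : B → B → R | ∃ E ∈ X, ∃ E' ∈ X, T = fun u v ↦ E u * E' v}

variable {X}

lemma evalMap_apply (u : B) (E : X) : evalMap X u E = (E : Module.Dual R B) u := rfl

lemma nsmul_cancel {q : ℕ} (hq : (q : R) ∈ R⁰) {h k : Module.Dual R X} (hk : q • h = q • k) :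
    h = k := by
  refine LinearMap.ext fun E ↦ ?_
  have h1 := LinearMap.congr_fun hk E
  rw [LinearMap.smul_apply, LinearMap.smul_apply, nsmul_eq_mul, nsmul_eq_mul, ← sub_eq_zero,
    ← mul_sub] at h1
  exact sub_eq_zero.mp ((mem_nonZeroDivisors_iff.mp hq).1 _ h1)

lemma IsLeibniz.evalMap_mul_congr (hX : IsLeibniz X) {u u' v v' : B} (hu : evalMap X u = evalMap X u')
    (hv : evalMap X v = evalMap X v') : evalMap X (u * v) = evalMap X (u' * v') := by
  refine LinearMap.ext fun E ↦ ?_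
  have h : ∀ T ∈ Submodule.span R {T : B → B → R | ∃ E ∈ X, ∃ E' ∈ X, T = fun u v ↦ E u * E' v},
      T u v = T u' v' := by
    intro T hT
    induction hT using Submodule.span_induction with
    | mem T hT =>
      obtain ⟨E, hE, E', hE', rfl⟩ := hT
      exact congrArg₂ (· * ·) (LinearMap.congr_fun hu ⟨E, hE⟩) (LinearMap.congr_fun hv ⟨E', hE'⟩)
    | zero => rfl
    | add T T' _ _ h h' => exact congrArg₂ (· + ·) h h'
    | smul r T _ h => exact congrArg (r • ·) h
  exact h _ (hX E E.2)

/-- Each product of values E(u)E'(v) is divisible by q², hence so is E(uv). The quotient is unique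
by regularity, and is therefore linear in E. -/
lemma IsLeibniz.exists_nsmul_eq (hX : IsLeibniz X) {q : ℕ} (hq : (q : R) ∈ R⁰) {u v : B}
    {h k : Module.Dual R X} (hu : evalMap X u = q • h) (hv : evalMap X v = q • k) :
    ∃ w : Module.Dual R X, evalMap X (u * v) = (q * q) • w := by
  have hdvd : ∀ T ∈ Submodule.span R {T : B → B → R | ∃ E ∈ X, ∃ E' ∈ X, T = fun u v ↦ E u * E' v},
      ∃ r, T u v = ((q * q : ℕ) : R) * r := by
    intro T hT
    induction hT using Submodule.span_induction with
    | mem T hT =>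
      obtain ⟨E, hE, E', hE', rfl⟩ := hT
      have h1 := LinearMap.congr_fun hu ⟨E, hE⟩
      have h2 := LinearMap.congr_fun hv ⟨E', hE'⟩
      rw [evalMap_apply, LinearMap.smul_apply, nsmul_eq_mul] at h1 h2
      refine ⟨h ⟨E, hE⟩ * k ⟨E', hE'⟩, ?_⟩
      dsimp only at h1 h2 ⊢
      rw [h1, h2]
      push_cast
      ring
    | zero => exact ⟨0, by simp⟩
    | add T T' _ _ h h' =>
      obtain ⟨r, hr⟩ := h
      obtain ⟨r', hr'⟩ := h'
      exact ⟨r + r', by rw [Pi.add_apply, Pi.add_apply, hr, hr', mul_add]⟩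
    | smul a T _ h =>
      obtain ⟨r, hr⟩ := h
      exact ⟨a * r, by rw [Pi.smul_apply, Pi.smul_apply, hr, smul_eq_mul]; ring⟩
  choose w hw using fun E : X ↦ hdvd _ (hX E E.2)
  have hqq : ((q * q : ℕ) : R) ∈ R⁰ := by
    rw [Nat.cast_mul]
    exact mul_mem hq hq
  have hc {a b : R} (hab : ((q * q : ℕ) : R) * a = ((q * q : ℕ) : R) * b) : a = b := by
    rw [← sub_eq_zero, ← mul_sub] at hab
    exact sub_eq_zero.mp ((mem_nonZeroDivisors_iff.mp hqq).1 _ hab)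
  refine ⟨⟨⟨w, fun E E' ↦ hc ?_⟩, fun r E ↦ hc ?_⟩, LinearMap.ext fun E ↦ ?_⟩
  · rw [← hw, mul_add, ← hw, ← hw]
    simp
  · rw [← hw, RingHom.id_apply, smul_eq_mul, mul_left_comm, ← hw]
    simp
  · rw [LinearMap.smul_apply, nsmul_eq_mul]
    exact hw E

/-- A multiplication on the dual of a module of linear forms. -/
lemma IsLeibniz.exists_mul (hX : IsLeibniz X) {q : ℕ} (hq : (q : R) ∈ R⁰)
    (hc : ∀ h : Module.Dual R X, ∃ u, evalMap X u = q • h) :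
    ∃ mul : Module.Dual R X → Module.Dual R X → Module.Dual R X, ∀ u v h k,
      evalMap X u = q • h → evalMap X v = q • k → evalMap X (u * v) = (q * q) • mul h k := by
  choose c hc using hc
  choose mul hmul using fun h k ↦ hX.exists_nsmul_eq hq (hc h) (hc k)
  refine ⟨mul, fun u v h k hu hv ↦ ?_⟩
  rw [← hmul]
  exact hX.evalMap_mul_congr (hu.trans (hc h).symm) (hv.trans (hc k).symm)

/-- Every identity is checked after multiplication by a power of q, where it becomes an identity in
B. That q is a natural number matters for uniqueness: a competing product is only known to be
biadditive, which allows integers, but not scalars of R, to be moved through it. -/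
theorem IsLeibniz.exists_unique_commRing (hX : IsLeibniz X) {q : ℕ} (hq : (q : R) ∈ R⁰)
    (hc : ∀ h : Module.Dual R X, ∃ u, evalMap X u = q • h) :
    ∃ S : CommRing (Module.Dual R X),
      ((∀ h k E, (S.add h k) E = h E + k E) ∧
        letI := S
        ∃ f : B →+* Module.Dual R X, ∀ u, f u = evalMap X u) ∧
      (∀ (r : R) h k, S.mul (r • h) k = r • S.mul h k) ∧
      ∀ S' : CommRing (Module.Dual R X), ((∀ h k E, (S'.add h k) E = h E + k E) ∧
        letI := S'
        ∃ f : B →+* Module.Dual R X, ∀ u, f u = evalMap X u) → S' = S := by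
  obtain ⟨mul, hmul⟩ := hX.exists_mul hq hc
  have hqq : ((q * q : ℕ) : R) ∈ R⁰ := by
    rw [Nat.cast_mul]
    exact mul_mem hq hq
  have hcomm (h k) : mul h k = mul k h := by
    obtain ⟨u, hu⟩ := hc h
    obtain ⟨v, hv⟩ := hc k
    refine nsmul_cancel hqq ?_
    rw [← hmul u v h k hu hv, ← hmul v u k h hv hu, mul_comm]
  have hadd (h k l) : mul h (k + l) = mul h k + mul h l := by
    obtain ⟨u, hu⟩ := hc h
    obtain ⟨v, hv⟩ := hc k
    obtain ⟨w, hw⟩ := hc l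
    refine nsmul_cancel hqq ?_
    rw [← hmul u (v + w) h _ hu (by rw [map_add, hv, hw, smul_add]), smul_add,
      ← hmul u v h k hu hv, ← hmul u w h l hu hw, mul_add, map_add]
  have hsmul (r : R) (h k) : mul (r • h) k = r • mul h k := by
    obtain ⟨u, hu⟩ := hc h
    obtain ⟨v, hv⟩ := hc k
    refine nsmul_cancel hqq ?_
    rw [← hmul (r • u) v _ k (by rw [map_smul, hu, smul_comm]) hv, smul_comm,
      ← hmul u v h k hu hv, smul_mul_assoc, map_smul]
  have heval (u v) : mul (evalMap X u) (evalMap X v) = evalMap X (u * v) := by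
    refine nsmul_cancel hqq ?_
    rw [← hmul (q • u) (q • v) _ _ (map_nsmul _ _ _) (map_nsmul _ _ _), smul_mul_smul_comm,
      map_nsmul]
  have hone (k) : mul (evalMap X 1) k = k := by
    obtain ⟨v, hv⟩ := hc k
    refine nsmul_cancel hqq ?_
    rw [← hmul (q • 1) v _ k (map_nsmul _ _ _) hv, smul_mul_assoc, one_mul, map_nsmul, hv, mul_smul]
  -- Three factors cost q³. The representative x of q·(hk) is related to uv only through c, by c(uv)
  -- = c(qx), so `evalMap_mul_congr` is used to multiply by w.
  have hassoc' {u v w : B} {h k l} (hu : evalMap X u = q • h) (hv : evalMap X v = q • k)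
      (hw : evalMap X w = q • l) : evalMap X (u * v * w) = q • (q * q) • mul (mul h k) l := by
    obtain ⟨x, hx⟩ := hc (mul h k)
    rw [← hmul x w _ l hx hw, ← map_nsmul, ← smul_mul_assoc]
    refine hX.evalMap_mul_congr ?_ rfl
    rw [hmul u v h k hu hv, map_nsmul, hx, mul_smul]
  have hassoc (h k l) : mul (mul h k) l = mul h (mul k l) := by
    obtain ⟨u, hu⟩ := hc h
    obtain ⟨v, hv⟩ := hc k
    obtain ⟨w, hw⟩ := hc l
    refine nsmul_cancel hqq (nsmul_cancel hq ?_)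
    rw [hcomm h (mul k l), ← hassoc' hu hv hw, ← hassoc' hv hw hu]
    congr 1
    ring
  have hzero (k) : mul 0 k = 0 := by
    simpa using hsmul 0 0 k
  have huniq {mul' : Module.Dual R X → Module.Dual R X → Module.Dual R X}
      (hl : ∀ h k l, mul' h (k + l) = mul' h k + mul' h l)
      (hr : ∀ h k l, mul' (h + k) l = mul' h l + mul' k l)
      (hm : ∀ u v, mul' (evalMap X u) (evalMap X v) = evalMap X (u * v)) (h k) :
      mul' h k = mul h k := by
    obtain ⟨u, hu⟩ := hc h
    obtain ⟨v, hv⟩ := hc k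
    have hln (n : ℕ) (h k) : mul' h (n • k) = n • mul' h k :=
      map_nsmul (AddMonoidHom.mk' (mul' h) (hl h)) n k
    have hrn (n : ℕ) (h k) : mul' (n • h) k = n • mul' h k :=
      map_nsmul (AddMonoidHom.mk' (fun h ↦ mul' h k) fun h h' ↦ hr h h' k) n h
    refine nsmul_cancel hqq ?_
    rw [← hmul u v h k hu hv, mul_smul, ← hln, ← hrn, ← hu, ← hv, hm]
  let S : CommRing (Module.Dual R X) :=
    { (inferInstance : AddCommGroup (Module.Dual R X)) with
      mul := mul
      one := evalMap X 1
      mul_assoc := hassoc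
      one_mul := hone
      mul_one := fun k ↦ (hcomm _ _).trans (hone k)
      left_distrib := hadd
      right_distrib := fun h k l ↦ by
        change mul (h + k) l = mul h l + mul k l
        rw [hcomm, hadd, hcomm l, hcomm l]
      zero_mul := hzero
      mul_zero := fun k ↦ (hcomm _ _).trans (hzero k)
      mul_comm := hcomm }
  refine ⟨S, ⟨fun h k E ↦ rfl, ⟨⟨⟨evalMap X, rfl⟩, fun u v ↦ (heval u v).symm⟩, map_zero _, map_add _⟩,
    fun u ↦ rfl⟩, hsmul, ?_⟩
  rintro S' ⟨hS', f, hf⟩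
  have hS'add (h k) : S'.add h k = h + k := LinearMap.ext fun E ↦ hS' h k E
  have hmul' : ∀ h k, S'.mul h k = mul h k := by
    refine huniq (fun h k l ↦ ?_) (fun h k l ↦ ?_) (fun u v ↦ ?_)
    · rw [← hS'add, ← hS'add]
      exact S'.left_distrib h k l
    · rw [← hS'add, ← hS'add]
      exact S'.right_distrib h k l
    · rw [← hf, ← hf, ← hf]
      exact (f.map_mul u v).symm
  refine CommRing.ext ?_ ?_
  · exact funext fun h ↦ funext fun k ↦ hS'add h k
  · exact funext fun h ↦ funext fun k ↦ hmul' h k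

end DualRing

end FormalGroupRing

end

noncomputable section

namespace FormalGroupRing

/-! ### The cokernel of the characteristic map is killed by a power of the torsion index -/

section CharacteristicMap

open scoped nonZeroDivisors

/-- Cramer's rule solves E_v(u) = q·h(E_v) for all v. For other E', the relation for q·E' gives the
equation multiplied by q, which is then cancelled. -/
lemma exists_evalMap_eq_nsmul {R B n : Type*} [CommRing R] [CommRing B] [Algebra R B]
    {X : Submodule R (Module.Dual R B)} [Fintype n] [DecidableEq n] {E : n → X} {e : n → B} {q : ℕ}
    (hq : (q : R) ∈ R⁰) (hdet : (Matrix.of fun v w ↦ (E v : Module.Dual R B) (e w)).det = q)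
    (hspan : ∀ E' ∈ X, ∃ d : n → R, ∀ u, (q : R) * E' u = ∑ v, d v * (E v : Module.Dual R B) u)
    (h : Module.Dual R X) : ∃ u, evalMap X u = q • h := by
  set A : Matrix n n R := Matrix.of fun v w ↦ (E v : Module.Dual R B) (e w) with hA
  set r : n → R := Matrix.mulVec A.adjugate fun v ↦ h (E v)
  have hr (v : n) : (E v : Module.Dual R B) (∑ w, r w • e w) = q * h (E v) := by
    have h1 : Matrix.mulVec A r = (q : R) • fun v ↦ h (E v) := by
      rw [Matrix.mulVec_mulVec, Matrix.mul_adjugate, hdet, Matrix.smul_mulVec, Matrix.one_mulVec]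
    have h2 := congrFun h1 v
    rw [Pi.smul_apply, smul_eq_mul] at h2
    rw [← h2, map_sum]
    refine Finset.sum_congr rfl fun w _ ↦ ?_
    rw [map_smul, smul_eq_mul, mul_comm]
    rfl
  refine ⟨∑ w, r w • e w, LinearMap.ext fun E' ↦ ?_⟩
  obtain ⟨d, hd⟩ := hspan E' E'.2
  have h1 : (q : R) • E' = ∑ v, d v • E v := by
    refine Subtype.ext (LinearMap.ext fun u ↦ ?_)
    simpa using hd u
  have h2 := congrArg h h1
  simp only [map_smul, map_sum, smul_eq_mul] at h2
  have h3 := hd (∑ w, r w • e w)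
  simp only [hr] at h3
  rw [evalMap_apply, LinearMap.smul_apply, nsmul_eq_mul, ← sub_eq_zero]
  refine (mem_nonZeroDivisors_iff.mp hq).1 _ ?_
  rw [mul_sub, h3, h2, Finset.mul_sum, ← Finset.sum_sub_distrib]
  exact Finset.sum_eq_zero fun v _ ↦ by ring

lemma isLeibniz_map {R B : Type*} [CommRing R] [CommRing B] [Algebra R B] (ε : B →ₐ[R] R)
    {𝒟 : Subalgebra R (Module.End R B)}
    (h : ∀ D ∈ 𝒟, (fun u v ↦ D (u * v)) ∈ productSpan 𝒟) :
    IsLeibniz ((Subalgebra.toSubmodule 𝒟).map (LinearMap.compRight R ε.toLinearMap)) := by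
  rintro _ ⟨D, hD, rfl⟩
  have key : ∀ T ∈ productSpan 𝒟, (fun u v ↦ ε (T u v)) ∈
      Submodule.span R {T : B → B → R |
        ∃ E ∈ (Subalgebra.toSubmodule 𝒟).map (LinearMap.compRight R ε.toLinearMap),
        ∃ E' ∈ (Subalgebra.toSubmodule 𝒟).map (LinearMap.compRight R ε.toLinearMap),
          T = fun u v ↦ E u * E' v} := by
    intro T hT
    induction hT using Submodule.span_induction with
    | mem T hT =>
      obtain ⟨E, hE, E', hE', rfl⟩ := hT
      refine Submodule.subset_span ⟨_, ⟨E, hE, rfl⟩, _, ⟨E', hE', rfl⟩, ?_⟩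
      simp
    | zero =>
      simp only [Pi.zero_apply, map_zero]
      exact Submodule.zero_mem _
    | add T T' _ _ h h' =>
      simp only [Pi.add_apply, map_add]
      exact add_mem h h'
    | smul r T _ h =>
      simp only [Pi.smul_apply, map_smul]
      exact Submodule.smul_mem _ r h
  exact key _ (h D hD)

variable {R : Type*} [CommRing R] (F : FormalGroup R) [F.IsComm]
variable {ι M N : Type*} [AddCommGroup M] [Module.Finite ℤ M] [Module.Free ℤ M] [AddCommGroup N]
variable (P : RootDatum ι M N)

lemma rootDemazure_mem_operatorAlgebra (i : ι) : rootDemazure F P i ∈ operatorAlgebra P F :=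
  Algebra.subset_adjoin (Or.inl ⟨i, (isDemazureOperator_iff F P).mpr rfl⟩)

omit [F.IsComm] [Module.Finite ℤ M] [Module.Free ℤ M] in
lemma mulLeft_mem_operatorAlgebra (a : FGRing F M) :
    LinearMap.mulLeft R a ∈ operatorAlgebra P F :=
  Algebra.subset_adjoin (Or.inr ⟨a, rfl⟩)

lemma wordDemazure_mem_operatorAlgebra (L : List ι) : wordDemazure F P L ∈ operatorAlgebra P F :=
  Subalgebra.list_prod_mem _ fun D hD ↦ by
    obtain ⟨i, -, rfl⟩ := List.mem_map.mp hD
    exact rootDemazure_mem_operatorAlgebra F P i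

lemma isLeibniz_augOperatorModule : IsLeibniz (augOperatorModule P F) := by
  refine isLeibniz_map (FGRing.aug F M) fun D hD ↦ mem_productSpan_of_mem_adjoin ?_ hD
  rintro D (⟨i, hi⟩ | ⟨a, rfl⟩)
  · obtain rfl := (isDemazureOperator_iff F P).mp hi
    have hΔ := rootDemazure_mem_operatorAlgebra F P i
    -- The reflection itself is 1 - x_α Δ_α, an element of the operator algebra, so both terms of
    -- the twisted Leibniz rule are products of operators.
    have hs := sub_mem (one_mem _)
      (mul_mem (mulLeft_mem_operatorAlgebra F P (FGRing.x F (P.root i))) hΔ)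
    change _ ∈ productSpan (operatorAlgebra P F)
    convert add_mem (mul_mem_productSpan hΔ (one_mem _)) (mul_mem_productSpan hs hΔ) using 1
    refine funext fun u ↦ funext fun v ↦ ?_
    rw [rootDemazure_mul, ← map_reflectBy_root, Pi.add_apply, Pi.add_apply, LinearMap.sub_apply,
      Module.End.mul_apply, Module.End.one_apply, Module.End.one_apply, LinearMap.mulLeft_apply,
      rootDemazure, x_mul_demazure, sub_sub_cancel]
  · change _ ∈ productSpan (operatorAlgebra P F)
    convert mul_mem_productSpan (mulLeft_mem_operatorAlgebra F P a) (one_mem _) using 1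
    refine funext fun u ↦ funext fun v ↦ ?_
    rw [LinearMap.mulLeft_apply, LinearMap.mulLeft_apply, Module.End.one_apply, mul_assoc]

variable {P} [Fintype ι] [P.IsReduced] {b : P.Base}

lemma exists_charMap_eq_nsmul (ht : (torsionIndex b : R) ∈ R⁰) :
    ∃ q : ℕ, (q : R) ∈ R⁰ ∧ ∀ h : DualModule P F, ∃ u, charMap P F u = q • h := by
  classical
  -- The value 0 can only be the default of the infimum on the empty set. Its image being regular
  -- makes R the zero ring, over which the claim is trivial.
  by_cases h0 : torsionIndex b = 0
  · rw [h0, Nat.cast_zero] at ht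
    have : Subsingleton R := 
      subsingleton_of_forall_eq 0 fun r ↦ (mem_nonZeroDivisors_iff.mp ht).1 r (zero_mul r)
    exact ⟨1, by simp, fun h ↦ ⟨0, LinearMap.ext fun E ↦ Subsingleton.elim _ _⟩⟩
  have := finite_weylGroup b
  have := Fintype.ofFinite P.weylGroup
  obtain ⟨I, e, n, hn⟩ := exists_matrix_det_mem_powers (R := R) F h0
  have hn' : (Matrix.of fun v w ↦ FGRing.aug F M (wordDemazure F P (I v) (e w))).det =
      ((torsionIndex b ^ n : ℕ) : R) := by
    rw [← hn, Nat.cast_pow]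
  have hq : ((torsionIndex b ^ n : ℕ) : R) ∈ R⁰ := by
    rw [Nat.cast_pow]
    exact pow_mem ht n
  refine ⟨torsionIndex b ^ n, hq, exists_evalMap_eq_nsmul (X := augOperatorModule P F)
    (E := fun v ↦ ⟨_, wordDemazure F P (I v), wordDemazure_mem_operatorAlgebra F P _, rfl⟩)
    hq hn' ?_⟩
  rintro _ ⟨D, hD, rfl⟩
  obtain ⟨d, hd⟩ := exists_det_mul_aug_eq F b (fun v ↦ wordDemazure_mem_operatorAlgebra F P (I v))
    (by rw [hn']; exact hq) hD
  rw [hn'] at hd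
  exact ⟨d, hd⟩

end CharacteristicMap

end FormalGroupRing

end

theorem mainTheorem5 {ι M N R : Type*} [Finite ι] [AddCommGroup M] [AddCommGroup N]
    [Module.Finite ℤ M] [Module.Free ℤ M] (P : RootDatum ι M N) [P.IsReduced] (b : P.Base)
    [CommRing R] (F : FormalGroup R) [F.IsComm]
    (ht : (FormalGroupRing.torsionIndex b : R) ∈ nonZeroDivisors R) :
    ∃ S : CommRing (FormalGroupRing.DualModule P F),
      FormalGroupRing.IsCharRingStructure P F S ∧
      (∀ (r : R) (h k : FormalGroupRing.DualModule P F), S.mul (r • h) k = r • S.mul h k) ∧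
      ∀ S' : CommRing (FormalGroupRing.DualModule P F),
        FormalGroupRing.IsCharRingStructure P F S' → S' = S := by
  have := Fintype.ofFinite ι
  obtain ⟨q, hq, hc⟩ := FormalGroupRing.exists_charMap_eq_nsmul F ht
  exact (FormalGroupRing.isLeibniz_augOperatorModule F P).exists_unique_commRing hq hc
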